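/- **Theorem A1.** Let $G$ be a (real, Hausdorff) Lie group, not necessarily connected, with Lie algebra $\mathfrak g$, let $\Gamma\subset G$ be a discrete subgroup, $X=G/\Gamma$, and let $f:X\to X$ be an affine map, that is, $f(h\Gamma)=g\,\sigma(h)\Gamma$ $(h\in G)$ for some $g\in G$ and some Lie group automorphism $\sigma$ of $G$ with $\sigma(\Gamma)\subset\Gamma$. Let $\sigma_f(h)=g\sigma(h)g^{-1}$ and let $T=d\sigma_f:\mathfrak g\to\mathfrak g$ be its differential at the identity. Let $Z\subset X$ be a $C^1$ submanifold, namely the image of an injective $C^1$ immersion of a second countable $C^1$ manifold into $X$ (in particular, $Z$ may be any second countable embedded submanifold); $T_zZ$ denotes the image of the differential of the immersion. If $Z$ is $G_f^{\max}$-transversal, i.e. $T_z(G_f^{\max}z)\not\subset T_zZ$ for every $z\in Z$, then the set $$E(f,Z)=\{x\in X:\ \overline{\{f^n(x):n\ge 0\}}\cap Z=\emptyset\}$$ is hyperplane absolute winning (HAW). *The group $G_f^{\max}$.* Let $\operatorname{Sp}(T)\subset\mathbb C$ be the set of eigenvalues of the complexification of $T$, $\rho=\max_{\lambda\in\operatorname{Sp}(T)}|\lambda|$,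 $s(\lambda)$ the multiplicity of $\lambda$ in the minimal polynomial $p_0$ of $T$, and $s=\max\{s(\lambda):|\lambda|=\rho\}$. There is a unique real polynomial $p_T$ with $\deg p_T<\deg p_0$ such that, modulo $(x-\lambda)^{s(\lambda)}$, $p_T\equiv(x-\lambda)^{s-1}$ if $|\lambda|=\rho$ and $s(\lambda)=s$, and $p_T\equiv 0$ for the other $\lambda\in\operatorname{Sp}(T)$. Put $\mathfrak g_f^{\max}=\operatorname{Im}p_T(T)$ if $\rho>1$ and $\mathfrak g_f^{\max}=\{0\}$ if $\rho\le 1$. Then $G_f^{\max}$ is the connected Lie subgroup of $G$ with Lie algebra $\mathfrak g_f^{\max}$ (the subgroup generated by $\exp\mathfrak g_f^{\max}$). The tangent space $T_z(Hz)$ to the orbit of a Lie subgroup $H$ is the image of the Lie algebra of $H$ under the differential at $1$ of $h\mapsto hz$. *HAW sets.* Let $U$ be an open subset of a Euclidean space $V$, $S\subset U$ and $0<\beta<\frac13$. In the $\beta$-hyperplane absolute game Bob first chooses a closed ball $B_0\subset U$ of radius $r_0>0$. After Bob has chosen a closed ball $B_i$ of radius $r_i$, Alice chooses an affine hyperplane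 $L_i\subset V$ and $0<r_i'\le\beta r_i$, and then Bob chooses a closed ball $B_{i+1}\subset B_i\setminus\{v:\operatorname{dist}(v,L_i)<r_i'\}$ of radius $r_{i+1}\ge\beta r_i$. Alice wins if $\bigcap_iB_i\cap S\ne\emptyset$. (If $\dim V=0$, the only hyperplane is the empty set.) The set $S$ is HAW on $U$ if Alice has a winning strategy for every $\beta\in(0,\frac13)$. A subset $S$ of a $C^1$ manifold $X$ is HAW if $\varphi(S\cap W)$ is HAW on $\varphi(W)$ for every $C^1$ chart $\varphi:W\to\varphi(W)\subset\mathbb R^{\dim X}$ of $X$. -/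

import Mathlib

open scoped Manifold ContDiff Topology Polynomial

noncomputable section

namespace NondenseOrbits

/-! ### The hyperplane absolute game -/

section Game

variable {V : Type*} [NormedAddCommGroup V] [InnerProductSpace ℝ V]

/-- Affine hyperplanes, i.e. the maximal proper affine subspaces: these are the affine subspaces of
codimension one. (If `V` is a point, the only hyperplane is the empty one.) -/
def IsHyperplane (L : AffineSubspace ℝ V) : Prop := IsCoatom L

/-- A strategy of Alice: it reads the balls (centre and radius) that Bob has chosen so far, in
chronological order, and returns a pair `(L, r')`, standing for the hyperplane neighbourhood
`{v | dist (v, L) < r'}`. -/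
abbrev AliceStrategy (V : Type*) [NormedAddCommGroup V] [InnerProductSpace ℝ V] : Type _ :=
  List (V × ℝ) → AffineSubspace ℝ V × ℝ

/-- The strategy respects the rules: if the last ball chosen by Bob has radius `r`, then the answer
is a neighbourhood of a hyperplane of size `r'` with `0 < r' ≤ β r`. -/
def AliceStrategy.IsLegal (A : AliceStrategy V) (β : ℝ) : Prop :=
  ∀ (h : List (V × ℝ)) (b : V × ℝ), 0 < b.2 →
    IsHyperplane (A (h ++ [b])).1 ∧ 0 < (A (h ++ [b])).2 ∧ (A (h ++ [b])).2 ≤ β * b.2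

/-- Alice's answer in round `i` if Bob chooses the balls `B 0, B 1, …`. -/
def AliceStrategy.answer (A : AliceStrategy V) (B : ℕ → V × ℝ) (i : ℕ) :
    AffineSubspace ℝ V × ℝ :=
  A ((List.range (i + 1)).map B)

/-- The sequence of balls `B` is a legal sequence of moves of Bob, in the `β`-game on `U`, against
the strategy `A`. -/
structure IsBobPlay (β : ℝ) (U : Set V) (A : AliceStrategy V) (B : ℕ → V × ℝ) : Prop where
  radius_pos : ∀ i, 0 < (B i).2
  start : Metric.closedBall (B 0).1 (B 0).2 ⊆ U
  subset : ∀ i, Metric.closedBall (B (i + 1)).1 (B (i + 1)).2 ⊆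
    Metric.closedBall (B i).1 (B i).2 \
      Metric.thickening (A.answer B i).2 ((A.answer B i).1 : Set V)
  radius_le : ∀ i, β * (B i).2 ≤ (B (i + 1)).2

/-- `S` is `β`-hyperplane absolute winning on `U`: Alice has a winning strategy. -/
def IsBetaHAWOn (β : ℝ) (S U : Set V) : Prop :=
  ∃ A : AliceStrategy V, A.IsLegal β ∧ ∀ B : ℕ → V × ℝ, IsBobPlay β U A B →
    ((⋂ i, Metric.closedBall (B i).1 (B i).2) ∩ S).Nonempty

/-- `S` is hyperplane absolute winning on the open set `U`. -/
def IsHAWOn (S U : Set V) : Prop :=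
  ∀ β : ℝ, 0 < β → β < 1 / 3 → IsBetaHAWOn β S U

end Game

/-- A subset `S` of a `C^1` manifold is HAW if its image in every `C^1` chart is HAW on the image of
the chart. -/
def IsHAW (d : ℕ) {X : Type*} [TopologicalSpace X] [ChartedSpace (EuclideanSpace ℝ (Fin d)) X]
    (S : Set X) : Prop :=
  ∀ e ∈ IsManifold.maximalAtlas (𝓡 d) 1 X, IsHAWOn (e '' (S ∩ e.source)) e.target

/-- The set `E(f, Z)` of points whose forward orbit closure misses `Z`. -/
def avoidanceSet {X : Type*} [TopologicalSpace X] (f : X → X) (Z : Set X) : Set X :=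
  {x | closure (Set.range fun n : ℕ => f^[n] x) ∩ Z = ∅}

/-! ### The polynomial attached to a linear transformation -/

section LinearAlgebra

variable {V : Type*} [AddCommGroup V] [Module ℝ V]

/-- The set of eigenvalues of the complexification of `T`. -/
def complexEigenvalues (T : V →ₗ[ℝ] V) : Set ℂ :=
  {z | Module.End.HasEigenvalue (T.baseChange ℂ : Module.End ℂ (TensorProduct ℝ ℂ V)) z}

/-- The spectral radius of `T`. -/
def rho (T : V →ₗ[ℝ] V) : ℝ := sSup ((fun z : ℂ => ‖z‖) '' complexEigenvalues T)

/-- The minimal polynomial of `T`, as a complex polynomial. -/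
def complexMinpoly (T : V →ₗ[ℝ] V) : ℂ[X] := (minpoly ℝ T).map (algebraMap ℝ ℂ)

/-- The multiplicity of `z` in the minimal polynomial of `T`. -/
def minpolyMultiplicity (T : V →ₗ[ℝ] V) (z : ℂ) : ℕ := (complexMinpoly T).rootMultiplicity z

/-- The largest multiplicity, in the minimal polynomial, of an eigenvalue of maximal modulus. -/
def maxMultiplicity (T : V →ₗ[ℝ] V) : ℕ :=
  sSup (minpolyMultiplicity T '' {z ∈ complexEigenvalues T | ‖z‖ = rho T})

open Classical in
/-- The properties that characterize the real polynomial `p_T`. -/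
def IsLeadingPolynomial (T : V →ₗ[ℝ] V) (p : ℝ[X]) : Prop :=
  p.degree < (minpoly ℝ T).degree ∧
  ∀ z ∈ complexEigenvalues T,
    (Polynomial.X - Polynomial.C z) ^ minpolyMultiplicity T z ∣
      p.map (algebraMap ℝ ℂ) -
        (if ‖z‖ = rho T ∧ minpolyMultiplicity T z = maxMultiplicity T
          then (Polynomial.X - Polynomial.C z) ^ (maxMultiplicity T - 1) else 0)

lemma mem_complexEigenvalues_iff [FiniteDimensional ℝ V] (T : V →ₗ[ℝ] V) (z : ℂ) :
    z ∈ complexEigenvalues T ↔ (complexMinpoly T).IsRoot z := by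
  constructor
  · rintro h
    obtain ⟨v, hv⟩ := Module.End.HasEigenvalue.exists_hasEigenvector h
    have h1 := Module.End.aeval_apply_of_hasEigenvector (p := complexMinpoly T) hv
    have h2 : Polynomial.aeval (T.baseChange ℂ : Module.End ℂ (TensorProduct ℝ ℂ V))
        (complexMinpoly T) = 0 := by
      rw [complexMinpoly, Polynomial.aeval_map_algebraMap]
      have h3 := Polynomial.aeval_algHom_apply (Module.End.baseChangeHom ℝ ℂ V) T (minpoly ℝ T)
      rw [minpoly.aeval, map_zero] at h3
      exact h3
    rw [h2] at h1
    simpa [hv.2] using h1.symm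
  · intro h
    refine (Module.End.hasEigenvalue_iff_isRoot_charpoly _ _).2 ?_
    rw [LinearMap.charpoly_baseChange]
    exact h.dvd (Polynomial.map_dvd _ (LinearMap.minpoly_dvd_charpoly T))

lemma complexMinpoly_ne_zero [FiniteDimensional ℝ V] (T : V →ₗ[ℝ] V) : complexMinpoly T ≠ 0 :=
  ((minpoly.monic (Algebra.IsIntegral.isIntegral T)).map _).ne_zero

lemma finite_complexEigenvalues [FiniteDimensional ℝ V] (T : V →ₗ[ℝ] V) :
    (complexEigenvalues T).Finite := by
  refine (complexMinpoly T).roots.toFinset.finite_toSet.subset fun z hz => ?_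
  simpa [complexMinpoly_ne_zero T] using (mem_complexEigenvalues_iff T z).1 hz

/-- A real polynomial is divisible by the minimal polynomial as soon as it vanishes to sufficiently
high order at all the eigenvalues. -/
lemma minpoly_dvd_of_forall [FiniteDimensional ℝ V] (T : V →ₗ[ℝ] V) (p : ℝ[X])
    (h : ∀ z ∈ complexEigenvalues T,
      (Polynomial.X - Polynomial.C z) ^ minpolyMultiplicity T z ∣ p.map (algebraMap ℝ ℂ)) :
    minpoly ℝ T ∣ p := by
  classical
  rw [← Polynomial.map_dvd_map' (algebraMap ℝ ℂ)]
  change complexMinpoly T ∣ _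
  by_cases hp : p.map (algebraMap ℝ ℂ) = 0
  · simp [hp]
  refine (IsAlgClosed.splits (complexMinpoly T)).dvd_of_roots_le_roots
    (complexMinpoly_ne_zero T) ?_
  rw [Multiset.le_iff_count]
  intro z
  rw [Polynomial.count_roots, Polynomial.count_roots]
  by_cases hz : (complexMinpoly T).IsRoot z
  · exact (Polynomial.le_rootMultiplicity_iff hp).2 (h z ((mem_complexEigenvalues_iff T z).2 hz))
  · simp [Polynomial.rootMultiplicity_eq_zero hz]

/-- The polynomial `p_T` exists and is unique. -/
theorem existsUnique_isLeadingPolynomial [FiniteDimensional ℝ V] (T : V →ₗ[ℝ] V) :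
    ∃! p : ℝ[X], IsLeadingPolynomial T p := by
  classical
  have hmonic : (minpoly ℝ T).Monic := minpoly.monic (Algebra.IsIntegral.isIntegral T)
  refine existsUnique_of_exists_of_unique ?_ ?_
  · have := (finite_complexEigenvalues T).to_subtype
    let t : ℂ → ℂ[X] := fun z =>
      if ‖z‖ = rho T ∧ minpolyMultiplicity T z = maxMultiplicity T
        then (Polynomial.X - Polynomial.C z) ^ (maxMultiplicity T - 1) else 0
    let m : ℂ → ℂ[X] := fun z => (Polynomial.X - Polynomial.C z) ^ minpolyMultiplicity T z
    have hconjp : ∀ p : ℝ[X],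
        (p.map (algebraMap ℝ ℂ)).map (starRingEnd ℂ) = p.map (algebraMap ℝ ℂ) := by
      intro p
      rw [Polynomial.map_map]
      congr 1
      ext x
      simp
    have hmult : ∀ z, minpolyMultiplicity T (starRingEnd ℂ z) = minpolyMultiplicity T z := by
      intro z
      have h1 := Polynomial.eq_rootMultiplicity_map (p := complexMinpoly T)
        (f := starRingEnd ℂ) (starRingEnd ℂ).injective z
      rw [complexMinpoly, hconjp] at h1
      exact h1.symm
    have hconjE : ∀ z ∈ complexEigenvalues T, starRingEnd ℂ z ∈ complexEigenvalues T := by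
      intro z hz
      rw [mem_complexEigenvalues_iff] at hz ⊢
      have h1 := hz.map (f := starRingEnd ℂ)
      rwa [complexMinpoly, hconjp] at h1
    have ht : ∀ z, (t (starRingEnd ℂ z)).map (starRingEnd ℂ) = t z := by
      intro z
      simp only [t, hmult, RCLike.norm_conj]
      split_ifs <;> simp
    have hm : ∀ z, (m (starRingEnd ℂ z)).map (starRingEnd ℂ) = m z := by
      intro z
      simp [m, hmult]
    obtain ⟨q, hq⟩ := Ideal.exists_forall_sub_mem_ideal
      (I := fun z : complexEigenvalues T => Ideal.span {m z}) (by
        intro a b hab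
        refine Ideal.isCoprime_span_singleton_iff _ _ |>.2 ?_
        exact (Polynomial.pairwise_coprime_X_sub_C Subtype.val_injective hab).pow)
      (fun z => t z)
    replace hq : ∀ z ∈ complexEigenvalues T, m z ∣ q - t z := fun z hz =>
      Ideal.mem_span_singleton.1 (hq ⟨z, hz⟩)
    have hq' : ∀ z ∈ complexEigenvalues T, m z ∣ q.map (starRingEnd ℂ) - t z := by
      intro z hz
      have h1 := Polynomial.map_dvd (starRingEnd ℂ) (hq _ (hconjE z hz))
      rwa [Polynomial.map_sub, ht, hm] at h1
    let r : ℝ[X] := ∑ i ∈ q.support, Polynomial.monomial i (q.coeff i).re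
    have hr : Polynomial.C 2 * r.map (algebraMap ℝ ℂ) = q + q.map (starRingEnd ℂ) := by
      ext i
      have : r.coeff i = (q.coeff i).re := by
        simp only [r, Polynomial.finsetSum_coeff, Polynomial.coeff_monomial]
        simp +contextual
      simp [Polynomial.coeff_C_mul, this, Complex.add_conj]
    have hr' : ∀ z ∈ complexEigenvalues T, m z ∣ r.map (algebraMap ℝ ℂ) - t z := by
      intro z hz
      have h1 : r.map (algebraMap ℝ ℂ) - t z = Polynomial.C (1 / 2 : ℂ) *
          ((q - t z) + (q.map (starRingEnd ℂ) - t z)) := by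
        have h2 : (q - t z) + (q.map (starRingEnd ℂ) - t z) =
            Polynomial.C 2 * (r.map (algebraMap ℝ ℂ) - t z) := by
          rw [mul_sub, hr, map_ofNat]
          ring
        rw [h2, ← mul_assoc, ← Polynomial.C_mul]
        norm_num
      rw [h1]
      exact Dvd.dvd.mul_left (dvd_add (hq z hz) (hq' z hz)) _
    refine ⟨r %ₘ minpoly ℝ T, Polynomial.degree_modByMonic_lt _ hmonic, fun z hz => ?_⟩
    change m z ∣ (r %ₘ minpoly ℝ T).map (algebraMap ℝ ℂ) - t z
    have h1 : (r %ₘ minpoly ℝ T).map (algebraMap ℝ ℂ) - t z = (r.map (algebraMap ℝ ℂ) - t z)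
        - complexMinpoly T * (r /ₘ minpoly ℝ T).map (algebraMap ℝ ℂ) := by
      rw [Polynomial.modByMonic_eq_sub_mul_div, Polynomial.map_sub, Polynomial.map_mul,
        complexMinpoly]
      ring
    rw [h1]
    exact dvd_sub (hr' z hz) (Dvd.dvd.mul_right (Polynomial.pow_rootMultiplicity_dvd _ _) _)
  · intro p q hp hq
    have h1 : minpoly ℝ T ∣ p - q := by
      refine minpoly_dvd_of_forall T _ fun z hz => ?_
      have h2 := dvd_sub (hp.2 z hz) (hq.2 z hz)
      rwa [sub_sub_sub_cancel_right, ← Polynomial.map_sub] at h2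
    have h2 : (p - q).degree < (minpoly ℝ T).degree :=
      (Polynomial.degree_sub_le _ _).trans_lt (max_lt hp.1 hq.1)
    exact sub_eq_zero.1 (Polynomial.eq_zero_of_dvd_of_degree_lt h1 h2)

/-- The polynomial `p_T`. -/
def leadingPolynomial [FiniteDimensional ℝ V] (T : V →ₗ[ℝ] V) : ℝ[X] :=
  (existsUnique_isLeadingPolynomial T).choose

open Classical in
/-- The image of `p_T(T)` if the spectral radius of `T` is larger than `1`, and `0` otherwise. -/
def maxExpandingSubspace [FiniteDimensional ℝ V] (T : V →ₗ[ℝ] V) : Submodule ℝ V :=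
  if 1 < rho T then LinearMap.range (Polynomial.aeval T (leadingPolynomial T)) else ⊥

end LinearAlgebra

/-! ### Lie groups and their subgroups -/

section LieGroup

variable {d : ℕ} {G : Type*} [TopologicalSpace G] [ChartedSpace (EuclideanSpace ℝ (Fin d)) G]
  [Group G]

instance : FiniteDimensional ℝ (GroupLieAlgebra (𝓡 d) G) :=
  inferInstanceAs (FiniteDimensional ℝ (EuclideanSpace ℝ (Fin d)))

variable (d) in
/-- A (smooth) one-parameter subgroup of `G`. -/
structure IsOneParameterSubgroup (φ : ℝ → G) : Prop where
  contMDiff : ContMDiff 𝓘(ℝ, ℝ) (𝓡 d) ∞ φ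
  map_add : ∀ s t, φ (s + t) = φ s * φ t

variable (d) in
/-- The velocity at time `0` of a curve `φ` in `G` with `φ 0 = 1`. -/
def velocity (φ : ℝ → G) : GroupLieAlgebra (𝓡 d) G :=
  mfderiv 𝓘(ℝ, ℝ) (𝓡 d) φ 0 (1 : ℝ)

/-- The Lie algebra of a Lie subgroup `H` of `G`: all vectors `v` with `exp (t v) ∈ H` for all
`t`. -/
def lieAlgebraOf (H : Subgroup G) : Set (GroupLieAlgebra (𝓡 d) G) :=
  {v | ∃ φ : ℝ → G, IsOneParameterSubgroup d φ ∧ (∀ t, φ t ∈ H) ∧ velocity d φ = v}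

/-- The connected Lie subgroup of `G` with Lie algebra `𝔥`, that is, the subgroup generated by
`exp 𝔥`. -/
def connectedLieSubgroup (𝔥 : Submodule ℝ (GroupLieAlgebra (𝓡 d) G)) : Subgroup G :=
  Subgroup.closure {g | ∃ φ : ℝ → G, IsOneParameterSubgroup d φ ∧ velocity d φ ∈ 𝔥 ∧ φ 1 = g}

variable (d) in
/-- The differential at the identity of an endomorphism of `G`. -/
def differentialAtOne (τ : G →* G) : GroupLieAlgebra (𝓡 d) G →ₗ[ℝ] GroupLieAlgebra (𝓡 d) G where
  toFun v := mfderiv (𝓡 d) (𝓡 d) τ 1 v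
  map_add' v w := map_add (mfderiv (𝓡 d) (𝓡 d) τ 1) v w
  map_smul' c v := map_smul (mfderiv (𝓡 d) (𝓡 d) τ 1) c v

/-- `σ` is an automorphism of the Lie group `G` that sends `Γ` into `Γ`. -/
structure IsLieAutInto (d : ℕ) {G : Type*} [TopologicalSpace G]
    [ChartedSpace (EuclideanSpace ℝ (Fin d)) G] [Group G] (Γ : Subgroup G) (σ : G ≃* G) : Prop where
  contMDiff : ContMDiff (𝓡 d) (𝓡 d) ∞ σ
  contMDiff_symm : ContMDiff (𝓡 d) (𝓡 d) ∞ σ.symm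
  map_mem : ∀ γ ∈ Γ, σ γ ∈ Γ

/-- The automorphism `σ_f (h) = g σ(h) g⁻¹` attached to the affine map `f (h Γ) = g σ(h) Γ`. -/
def affineAut {G : Type*} [Group G] (g : G) (σ : G ≃* G) : G →* G :=
  (MulAut.conj g).toMonoidHom.comp σ.toMonoidHom

/-- The maximally expanding horospherical subgroup of `G` relative to the affine map
`f (h Γ) = g σ(h) Γ`. -/
def maxHorospherical (d : ℕ) {G : Type*} [TopologicalSpace G]
    [ChartedSpace (EuclideanSpace ℝ (Fin d)) G] [Group G] (g : G) (σ : G ≃* G) : Subgroup G :=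
  connectedLieSubgroup (maxExpandingSubspace (differentialAtOne d (affineAut g σ)))

end LieGroup

/-! ### The manifold `G ⧸ Γ` -/

section Quotient

variable {d : ℕ} {G : Type*} [TopologicalSpace G] [ChartedSpace (EuclideanSpace ℝ (Fin d)) G]
  [Group G] [LieGroup (𝓡 d) ∞ G]

/-- The projection of a Lie group onto its quotient by a discrete subgroup is a local
homeomorphism. -/
theorem isLocalHomeomorph_mk (d : ℕ) {G : Type*} [TopologicalSpace G]
    [ChartedSpace (EuclideanSpace ℝ (Fin d)) G] [Group G] [LieGroup (𝓡 d) ∞ G] (Γ : Subgroup G) [DiscreteTopology Γ] :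
    IsLocalHomeomorph (QuotientGroup.mk : G → G ⧸ Γ) :=
  haveI := topologicalGroup_of_lieGroup (𝓡 d) ∞ (G := G)
  (Γ.isQuotientCoveringMap
    (SetLike.isDiscrete_iff_discreteTopology.2 inferInstance)).isCoveringMap.isLocalHomeomorph

/-- The quotient of a Lie group by a discrete subgroup is a manifold: the charts are the charts
of `G`, composed with local inverses of the projection. -/
instance quotientChartedSpace (Γ : Subgroup G) [DiscreteTopology Γ] :
    ChartedSpace (EuclideanSpace ℝ (Fin d)) (G ⧸ Γ) :=
  (isLocalHomeomorph_mk d Γ).chartedSpace QuotientGroup.mk_surjective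

/-- A local inverse of the projection, preceded by the projection, is smooth. -/
lemma contMDiffAt_localInverse_mk (Γ : Subgroup G) [DiscreteTopology Γ] (b a : G)
    (ha : (a : G ⧸ Γ) ∈ ((isLocalHomeomorph_mk d Γ).localInverseAt b).source) :
    ContMDiffAt (𝓡 d) (𝓡 d) ∞
      (fun x : G => (isLocalHomeomorph_mk d Γ).localInverseAt b (x : G ⧸ Γ)) a := by
  have := topologicalGroup_of_lieGroup (𝓡 d) ∞ (G := G)
  set hπ := isLocalHomeomorph_mk d Γ
  set e := hπ.localInverseAt b with he
  have h1 : ((e (a : G ⧸ Γ) : G) : G ⧸ Γ) = a := hπ.apply_localInverseAt_of_mem ha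
  obtain ⟨γ, hγ⟩ : ∃ γ : Γ, e (a : G ⧸ Γ) = a * γ :=
    ⟨⟨a⁻¹ * e (a : G ⧸ Γ), QuotientGroup.eq.1 h1.symm⟩, by simp⟩
  have hc : Continuous fun x : G => (x : G ⧸ Γ) := hπ.continuous
  have h2 : ∀ᶠ x : G in 𝓝 a, (x : G ⧸ Γ) ∈ e.source :=
    hc.continuousAt.preimage_mem_nhds (e.open_source.mem_nhds ha)
  have h3 : ∀ᶠ x : G in 𝓝 a, x * (γ : G) ∈ e.target := by
    have : Continuous fun x : G => x * (γ : G) := continuous_mul_const _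
    exact this.continuousAt.preimage_mem_nhds (e.open_target.mem_nhds (hγ ▸ e.map_source ha))
  have h4 : (fun x : G => e (x : G ⧸ Γ)) =ᶠ[𝓝 a] fun x => x * (γ : G) := by
    filter_upwards [h2, h3] with x hx hx'
    refine hπ.injOn_localInverseAt_target (e.map_source hx) hx' ?_
    rw [hπ.apply_localInverseAt_of_mem hx]
    exact QuotientGroup.eq.2 (by simp)
  exact (contMDiff_mul_right (a := (γ : G))).contMDiffAt.congr_of_eventuallyEq h4

instance quotientIsManifold (Γ : Subgroup G) [DiscreteTopology Γ] :
    IsManifold (𝓡 d) ∞ (G ⧸ Γ) := by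
  have : IsManifold (𝓡 d) ∞ G := LieGroup.toContMDiffMul.toIsManifold
  refine isManifold_of_contDiffOn _ _ _ ?_
  rintro _ _ ⟨q, rfl⟩ ⟨q', rfl⟩
  set hπ := isLocalHomeomorph_mk d Γ
  generalize (QuotientGroup.mk_surjective (s := Γ)).hasRightInverse.choose q = a
  generalize (QuotientGroup.mk_surjective (s := Γ)).hasRightInverse.choose q' = b
  rw [← contMDiffOn_iff_contDiffOn]
  intro y hy
  have hy' := hy.1
  simp only [modelWithCornersSelf_coe_symm, Set.preimage_id, OpenPartialHomeomorph.trans_source,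
    OpenPartialHomeomorph.symm_source, OpenPartialHomeomorph.trans_target, Set.mem_inter_iff,
    Set.mem_preimage, OpenPartialHomeomorph.coe_trans_symm, Function.comp,
    IsLocalHomeomorph.localInverseAt_symm] at hy'
  obtain ⟨⟨h1, h2⟩, h3, h4⟩ := hy'
  apply ContMDiffAt.contMDiffWithinAt
  have k1 : ContMDiffAt (𝓡 d) (𝓡 d) ∞ (chartAt (EuclideanSpace ℝ (Fin d)) a).symm y :=
    (contMDiffOn_chart_symm (I := 𝓡 d)).contMDiffAt
      ((chartAt (EuclideanSpace ℝ (Fin d)) a).open_target.mem_nhds h1)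
  have k2 := contMDiffAt_localInverse_mk (d := d) Γ b _ h3
  have k3 : ContMDiffAt (𝓡 d) (𝓡 d) ∞ (chartAt (EuclideanSpace ℝ (Fin d)) b) _ :=
    (contMDiffOn_chart (I := 𝓡 d)).contMDiffAt
      ((chartAt (EuclideanSpace ℝ (Fin d)) b).open_source.mem_nhds h4)
  have k4 : ContMDiffAt (𝓡 d) (𝓡 d) ∞ (fun x : G =>
      chartAt (EuclideanSpace ℝ (Fin d)) b (hπ.localInverseAt b (x : G ⧸ Γ)))
      ((chartAt (EuclideanSpace ℝ (Fin d)) a).symm y) :=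
    ContMDiffAt.comp (g := chartAt (EuclideanSpace ℝ (Fin d)) b) _ k3 k2
  have k5 := ContMDiffAt.comp y k4 k1
  refine k5.congr_of_eventuallyEq (Filter.Eventually.of_forall fun x => ?_)
  simp [Function.comp]

/-- The tangent space at `x` of the orbit `H x` of a Lie subgroup `H` of `G`: the image of the Lie
algebra of `H` under the differential at `1` of the orbit map `h ↦ h x`. -/
def orbitTangent (Γ : Subgroup G) [DiscreteTopology Γ] (H : Subgroup G) (x : G ⧸ Γ) :
    Set (TangentSpace (𝓡 d) x) :=
  {w | ∃ v ∈ lieAlgebraOf (d := d) H, w = mfderiv (𝓡 d) (𝓡 d) (fun h : G => h • x) 1 v}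

variable (d) in
/-- The injective `C^1` immersion `ι : M → G ⧸ Γ`, viewed as the `C^1` submanifold `Z = ι(M)` with
`T_z Z` the image of the differential of `ι`, is transversal to the Lie subgroup `H`:
`T_z (H z) ⊄ T_z Z` for all `z ∈ Z`. -/
def IsTransversal (Γ : Subgroup G) [DiscreteTopology Γ] (H : Subgroup G) (k : ℕ) {M : Type*}
    [TopologicalSpace M] [ChartedSpace (EuclideanSpace ℝ (Fin k)) M] (ι : M → G ⧸ Γ) : Prop :=
  ∀ m : M, ¬ orbitTangent Γ H (ι m) ⊆ Set.range (mfderiv (𝓡 k) (𝓡 d) ι m)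

end Quotient

end NondenseOrbits

end

open NondenseOrbits

open scoped Manifold ContDiff Topology Polynomial

noncomputable section

namespace NondenseOrbits

open Filter Metric Set

/-! ### Rules for Alice -/

section Rules

variable {V : Type*} [NormedAddCommGroup V] [InnerProductSpace ℝ V]

/-! An affine map satisfies f^n(hx) = σ_f^n(h) f^n(x) (`iterate_affine_smul`), so f^n expands small
displacements by T^n, whose norm is O(τ_n) with τ_n = n^(s-1) ρ^n. Put Q = p_T(T). On generalized
eigenvectors one sees that T^n = binom(n, s-1) T^(n-s+1) Q + o(τ_n), and that T acts on Im Q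
semisimply with all eigenvalues of modulus ρ. Hence every v in Im Q is, up to a prescribed error,
T^n w with ‖w‖ ≤ C/τ_n (`exists_small_preimage`): the directions in Im Q are exactly those reached
at the maximal rate.

At a point z of Z, transversality supplies v in Im Q that points out of T_zZ, and near z the
submanifold lies in the zero set of a C^1 function u of the orbit coordinates with du(v) = 1
(`exists_orbit_defining_function`). Let c and c₁ be points of a ball of radius r with τ_n r ≤ δ,
both mapped by f^n close to {u = 0} near z. Linearizing all maps (`abs_le_of_hits`) shows that the
functional du ∘ T^n ∘ M is small at c - c₁, where M is the derivative of the passage from chart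
displacements to group displacements. By the choice of v its norm is at least a constant times τ_n.
So the points of the ball that are bad at time n lie in a thin slab. This needs σ_f^n to be close to
its linearization uniformly in n; `coord_hom_sub_le` obtains that by integrating logarithmic
derivatives, with constants that depend on the group only.

For the game, τ_(n+1) ≥ ρ τ_n means that only boundedly many times n belong to a given scale, but
Alice has one hyperplane per round. An affine dependence among dim + 2 points shows that she can
always pick one slab such that each answer of Bob with a small enough ball misses a fixed proportion
of all the slabs (`exists_good_slab`); so m rounds suffice for q m slabs
(`exists_rule_avoiding_slabs`), and `canForce_of_expanding` schedules the times. Countably many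
pieces of Z are treated together by `CanForce.iInter`, and `CanForce.isBetaHAWOn` disposes of plays
whose radii do not tend to zero.

Finally, transversality is phrased with the Lie algebra of the group generated by exp(Im Q), which
must be shown not to exceed Im Q (`lieAlgebraOf_connectedLieSubgroup_subset`). Under σ_f^(-n) each
element of that group tends to 1 along Im Q up to an error O(ρ^(-2n)). For a one-parameter subgroup,
Baire's theorem makes this uniform on an interval, and since τ_n ρ^(-2n) → 0, applying T^n puts the
velocity into Im Q. -/

/-- A legal way for Alice to answer: the answer in round `i` depends on the first `i + 1` balls. -/
structure IsRule (β : ℝ) (F : ℕ → (ℕ → V × ℝ) → AffineSubspace ℝ V × ℝ) : Prop where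
  congr : ∀ i B B', (∀ j ≤ i, B j = B' j) → F i B = F i B'
  legal : ∀ i B, 0 < (B i).2 →
    IsHyperplane (F i B).1 ∧ 0 < (F i B).2 ∧ (F i B).2 ≤ β * (B i).2

/-- The sequence of balls `B` obeys the rules of the game, if Alice plays according to `F`. -/
structure Follows (β : ℝ) (F : ℕ → (ℕ → V × ℝ) → AffineSubspace ℝ V × ℝ) (B : ℕ → V × ℝ) :
    Prop where
  pos : ∀ i, 0 < (B i).2
  subset : ∀ i, closedBall (B (i + 1)).1 (B (i + 1)).2 ⊆
    closedBall (B i).1 (B i).2 \ thickening (F i B).2 ((F i B).1 : Set V)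
  radius_le : ∀ i, β * (B i).2 ≤ (B (i + 1)).2

/-- If Bob's first ball satisfies `P` and the radii of his balls tend to zero, then Alice can force
the common point of the balls to be in `S`. -/
def CanForce (β : ℝ) (P : V × ℝ → Prop) (S : Set V) : Prop :=
  ∃ F, IsRule β F ∧ ∀ B, Follows β F B → P (B 0) → Tendsto (fun i => (B i).2) atTop (𝓝 0) →
    ∀ x, (∀ i, x ∈ closedBall (B i).1 (B i).2) → x ∈ S

lemma CanForce.mono {β : ℝ} {P : V × ℝ → Prop} {S S' : Set V} (h : CanForce β P S)
    (hS : S ⊆ S') : CanForce β P S' := by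
  obtain ⟨F, hF, h⟩ := h
  exact ⟨F, hF, fun B hB hP hr x hx => hS (h B hB hP hr x hx)⟩

/-- By `congr` a rule ignores all later balls, so the list of past balls may be continued by an
arbitrary value, here 0. -/
lemma IsRule.exists_strategy {β : ℝ} {F : ℕ → (ℕ → V × ℝ) → AffineSubspace ℝ V × ℝ}
    (hF : IsRule β F) :
    ∃ A : AliceStrategy V, A.IsLegal β ∧ ∀ B i, A.answer B i = F i B := by
  refine ⟨fun h => F (h.length - 1) (fun j => h.getD j 0), ?_, ?_⟩
  · intro h b hb
    have := hF.legal ((h ++ [b]).length - 1) (fun j => (h ++ [b]).getD j 0) (by simpa using hb)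
    simpa using this
  · intro B i
    simp only [AliceStrategy.answer, List.length_map, List.length_range, Nat.add_sub_cancel]
    refine hF.congr _ _ _ fun j hj => ?_
    rw [List.getD_eq_getElem _ _ (by simpa using Nat.lt_succ_of_le hj)]
    simp

lemma Follows.antitone {β : ℝ} {F : ℕ → (ℕ → V × ℝ) → AffineSubspace ℝ V × ℝ} {B : ℕ → V × ℝ}
    (h : Follows β F B) : Antitone fun i => closedBall (B i).1 (B i).2 :=
  antitone_nat_of_succ_le fun i => (h.subset i).trans sdiff_subset

lemma Follows.pow_mul_le {β : ℝ} {F : ℕ → (ℕ → V × ℝ) → AffineSubspace ℝ V × ℝ} {B : ℕ → V × ℝ}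
    (h : Follows β F B) (hβ : 0 ≤ β) (i k : ℕ) : β ^ k * (B i).2 ≤ (B (i + k)).2 := by
  induction k with
  | zero => simp
  | succ k ih =>
    calc β ^ (k + 1) * (B i).2 = β * (β ^ k * (B i).2) := by ring
      _ ≤ β * (B (i + k)).2 := by gcongr
      _ ≤ _ := h.radius_le _

lemma isHyperplane_mk' {n : V} (hn : n ≠ 0) (p : V) :
    IsHyperplane (AffineSubspace.mk' p (ℝ ∙ n)ᗮ) := by
  refine ⟨?_, fun L hL => ?_⟩
  · intro h
    have h1 := congrArg AffineSubspace.direction h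
    rw [AffineSubspace.direction_mk', AffineSubspace.direction_top] at h1
    have h2 : n ∈ (ℝ ∙ n)ᗮ := h1 ▸ Submodule.mem_top
    rw [Submodule.mem_orthogonal_singleton_iff_inner_right] at h2
    exact hn (inner_self_eq_zero.1 h2)
  · have hp : p ∈ L := hL.le (AffineSubspace.self_mem_mk' _ _)
    have h1 : (ℝ ∙ n)ᗮ < L.direction := by
      have := AffineSubspace.direction_lt_of_nonempty hL ⟨p, AffineSubspace.self_mem_mk' _ _⟩
      rwa [AffineSubspace.direction_mk'] at this
    obtain ⟨w, hw, hw'⟩ := SetLike.exists_of_lt h1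
    rw [Submodule.mem_orthogonal_singleton_iff_inner_right] at hw'
    have h2 : L.direction = ⊤ := by
      rw [eq_top_iff]
      intro y _
      have h3 : y - (inner ℝ n y / inner ℝ n w) • w ∈ (ℝ ∙ n)ᗮ := by
        rw [Submodule.mem_orthogonal_singleton_iff_inner_right, inner_sub_right, inner_smul_right]
        field_simp
        simp
      have h4 := L.direction.add_mem (h1.le h3) (L.direction.smul_mem (inner ℝ n y / inner ℝ n w) hw)
      simpa using h4
    exact (AffineSubspace.direction_eq_top_iff_of_nonempty ⟨p, hp⟩).1 h2

lemma exists_isHyperplane (V : Type*) [NormedAddCommGroup V] [InnerProductSpace ℝ V] :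
    ∃ L : AffineSubspace ℝ V, IsHyperplane L := by
  rcases subsingleton_or_nontrivial V with hV | hV
  -- In a one-point space the empty subspace is the coatom.
  · refine ⟨⊥, bot_ne_top, fun L hL => ?_⟩
    obtain ⟨p, hp⟩ := (AffineSubspace.nonempty_iff_ne_bot L).2 hL.ne'
    ext q
    have hp' : p ∈ L := hp
    simp [Subsingleton.elim q p, hp']
  · obtain ⟨n, hn⟩ := exists_ne (0 : V)
    exact ⟨_, isHyperplane_mk' hn 0⟩

/-- An arbitrary legal answer to the ball `b`. -/
def dummyAnswer (β : ℝ) (b : V × ℝ) : AffineSubspace ℝ V × ℝ :=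
  ((exists_isHyperplane V).choose, β * b.2)

lemma dummyAnswer_legal {β : ℝ} (hβ : 0 < β) (b : V × ℝ) (hb : 0 < b.2) :
    IsHyperplane (dummyAnswer β b).1 ∧ 0 < (dummyAnswer β b).2 ∧
      (dummyAnswer β b).2 ≤ β * b.2 :=
  ⟨(exists_isHyperplane V).choose_spec, mul_pos hβ hb, le_rfl⟩

/-- Bob can always make a move. -/
lemma exists_closedBall_subset_diff [FiniteDimensional ℝ V] {β : ℝ} (hβ' : β < 1 / 3)
    {L : AffineSubspace ℝ V} (hL : L ≠ ⊤) (c : V) {r r' : ℝ} (hr : 0 < r) (hr' : r' ≤ β * r) :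
    ∃ c', closedBall c' (β * r) ⊆ closedBall c r \ thickening r' (L : Set V) := by
  rcases L.eq_bot_or_nonempty with rfl | ⟨p, hp⟩
  · refine ⟨c, ?_⟩
    simpa using closedBall_subset_closedBall (by nlinarith)
  have h1 : L.direction ≠ ⊤ := fun h =>
    hL ((AffineSubspace.direction_eq_top_iff_of_nonempty ⟨p, hp⟩).1 h)
  obtain ⟨n0, hn0, hn0'⟩ := Submodule.exists_mem_ne_zero_of_ne_bot
    (fun h => h1 (Submodule.orthogonal_eq_bot_iff.1 h))
  obtain ⟨n, hn, hnL⟩ : ∃ n : V, ‖n‖ = 1 ∧ n ∈ L.directionᗮ :=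
    ⟨‖n0‖⁻¹ • n0, by simp [norm_smul, hn0'], Submodule.smul_mem _ _ hn0⟩
  obtain ⟨s, hs, hs'⟩ : ∃ s : ℝ, |s| = 1 ∧ 0 ≤ s * inner ℝ n (c - p) := by
    rcases le_total 0 (inner ℝ n (c - p)) with h | h
    · exact ⟨1, by simp, by simpa using h⟩
    · exact ⟨-1, by simp, by simpa using h⟩
  have hss : s * s = 1 := by rw [← abs_mul_abs_self, hs, one_mul]
  -- The centre is pushed along the normal, away from `L`, until the small ball touches the big
  -- sphere from inside. Its points then have distance at least (1 - 2β) r > β r ≥ r' from `L`; this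
  -- is where β < 1/3 enters.
  refine ⟨c + (s * ((1 - β) * r)) • n, fun x hx => ⟨?_, fun hxL => ?_⟩⟩
  · rw [mem_closedBall, dist_eq_norm] at hx ⊢
    have h2 : ‖(s * ((1 - β) * r)) • n‖ = (1 - β) * r := by
      rw [norm_smul, hn, mul_one, Real.norm_eq_abs, abs_mul, hs, one_mul, abs_of_nonneg]
      nlinarith
    calc ‖x - c‖ = ‖(x - (c + (s * ((1 - β) * r)) • n)) + (s * ((1 - β) * r)) • n‖ := by
          congr 1; abel
      _ ≤ β * r + (1 - β) * r := (norm_add_le _ _).trans (by rw [h2]; gcongr)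
      _ = r := by ring
  · obtain ⟨q, hq, hxq⟩ := mem_thickening_iff.1 hxL
    rw [mem_closedBall, dist_eq_norm] at hx
    rw [dist_eq_norm] at hxq
    have hqp : inner ℝ n (q - p) = 0 := by
      rw [real_inner_comm]
      exact hnL _ (AffineSubspace.vsub_mem_direction hq hp)
    have h3 : s * inner ℝ n (x - q) = s * inner ℝ n (c - p) + (1 - β) * r +
        s * inner ℝ n (x - (c + (s * ((1 - β) * r)) • n)) := by
      have : x - q = (c - p) - (q - p) + (s * ((1 - β) * r)) • n +
          (x - (c + (s * ((1 - β) * r)) • n)) := by abel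
      rw [this, inner_add_right, inner_add_right, inner_sub_right, hqp, inner_smul_right,
        real_inner_self_eq_norm_sq, hn]
      linear_combination ((1 - β) * r) * hss
    have key : ∀ y : V, |s * inner ℝ n y| ≤ ‖y‖ := fun y => by
      rw [abs_mul, hs, one_mul]
      simpa [hn] using abs_real_inner_le_norm n y
    have h4 := (abs_le.1 (key (x - q))).2
    have h5 := (abs_le.1 (key (x - (c + (s * ((1 - β) * r)) • n)))).1
    nlinarith

/-- To win the game it suffices to win the plays in which the radii tend to zero. -/
theorem CanForce.isBetaHAWOn [FiniteDimensional ℝ V] {β : ℝ} (hβ : 0 < β) (hβ' : β < 1 / 3)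
    {S U : Set V} (h : CanForce β (fun b => closedBall b.1 b.2 ⊆ U) S) : IsBetaHAWOn β S U := by
  obtain ⟨F, hF, hS⟩ := h
  obtain ⟨A, hA, hAF⟩ := hF.exists_strategy
  refine ⟨A, hA, fun B hB => ?_⟩
  have hFB : Follows β F B := ⟨hB.radius_pos, fun i => by
    have := hB.subset i; rwa [hAF] at this, hB.radius_le⟩
  by_cases hr : Tendsto (fun i => (B i).2) atTop (𝓝 0)
  · obtain ⟨x, hx⟩ := IsCompact.nonempty_iInter_of_sequence_nonempty_isCompact_isClosed
      (fun i => closedBall (B i).1 (B i).2) (fun i => hFB.antitone (Nat.le_succ i))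
      (fun i => nonempty_closedBall.2 (hB.radius_pos i).le) (isCompact_closedBall _ _)
      (fun i => isClosed_closedBall)
    exact ⟨x, hx, hS B hFB hB.start hr x (mem_iInter.1 hx)⟩
  -- If the radii do not tend to zero, all balls of Bob contain one ball of radius ε / 2, centred at
  -- a limit point of centres. An auxiliary play is started in that ball with radii shrinking by
  -- exactly β; its outcome is in `S`, and it belongs to all the original balls too.
  obtain ⟨ε, hε, hfreq⟩ : ∃ ε > 0, ∃ᶠ i in atTop, ε ≤ (B i).2 := by
    rw [Metric.tendsto_nhds] at hr
    push Not at hr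
    obtain ⟨ε, hε, h⟩ := hr
    refine ⟨ε, hε, h.mono fun i hi => ?_⟩
    rwa [Real.dist_0_eq_abs, abs_of_pos (hB.radius_pos i)] at hi
  obtain ⟨φ, hφ, hφε⟩ := extraction_of_frequently_atTop hfreq
  obtain ⟨y, -, ψ, hψ, hy⟩ := (isCompact_closedBall (B 0).1 (B 0).2).tendsto_subseq
    (x := fun i => (B (φ i)).1)
    (fun i => hFB.antitone (Nat.zero_le _) (mem_closedBall_self (hB.radius_pos _).le))
  have hyB : ∀ i, closedBall y (ε / 2) ⊆ closedBall (B i).1 (B i).2 := by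
    intro i
    have h1 := (Metric.tendsto_nhds.1 hy (ε / 2) (half_pos hε)).and (eventually_ge_atTop i)
    obtain ⟨k, hk, hki⟩ := h1.exists
    refine Subset.trans ?_ (hFB.antitone (hki.trans ((hφ.comp hψ).id_le k)))
    intro z hz
    have h2 : ε ≤ (B (φ (ψ k))).2 := hφε _
    rw [mem_closedBall] at hz ⊢
    have h3 : dist (B (φ (ψ k))).1 y < ε / 2 := hk
    have := dist_triangle_right z (B (φ (ψ k))).1 y
    simp only [Function.comp]
    linarith
  have hmove : ∀ i (C : ℕ → V × ℝ), ∃ b : V × ℝ, 0 < (C i).2 → b.2 = β * (C i).2 ∧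
      closedBall b.1 b.2 ⊆
        closedBall (C i).1 (C i).2 \ thickening (F i C).2 ((F i C).1 : Set V) := by
    intro i C
    by_cases hC : 0 < (C i).2
    · have hl := hF.legal i C hC
      obtain ⟨c', hc'⟩ := exists_closedBall_subset_diff hβ' hl.1.1 (C i).1 hC hl.2.2
      exact ⟨(c', _), fun _ => ⟨rfl, hc'⟩⟩
    · exact ⟨0, fun h => absurd h hC⟩
  choose move hm using hmove
  -- `g n` is the auxiliary play after `n` moves, continued by a junk value; the play itself is the
  -- diagonal `C`. Since `F n` depends only on the balls up to `n`, it cannot tell `g n` from `C`.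
  let g : ℕ → ℕ → V × ℝ := fun n => Nat.rec (fun _ => (y, ε / 2))
    (fun n C => Function.update C (n + 1) (move n C)) n
  have hg : ∀ n k, g (n + k) n = g n n := by
    intro n k
    induction k with
    | zero => rfl
    | succ k ih =>
      rw [← ih]
      exact Function.update_of_ne (Nat.lt_succ_of_le (Nat.le_add_right n k)).ne _ _
  let C : ℕ → V × ℝ := fun n => g n n
  have hgC : ∀ n, ∀ j ≤ n, g n j = C j := by
    intro n j hj
    obtain ⟨k, rfl⟩ := Nat.exists_eq_add_of_le hj
    exact hg j k
  have hC1 : ∀ n, C (n + 1) = move n (g n) := fun n => by simp [C, g]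
  have hFC : ∀ n, F n (g n) = F n C := fun n => hF.congr _ _ _ (hgC n)
  have hpos : ∀ n, 0 < (C n).2 := by
    intro n
    induction n with
    | zero => exact half_pos hε
    | succ n ih => rw [hC1, (hm n (g n) ih).1]; exact mul_pos hβ ih
  have hrad : ∀ n, (C (n + 1)).2 = β * (C n).2 := fun n => by
    rw [hC1, (hm n (g n) (hpos n)).1]
  have hCfol : Follows β F C := by
    refine ⟨hpos, fun n => ?_, fun n => (hrad n).ge⟩
    rw [hC1, ← hFC]
    exact (hm n (g n) (hpos n)).2
  have hlim : Tendsto (fun n => (C n).2) atTop (𝓝 0) := by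
    have : ∀ n, (C n).2 = β ^ n * (ε / 2) := by
      intro n
      induction n with
      | zero => simp [C, g]
      | succ n ih => rw [hrad, ih]; ring
    simp_rw [this]
    simpa using (tendsto_pow_atTop_nhds_zero_of_lt_one hβ.le (by linarith)).mul_const (ε / 2)
  obtain ⟨x, hx⟩ := IsCompact.nonempty_iInter_of_sequence_nonempty_isCompact_isClosed
      (fun i => closedBall (C i).1 (C i).2) (fun i => hCfol.antitone (Nat.le_succ i))
      (fun i => nonempty_closedBall.2 (hpos i).le) (isCompact_closedBall _ _)
      (fun i => isClosed_closedBall)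
  have hx0 : x ∈ closedBall y (ε / 2) := mem_iInter.1 hx 0
  exact ⟨x, mem_iInter.2 fun i => hyB i hx0,
    hS C hCfol ((hyB 0).trans hB.start) hlim x (mem_iInter.1 hx)⟩

end Rules

/-! ### Combining countably many games, and waiting before playing -/

section Combine

variable {V : Type*} [NormedAddCommGroup V] [InnerProductSpace ℝ V]

/-- The number of the `m`-th round that is devoted to the `j`-th of countably many games. -/
def roundIndex (j m : ℕ) : ℕ := 2 ^ j * (2 * m + 1) - 1

lemma roundIndex_add_one (j m : ℕ) : roundIndex j m + 1 = 2 ^ j * (2 * m + 1) :=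
  Nat.sub_add_cancel (Nat.mul_pos (by positivity) (by omega))

/-- Round `i` belongs to game `j` when 2^j exactly divides i + 1. The rounds of game `j` are thus
2^(j+1) apart, and between two of them the radius may shrink by β^(2^(j+1)): this is the parameter
with which game `j` has to be won. -/
lemma roundIndex_succ (j m : ℕ) : roundIndex j (m + 1) = roundIndex j m + 2 ^ (j + 1) := by
  have h1 := roundIndex_add_one j m
  have h2 := roundIndex_add_one j (m + 1)
  have : 2 ^ j * (2 * (m + 1) + 1) = 2 ^ j * (2 * m + 1) + 2 ^ (j + 1) := by ring
  omega

lemma roundIndex_strictMono (j : ℕ) : StrictMono (roundIndex j) :=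
  strictMono_nat_of_lt_succ fun m => by
    rw [roundIndex_succ]; exact Nat.lt_add_of_pos_right (by positivity)

lemma exists_eq_roundIndex (i : ℕ) : ∃ p : ℕ × ℕ, roundIndex p.1 p.2 = i := by
  obtain ⟨j, m, hm, h⟩ := Nat.exists_eq_two_pow_mul_odd (n := i + 1) (by omega)
  obtain ⟨k, rfl⟩ := hm
  exact ⟨(j, k), by have := roundIndex_add_one j k; simp only; omega⟩

lemma roundIndex_inj {j m j' m' : ℕ} (h : roundIndex j m = roundIndex j' m') :
    j = j' ∧ m = m' := by
  have h1 := roundIndex_add_one j m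
  have h2 := roundIndex_add_one j' m'
  rw [h, h2] at h1
  have key : ∀ j m, padicValNat 2 (2 ^ j * (2 * m + 1)) = j := fun j m => by
    have : Fact (Nat.Prime 2) := ⟨Nat.prime_two⟩
    rw [padicValNat.mul (by positivity) (by omega), padicValNat.prime_pow,
      padicValNat.eq_zero_of_not_dvd (by omega), add_zero]
  have h3 : j = j' := by rw [← key j m, ← key j' m', h1]
  subst h3
  have := Nat.eq_of_mul_eq_mul_left (by positivity) h1
  omega

/-- Alice can play countably many games simultaneously. -/
theorem CanForce.iInter {β : ℝ} (hβ : 0 < β) (hβ' : β < 1 / 3) {U : Set V} {S : ℕ → Set V}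
    (h : ∀ j, CanForce (β ^ (2 ^ (j + 1))) (fun b => closedBall b.1 b.2 ⊆ U) (S j)) :
    CanForce β (fun b => closedBall b.1 b.2 ⊆ U) (⋂ j, S j) := by
  choose F hF hS using h
  -- `p i` records the game to which round `i` belongs and its number within that game. The answer
  -- consults only the balls of that game.
  choose p hp using exists_eq_roundIndex
  have hple : ∀ i, ∀ m ≤ (p i).2, roundIndex (p i).1 m ≤ i := fun i m hm => by
    conv_rhs => rw [← hp i]
    exact (roundIndex_strictMono _).monotone hm
  refine ⟨fun i B => F (p i).1 (p i).2 fun m => B (roundIndex (p i).1 m), ⟨?_, ?_⟩, ?_⟩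
  · intro i B B' hB
    exact (hF _).congr _ _ _ fun m hm => hB _ (hple i m hm)
  · intro i B hB
    have h1 := (hF (p i).1).legal (p i).2 (fun m => B (roundIndex (p i).1 m)) (by simpa [hp] using hB)
    simp only [hp] at h1
    refine ⟨h1.1, h1.2.1, h1.2.2.trans ?_⟩
    gcongr
    exact pow_le_of_le_one hβ.le (by linarith) (by positivity)
  · intro B hB h0 hr x hx
    refine mem_iInter.2 fun j => ?_
    have hpj : ∀ m, p (roundIndex j m) = (j, m) := fun m => by
      obtain ⟨h1, h2⟩ := roundIndex_inj (hp (roundIndex j m))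
      exact Prod.ext h1 h2
    refine hS j (fun m => B (roundIndex j m)) ⟨fun m => hB.pos _, fun m => ?_, fun m => ?_⟩
      ((hB.antitone (Nat.zero_le _)).trans h0)
      (hr.comp (roundIndex_strictMono j).tendsto_atTop) x fun m => hx _
    · have h1 := hB.subset (roundIndex j m)
      simp only [hpj] at h1
      refine Subset.trans (hB.antitone ?_) h1
      exact roundIndex_strictMono j (Nat.lt_succ_self m)
    · rw [roundIndex_succ]
      exact hB.pow_mul_le hβ.le _ _

open Classical in
/-- Alice can wait for a convenient position and choose her way of playing only then. -/
theorem CanForce.of_eventually {β : ℝ} (hβ : 0 < β) {P good : V × ℝ → Prop} {S : Set V}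
    (h : ∀ b, good b → CanForce β (fun b' => b' = b) S)
    (hgood : ∀ B : ℕ → V × ℝ, (∀ i, 0 < (B i).2) →
      (Antitone fun i => closedBall (B i).1 (B i).2) → P (B 0) →
      Tendsto (fun i => (B i).2) atTop (𝓝 0) →
      ∀ x, (∀ i, x ∈ closedBall (B i).1 (B i).2) → ∃ i, good (B i)) :
    CanForce β P S := by
  -- Balls that are not good receive an arbitrary legal rule, so that a rule can be chosen for every
  -- ball.
  have h' : ∀ b, ∃ F, IsRule β F ∧ (good b → ∀ B, Follows β F B → B 0 = b →
      Tendsto (fun i => (B i).2) atTop (𝓝 0) →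
      ∀ x, (∀ i, x ∈ closedBall (B i).1 (B i).2) → x ∈ S) := by
    intro b
    by_cases hb : good b
    · obtain ⟨F, hF, hS⟩ := h b hb
      exact ⟨F, hF, fun _ => hS⟩
    · exact ⟨fun i B => dummyAnswer β (B i), ⟨fun i B B' hB => by rw [hB i le_rfl],
        fun i B hB => dummyAnswer_legal hβ _ hB⟩, fun h => absurd h hb⟩
  choose F hF hS using h'
  let G : ℕ → (ℕ → V × ℝ) → AffineSubspace ℝ V × ℝ := fun i B =>
    if H : ∃ k, k ≤ i ∧ good (B k) then
      F (B (Nat.find H)) (i - Nat.find H) fun j => B (Nat.find H + j)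
    else dummyAnswer β (B i)
  refine ⟨G, ⟨?_, ?_⟩, ?_⟩
  · intro i B B' hB
    by_cases H : ∃ k, k ≤ i ∧ good (B k)
    · have H' : ∃ k, k ≤ i ∧ good (B' k) := by
        obtain ⟨k, hk, hk'⟩ := H
        exact ⟨k, hk, hB k hk ▸ hk'⟩
      have hfind : Nat.find H = Nat.find H' :=
        Nat.find_congr' fun {n} => and_congr_right fun hn => by rw [hB n hn]
      simp only [G, dif_pos H, dif_pos H']
      rw [← hfind, ← hB _ (Nat.find_spec H).1]
      have := (Nat.find_spec H).1
      exact (hF _).congr _ _ _ fun j hj => hB _ (by omega)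
    · have H' : ¬ ∃ k, k ≤ i ∧ good (B' k) := by
        rintro ⟨k, hk, hk'⟩
        exact H ⟨k, hk, (hB k hk).symm ▸ hk'⟩
      simp only [G, dif_neg H, dif_neg H', hB i le_rfl]
  · intro i B hB
    by_cases H : ∃ k, k ≤ i ∧ good (B k)
    · simp only [G, dif_pos H]
      have h1 : Nat.find H + (i - Nat.find H) = i := by
        have := (Nat.find_spec H).1
        omega
      have := (hF (B (Nat.find H))).legal (i - Nat.find H) (fun j => B (Nat.find H + j))
        (by simpa [h1] using hB)
      simpa only [h1] using this
    · simp only [G, dif_neg H]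
      exact dummyAnswer_legal hβ _ hB
  · intro B hB h0 hr x hx
    have H := hgood B hB.pos hB.antitone h0 hr x hx
    set k := Nat.find H with hk
    have hGk : ∀ i, G (k + i) B = F (B k) i fun j => B (k + j) := by
      intro i
      have H' : ∃ l, l ≤ k + i ∧ good (B l) := ⟨k, by omega, Nat.find_spec H⟩
      have hfind : Nat.find H' = k := by
        refine le_antisymm (Nat.find_le ⟨by omega, Nat.find_spec H⟩) ?_
        exact Nat.find_le (Nat.find_spec H').2
      simp only [G, dif_pos H', hfind, Nat.add_sub_cancel_left]
    refine hS (B k) (Nat.find_spec H) (fun j => B (k + j)) ⟨fun i => hB.pos _, fun i => ?_,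
      fun i => hB.radius_le _⟩ rfl ?_ x fun i => hx _
    · simp only [← hGk]
      exact hB.subset (k + i)
    · exact hr.comp (tendsto_add_atTop_nat k |>.congr fun n => add_comm _ _)

end Combine

/-! ### Thinning out a play so that the radii decrease at a definite rate -/

section Thin


/-- Bob's balls up to round `i`, thinned out: a ball is kept if its radius is at most `η` times the
radius of the last ball that was kept. The first component is the number of the last ball kept. -/
def thinned {V : Type*} (η : ℝ) (B : ℕ → V × ℝ) : ℕ → ℕ × (ℕ → V × ℝ)
  | 0 => (0, fun _ => B 0)
  | i + 1 => open Classical in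
    if (B (i + 1)).2 ≤ η * ((thinned η B i).2 (thinned η B i).1).2 then
      ((thinned η B i).1 + 1,
        Function.update (thinned η B i).2 ((thinned η B i).1 + 1) (B (i + 1)))
    else thinned η B i

lemma thinned_congr {V : Type*} {η : ℝ} {B B' : ℕ → V × ℝ} (i : ℕ) (h : ∀ j ≤ i, B j = B' j) :
    thinned η B i = thinned η B' i := by
  induction i with
  | zero => simp [thinned, h 0 le_rfl]
  | succ i ih => simp only [thinned, ih fun j hj => h j (by omega), h (i + 1) le_rfl]

variable {V : Type*} [NormedAddCommGroup V] [InnerProductSpace ℝ V]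

open Classical in
/-- Alice's rule `F` for the thinned-out game, played in the original game. -/
def thinnedRule (β η : ℝ) (F : ℕ → (ℕ → V × ℝ) → AffineSubspace ℝ V × ℝ) (i : ℕ)
    (B : ℕ → V × ℝ) : AffineSubspace ℝ V × ℝ :=
  -- The test compares balls, not rounds. If Bob repeats the last ball kept, the same answer is
  -- given again, which does no harm.
  if (thinned η B i).2 (thinned η B i).1 = B i then F (thinned η B i).1 (thinned η B i).2
  else dummyAnswer β (B i)

lemma isRule_thinnedRule {β : ℝ} (η : ℝ) (hβ : 0 < β)
    {F : ℕ → (ℕ → V × ℝ) → AffineSubspace ℝ V × ℝ} (hF : IsRule β F) :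
    IsRule β (thinnedRule β η F) := by
  refine ⟨fun i B B' h => ?_, fun i B h => ?_⟩
  · rw [thinnedRule, thinnedRule, thinned_congr i h, h i le_rfl]
  · unfold thinnedRule
    split_ifs with h1
    · have := hF.legal (thinned η B i).1 (thinned η B i).2 (by rw [h1]; exact h)
      rwa [h1] at this
    · exact dummyAnswer_legal hβ _ h

/-- By waiting, Alice can enforce that the radii decrease at least by the factor `η` in each
round. -/
theorem exists_thinned_play {β η : ℝ} (hβ : 0 < β) (hη : 0 < η) (hη' : η ≤ 1)
    {F : ℕ → (ℕ → V × ℝ) → AffineSubspace ℝ V × ℝ} (hF : IsRule β F) {B : ℕ → V × ℝ}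
    (hB : Follows β (thinnedRule β η F) B) (hr : Tendsto (fun i => (B i).2) atTop (𝓝 0)) :
    ∃ C : ℕ → V × ℝ, C 0 = B 0 ∧ Follows (β * η) F C ∧ (∀ k, (C (k + 1)).2 ≤ η * (C k).2) ∧
      ∀ x, (∀ i, x ∈ closedBall (B i).1 (B i).2) → ∀ k, x ∈ closedBall (C k).1 (C k).2 := by
  set k : ℕ → ℕ := fun i => (thinned η B i).1 with hk
  set s : ℕ → ℕ → V × ℝ := fun i => (thinned η B i).2 with hs
  have hstep : ∀ i, ((B (i + 1)).2 ≤ η * (s i (k i)).2 ∧ k (i + 1) = k i + 1 ∧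
      s (i + 1) = Function.update (s i) (k i + 1) (B (i + 1))) ∨
      (η * (s i (k i)).2 < (B (i + 1)).2 ∧ k (i + 1) = k i ∧ s (i + 1) = s i) := by
    intro i
    by_cases h : (B (i + 1)).2 ≤ η * (s i (k i)).2
    · left
      refine ⟨h, ?_⟩
      simp only [hk, hs, thinned] at h ⊢
      simp [h]
    · right
      refine ⟨not_le.1 h, ?_⟩
      simp only [hk, hs, thinned] at h ⊢
      simp [h]
  have hkmono : Monotone k := monotone_nat_of_le_succ fun i => by
    rcases hstep i with h | h <;> omega
  have hmem : ∀ i, ∀ j ≤ k i, ∃ l ≤ i, s i j = B l := by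
    intro i
    induction i with
    | zero => intro j _; exact ⟨0, le_rfl, by simp [hs, thinned]⟩
    | succ i ih =>
      intro j hj
      rcases hstep i with ⟨-, h1, h2⟩ | ⟨-, h1, h2⟩
      · rw [h2]
        by_cases hjk : j = k i + 1
        · exact ⟨i + 1, le_rfl, by simp [hjk]⟩
        · obtain ⟨l, hl, hl'⟩ := ih j (by omega)
          exact ⟨l, by omega, by simp [hjk, hl']⟩
      · rw [h2]
        obtain ⟨l, hl, hl'⟩ := ih j (by omega)
        exact ⟨l, by omega, hl'⟩
  have hspos : ∀ i, ∀ j ≤ k i, 0 < (s i j).2 := fun i j hj => by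
    obtain ⟨l, -, hl⟩ := hmem i j hj
    rw [hl]; exact hB.pos l
  have hstable : ∀ i n, ∀ j ≤ k i, s (i + n) j = s i j := by
    intro i n
    induction n with
    | zero => intro j _; rfl
    | succ n ih =>
      intro j hj
      rw [← ih j hj, ← add_assoc]
      rcases hstep (i + n) with ⟨-, -, h2⟩ | ⟨-, -, h2⟩
      · rw [h2]
        have := hkmono (Nat.le_add_right i n)
        exact Function.update_of_ne (by omega) _ _
      · rw [h2]
  have hunb : ∀ n, ∃ i, n ≤ k i := by
    intro n
    induction n with
    | zero => exact ⟨0, Nat.zero_le _⟩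
    | succ n ih =>
      obtain ⟨i, hi⟩ := ih
      -- If no further ball were kept, Bob's radii would stay above the fixed number `η * (s i (k
      -- i)).2`, against `hr`.
      have h1 : 0 < η * (s i (k i)).2 := mul_pos hη (hspos i _ le_rfl)
      obtain ⟨N, hN⟩ := eventually_atTop.1 (hr.eventually (gt_mem_nhds h1))
      by_contra! hcon
      have hconst : ∀ l, k (i + l) = k i ∧ s (i + l) = s i := by
        intro l
        induction l with
        | zero => exact ⟨rfl, rfl⟩
        | succ l ihl =>
          rcases hstep (i + l) with ⟨-, h2, -⟩ | ⟨-, h2, h3⟩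
          · have := hcon (i + l + 1)
            omega
          · exact ⟨h2.trans ihl.1, h3.trans ihl.2⟩
      rcases hstep (i + N) with ⟨-, h2, -⟩ | ⟨h2, -, -⟩
      · have h3 := hcon (i + N + 1)
        have := (hconst N).1
        omega
      · rw [(hconst N).1, (hconst N).2] at h2
        exact absurd (hN (i + N + 1) (by omega)) (not_lt.2 h2.le)
  choose I hI using hunb
  set C : ℕ → V × ℝ := fun n => s (I n) n with hC
  have hCs : ∀ i, ∀ j ≤ k i, s i j = C j := by
    intro i j hj
    rcases le_total i (I j) with h | h
    · obtain ⟨n, hn⟩ := Nat.exists_eq_add_of_le h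
      rw [hC]; simp only
      rw [hn]; exact (hstable i n j hj).symm
    · obtain ⟨n, hn⟩ := Nat.exists_eq_add_of_le h
      rw [hn]; exact hstable (I j) n j (hI j)
  have hFC : ∀ i, F (k i) (s i) = F (k i) C := fun i => hF.congr _ _ _ (hCs i)
  -- the relation of the current ball with the last ball kept
  have hinv : ∀ i, closedBall (B (i + 1)).1 (B (i + 1)).2 ⊆ closedBall (C (k i)).1 (C (k i)).2 \
      thickening (F (k i) C).2 ((F (k i) C).1 : Set V) ∧ η * (C (k i)).2 ≤ (B i).2 := by
    intro i
    induction i with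
    | zero =>
      have h0 : s 0 (k 0) = B 0 := rfl
      have h1 := hB.subset 0
      have h2 : thinnedRule β η F 0 B = F (k 0) (s 0) := by
        rw [thinnedRule, if_pos (show s 0 (k 0) = B 0 from h0)]
      rw [h2, hFC] at h1
      rw [← hCs 0 _ le_rfl, h0]
      exact ⟨h1, mul_le_of_le_one_left (hB.pos 0).le hη'⟩
    | succ i ih =>
      have h1 := hB.subset (i + 1)
      rcases hstep i with ⟨-, h2, h3⟩ | ⟨h4, h2, h3⟩
      · have h0 : s (i + 1) (k (i + 1)) = B (i + 1) := by rw [h2, h3]; simp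
        have h2 : thinnedRule β η F (i + 1) B = F (k (i + 1)) (s (i + 1)) := by
          rw [thinnedRule, if_pos (show s (i + 1) (k (i + 1)) = B (i + 1) from h0)]
        rw [h2, hFC] at h1
        rw [← hCs (i + 1) _ le_rfl, h0]
        exact ⟨h1, mul_le_of_le_one_left (hB.pos _).le hη'⟩
      · rw [h2]
        refine ⟨(h1.trans sdiff_subset).trans ih.1, ?_⟩
        rw [hCs i _ le_rfl] at h4
        exact h4.le
  -- Here `i + 1` is the first round in which n + 1 balls after the initial one have been kept; just
  -- before it, the last ball kept is still `C n`.
  have hsucc : ∀ n, ∃ i, k i = n ∧ C (n + 1) = B (i + 1) ∧ (B (i + 1)).2 ≤ η * (C n).2 := by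
    intro n
    have hex : ∃ i, n + 1 ≤ k i := ⟨_, hI (n + 1)⟩
    classical
    obtain ⟨i, hi⟩ : ∃ i, Nat.find hex = i + 1 := Nat.exists_eq_succ_of_ne_zero fun h => by
      have := Nat.find_spec hex
      rw [h] at this
      simp [hk, thinned] at this
    have h1 : n + 1 ≤ k (i + 1) := hi ▸ Nat.find_spec hex
    have h2 : ¬ n + 1 ≤ k i := Nat.find_min hex (by omega)
    rcases hstep i with ⟨h3, h4, h5⟩ | ⟨-, h4, -⟩
    · have h6 : k i = n := by omega
      refine ⟨i, h6, ?_, ?_⟩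
      · rw [← hCs (i + 1) (n + 1) h1, h5, h6]; simp
      · rwa [hCs i _ le_rfl, h6] at h3
    · omega
  have hC0 : C 0 = B 0 := (hCs 0 0 (Nat.zero_le _)).symm
  refine ⟨C, hC0, ⟨fun n => ?_, fun n => ?_, fun n => ?_⟩, fun n => ?_, fun x hx n => ?_⟩
  · exact hspos _ _ (hI n)
  · obtain ⟨i, hi, h1, -⟩ := hsucc n
    rw [h1, ← hi]
    exact (hinv i).1
  -- A factor η is lost at most between `C n` and the ball that precedes the next kept one, and a
  -- further β in Bob's move. Hence the thinned play is a play with parameter β η.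
  · obtain ⟨i, hi, h1, -⟩ := hsucc n
    rw [h1, ← hi, mul_assoc]
    exact (mul_le_mul_of_nonneg_left (hinv i).2 hβ.le).trans (hB.radius_le i)
  · obtain ⟨i, hi, h1, h2⟩ := hsucc n
    rwa [h1]
  · obtain ⟨l, -, hl⟩ := hmem (I n) n (hI n)
    change x ∈ closedBall (s (I n) n).1 (s (I n) n).2
    rw [hl]
    exact hx l

end Thin

/-! ### Choosing one slab out of many -/

section Slabs

variable {V : Type*} [NormedAddCommGroup V] [InnerProductSpace ℝ V]

/-- There are no `dim V + 2` affine functions and `dim V + 2` points whose matrix of values is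
almost triangular with large entries on the diagonal. -/
lemma not_almost_triangular [FiniteDimensional ℝ V] {D : ℕ} (hD : Module.finrank ℝ V + 2 ≤ D)
    {β η t r : ℝ} (hr : 0 < r) (ht1 : 1 ≤ t) (ht : 12 * D ≤ β * t)
    (hη : 8 * D * t ^ D * η ≤ β) (hη0 : 0 < η) (n p : ℕ → V) (a : ℕ → ℝ)
    (hdiag : ∀ k < D, β * r ≤ |inner ℝ (n k) (p k) - a k|)
    (hbound : ∀ k < D, ∀ l < D, |inner ℝ (n k) (p l) - a k| ≤ 3 * r)
    (hlow : ∀ k < D, ∀ l < k, |inner ℝ (n k) (p l) - a k| ≤ 2 * η * r) : False := by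
  have hDpos : (0 : ℝ) < D := by
    have : 0 < D := by omega
    exact_mod_cast this
  -- Any dim V + 2 points are affinely dependent. Such a dependence annihilates the values of every
  -- affine function.
  obtain ⟨w, hw0, hw⟩ : ∃ w : Fin D → ℝ, w ≠ 0 ∧
      (∑ l, w l • (p l) = 0 ∧ ∑ l, w l = 0) := by
    let Φ : (Fin D → ℝ) →ₗ[ℝ] V × ℝ :=
      (∑ l : Fin D, (LinearMap.proj l : (Fin D → ℝ) →ₗ[ℝ] ℝ).smulRight (p l)).prod
        (∑ l : Fin D, LinearMap.proj l)
    have hker : LinearMap.ker Φ ≠ ⊥ := by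
      apply LinearMap.ker_ne_bot_of_finrank_lt
      simp only [Module.finrank_prod, Module.finrank_self, Module.finrank_fin_fun]
      omega
    obtain ⟨w, hw, hw0⟩ := Submodule.exists_mem_ne_zero_of_ne_bot hker
    have h1 : Φ w = 0 := hw
    refine ⟨w, hw0, ?_, ?_⟩
    · simpa [Φ] using congrArg Prod.fst h1
    · simpa [Φ] using congrArg Prod.snd h1
  have hne : (Finset.univ : Finset (Fin D)).Nonempty := ⟨⟨0, by omega⟩, Finset.mem_univ _⟩
  -- The weights t^l make row `k` dominated by its diagonal. For l < k the coefficient is at most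
  -- t^D |w_k| but the entry is at most 2 η r; for l > k the entry is only bounded by 3 r, but the
  -- coefficient is at most |w_k| / t. Either way a term is at most β r |w_k| / (4 D), so all
  -- together cannot cancel the diagonal term, which is at least β r |w_k|.
  obtain ⟨k, -, hk⟩ := Finset.exists_max_image Finset.univ (fun l : Fin D => |w l| * t ^ (l : ℕ)) hne
  have htpos : 0 < t := by linarith
  have hwk : 0 < |w k| := by
    obtain ⟨l, hl⟩ := Function.ne_iff.1 hw0
    have h1 := hk l (Finset.mem_univ _)
    have h2 : 0 < |w l| * t ^ (l : ℕ) := mul_pos (abs_pos.2 hl) (by positivity)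
    have h3 := h2.trans_le h1
    exact pos_of_mul_pos_left h3 (by positivity)
  have hsum : ∑ l, w l * (inner ℝ (n k) (p l) - a k) = 0 := by
    have h1 : ∑ l, w l * (inner ℝ (n k) (p l) - a k) =
        inner ℝ (n k) (∑ l, w l • p l) - (∑ l, w l) * a k := by
      rw [inner_sum, Finset.sum_mul, ← Finset.sum_sub_distrib]
      refine Finset.sum_congr rfl fun l _ => ?_
      rw [inner_smul_right]; ring
    rw [h1, hw.1, hw.2]; simp
  rw [← Finset.add_sum_erase _ _ (Finset.mem_univ k)] at hsum
  have hterm : ∀ l ∈ Finset.univ.erase k, |w l * (inner ℝ (n k) (p l) - a k)| ≤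
      (β / (4 * D)) * r * |w k| := by
    intro l hl
    have hlk : l ≠ k := Finset.ne_of_mem_erase hl
    have hmax := hk l (Finset.mem_univ _)
    rw [abs_mul]
    rcases lt_or_gt_of_ne hlk with h | h
    · have h1 : |w l| ≤ |w k| * t ^ D := by
        calc |w l| ≤ |w l| * t ^ (l : ℕ) := le_mul_of_one_le_right (abs_nonneg _) (one_le_pow₀ ht1)
          _ ≤ |w k| * t ^ (k : ℕ) := hmax
          _ ≤ |w k| * t ^ D := by gcongr; exact k.2.le
      calc |w l| * |inner ℝ (n k) (p l) - a k| ≤ (|w k| * t ^ D) * (2 * η * r) := by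
            gcongr; exact hlow k k.2 l h
        _ = (8 * D * t ^ D * η) / (4 * D) * r * |w k| := by field_simp; ring
        _ ≤ _ := by gcongr
    · have h1 : |w l| * t ≤ |w k| := by
        have h2 : (k : ℕ) + 1 ≤ l := h
        obtain ⟨q, hq⟩ := Nat.exists_eq_add_of_le h2
        rw [hq, pow_add, pow_add] at hmax
        have h3 : (|w l| * t * t ^ q) * t ^ (k : ℕ) ≤ |w k| * t ^ (k : ℕ) := by
          refine le_trans (le_of_eq ?_) hmax; ring
        have h4 := le_of_mul_le_mul_right h3 (by positivity)
        exact (le_mul_of_one_le_right (by positivity) (one_le_pow₀ ht1)).trans h4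
      calc |w l| * |inner ℝ (n k) (p l) - a k| ≤ |w l| * (3 * r) := by
            gcongr; exact hbound k k.2 l l.2
        _ = |w l| * (12 * D) / (4 * D) * r := by field_simp; ring
        _ ≤ |w l| * (β * t) / (4 * D) * r := by gcongr
        _ = β / (4 * D) * r * (|w l| * t) := by ring
        _ ≤ _ := by
          have : 0 ≤ β := by nlinarith [mul_pos hDpos htpos]
          gcongr
  have h1 : |w k * (inner ℝ (n k) (p k) - a k)| ≤ D * ((β / (4 * D)) * r * |w k|) := by
    rw [eq_neg_of_add_eq_zero_left hsum, abs_neg]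
    refine (Finset.abs_sum_le_sum_abs _ _).trans ((Finset.sum_le_sum hterm).trans ?_)
    rw [Finset.sum_const, nsmul_eq_mul]
    have hβ : 0 ≤ β := le_trans (by positivity) hη
    gcongr
    exact (Finset.card_le_univ _).trans (by simp)
  rw [abs_mul] at h1
  have h2 : |w k| * (β * r) ≤ |w k| * |inner ℝ (n k) (p k) - a k| := by
    gcongr; exact hdiag k k.2
  have h3 : D * ((β / (4 * D)) * r * |w k|) = |w k| * (β * r) / 4 := by field_simp
  have hβ : 0 < β := by
    by_contra h
    push Not at h
    have : 12 * (D : ℝ) ≤ 0 := ht.trans (mul_nonpos_of_nonpos_of_nonneg h htpos.le)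
    linarith
  have h4 : 0 < |w k| * (β * r) := by positivity
  rw [h3] at h1
  linarith

/-- Among finitely many thin slabs one can find one such that every small ball that stays away from
it misses a definite proportion of the slabs. -/
theorem exists_good_slab [FiniteDimensional ℝ V] {β : ℝ} (hβ : 0 < β) (hβ' : β < 1 / 3) :
    ∃ η : ℝ, 0 < η ∧ η < 1 ∧ ∀ {J : Type} (s : Finset J) (_ : s.Nonempty) (n : J → V) (a : J → ℝ)
      (_ : ∀ j ∈ s, ‖n j‖ = 1) (c : V) (r : ℝ) (_ : 0 < r)
      (_ : ∀ j ∈ s, |inner ℝ (n j) c - a j| ≤ 2 * r),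
      ∃ i ∈ s, ∀ q ∈ closedBall c r, β * r ≤ |inner ℝ (n i) q - a i| →
        ∀ u ⊆ s, (∀ j ∈ u, |inner ℝ (n j) q - a j| ≤ 2 * η * r) →
          (Module.finrank ℝ V + 2) * u.card ≤ (Module.finrank ℝ V + 1) * s.card := by
  classical
  set D : ℕ := Module.finrank ℝ V + 2 with hD
  have hDpos : (2 : ℝ) ≤ D := by
    rw [hD]
    push_cast
    linarith [(Nat.cast_nonneg (Module.finrank ℝ V) : (0 : ℝ) ≤ _)]
  -- With this `t`, and η = β / (8 D t^D) below, the two inequalities required by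
  -- `not_almost_triangular` become equalities.
  set t : ℝ := 12 * D / β with ht
  have ht1 : 1 ≤ t := by rw [ht, le_div_iff₀ hβ]; linarith
  have htD : 1 ≤ t ^ D := one_le_pow₀ ht1
  refine ⟨β / (8 * D * t ^ D), by positivity, ?_, ?_⟩
  · rw [div_lt_one (by positivity)]
    nlinarith
  intro J s hs n a hn c r hr hc
  set η : ℝ := β / (8 * D * t ^ D) with hη
  -- If every slab `i` fails, there are a point `q i` at distance at least β r from its middle and a
  -- set `u i` of more than (D - 1)/D of all slabs that pass close to `q i`. Slabs selected one by
  -- one from the intersection of the earlier sets `u` give an almost triangular matrix of size D.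
  by_contra! hcon
  have h1 : ∀ i, ∃ q, ∃ u : Finset J, i ∈ s → q ∈ closedBall c r ∧ β * r ≤ |inner ℝ (n i) q - a i| ∧
      u ⊆ s ∧ (∀ j ∈ u, |inner ℝ (n j) q - a j| ≤ 2 * η * r) ∧
      (Module.finrank ℝ V + 1) * s.card < D * u.card := by
    intro i
    by_cases hi : i ∈ s
    · obtain ⟨q, hq, h2, u, hu, h3, h4⟩ := hcon i hi
      exact ⟨q, u, fun _ => ⟨hq, h2, hu, h3, h4⟩⟩
    · exact ⟨0, ∅, fun h => absurd h hi⟩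
  choose q u hqu using h1
  have hseq : ∀ k ≤ D, ∃ f : ℕ → J, ∀ x < k, f x ∈ s ∧ ∀ l < x, f x ∈ u (f l) := by
    intro k
    induction k with
    | zero => intro _; exact ⟨fun _ => hs.choose, fun x hx => absurd hx (by omega)⟩
    | succ k ih =>
      intro hk
      obtain ⟨f, hf⟩ := ih (by omega)
      -- The complement of each `u` has fewer than s.card / D elements, so fewer than D such
      -- complements cannot cover `s`.
      obtain ⟨j, hj, hju⟩ : ∃ j ∈ s, ∀ l < k, j ∈ u (f l) := by
        by_contra! hno
        have hsub : s ⊆ (Finset.range k).biUnion fun l => s \ u (f l) := by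
          intro j hj
          obtain ⟨l, hl, hl'⟩ := hno j hj
          exact Finset.mem_biUnion.2 ⟨l, Finset.mem_range.2 hl, Finset.mem_sdiff.2 ⟨hj, hl'⟩⟩
        have h2 := (Finset.card_le_card hsub).trans Finset.card_biUnion_le
        have h3 : D * ∑ l ∈ Finset.range k, (s \ u (f l)).card ≤ k * (s.card - 1) := by
          rw [Finset.mul_sum]
          refine (Finset.sum_le_card_nsmul _ _ (s.card - 1) fun l hl => ?_).trans (by simp)
          obtain ⟨-, -, hu, -, hcard⟩ := hqu (f l) (hf l (Finset.mem_range.1 hl)).1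
          rw [Finset.card_sdiff_of_subset hu]
          have := Finset.card_le_card hu
          have h5 : D * (s.card - (u (f l)).card) + D * (u (f l)).card = D * s.card := by
            rw [← mul_add, Nat.sub_add_cancel this]
          have h6 : D * s.card = (Module.finrank ℝ V + 1) * s.card + s.card := by
            rw [hD]; ring
          omega
        have hs1 : 0 < s.card := hs.card_pos
        have h4 : D * s.card ≤ k * (s.card - 1) := (Nat.mul_le_mul_left D h2).trans h3
        have h5 : k * (s.card - 1) ≤ D * (s.card - 1) := Nat.mul_le_mul_right _ (by omega)
        have h6 := Nat.le_of_mul_le_mul_left (h4.trans h5) (by omega)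
        omega
      refine ⟨Function.update f k j, fun x hx => ?_⟩
      have hup : ∀ l < k, Function.update f k j l = f l := fun l hl =>
        Function.update_of_ne (by omega) _ _
      rcases Nat.lt_succ_iff_lt_or_eq.1 hx with hx | rfl
      · rw [hup x hx]
        exact ⟨(hf x hx).1, fun l hl => by rw [hup l (by omega)]; exact (hf x hx).2 l hl⟩
      · rw [Function.update_self]
        exact ⟨hj, fun l hl => by rw [hup l hl]; exact hju l hl⟩
  obtain ⟨f, hf⟩ := hseq D le_rfl
  refine not_almost_triangular (V := V) (D := D) le_rfl (β := β) (η := η) (t := t) hr ht1 ?_ ?_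
    (by positivity) (fun k => n (f k)) (fun k => q (f k)) (fun k => a (f k)) ?_ ?_ ?_
  · rw [ht]; field_simp; rfl
  · rw [hη]; field_simp; rfl
  · exact fun k hk => (hqu _ (hf k hk).1).2.1
  · intro k hk l hl
    have h1 := (hqu _ (hf l hl).1).1
    rw [mem_closedBall, dist_eq_norm] at h1
    have h2 := hc _ (hf k hk).1
    have h3 : |inner ℝ (n (f k)) (q (f l) - c)| ≤ 1 * r := by
      refine (abs_real_inner_le_norm _ _).trans ?_
      rw [hn _ (hf k hk).1]
      gcongr
    have h4 : inner ℝ (n (f k)) (q (f l)) - a (f k) =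
        (inner ℝ (n (f k)) c - a (f k)) + inner ℝ (n (f k)) (q (f l) - c) := by
      rw [inner_sub_right]; ring
    rw [h4]
    exact (abs_add_le _ _).trans (by linarith)
  · intro k hk l hl
    exact (hqu _ (hf l (hl.trans hk)).1).2.2.2.1 _ ((hf k hk).2 l hl)

lemma mem_thickening_mk' {n : V} (hn : ‖n‖ = 1) {a r' : ℝ} {x : V}
    (h : |inner ℝ n x - a| < r') :
    x ∈ thickening r' ((AffineSubspace.mk' (a • n) (ℝ ∙ n)ᗮ : AffineSubspace ℝ V) : Set V) := by
  refine mem_thickening_iff.2 ⟨x - (inner ℝ n x - a) • n, ?_, ?_⟩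
  · rw [SetLike.mem_coe, AffineSubspace.mem_mk', Submodule.mem_orthogonal_singleton_iff_inner_right]
    simp only [vsub_eq_sub, inner_sub_right, inner_smul_right, real_inner_self_eq_norm_sq, hn]
    ring
  · rw [dist_eq_norm, sub_sub_cancel, norm_smul, hn, mul_one]
    exact h

end Slabs

/-! ### Avoiding many slabs within a window of rounds -/

section Tasks

variable {V : Type*} [NormedAddCommGroup V] [InnerProductSpace ℝ V] [FiniteDimensional ℝ V]

/-- The number m of rounds enters the number a m of tasks as well; the exponential gain per round
beats this linear factor. -/
lemma exists_mul_pow_lt (D a : ℕ) :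
    ∃ m : ℕ, 0 < m ∧ (((D : ℝ) + 1) / (D + 2)) ^ m * ((a * m : ℕ) : ℝ) < 1 := by
  have h1 : ((D : ℝ) + 1) / (D + 2) < 1 := by
    rw [div_lt_one (by positivity)]; linarith
  have h2 := (tendsto_self_mul_const_pow_of_lt_one (r := ((D : ℝ) + 1) / (D + 2)) (by positivity)
    h1).const_mul (a : ℝ)
  rw [mul_zero] at h2
  obtain ⟨m, hm, hm'⟩ := ((h2.eventually (gt_mem_nhds one_pos)).and (eventually_gt_atTop 0)).exists
  refine ⟨m, hm', ?_⟩
  push_cast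
  linarith

open Classical in
/-- The tasks of the window ball `b` whose slab meets the ball `b'`. -/
def openTasks {N : ℕ} (θ : ℝ) (n : V × ℝ → Fin N → V) (a : V × ℝ → Fin N → ℝ) (b b' : V × ℝ) :
    Finset (Fin N) :=
  {j | ‖n b j‖ = 1 ∧ ∃ x ∈ closedBall b'.1 b'.2, |inner ℝ (n b j) x - a b j| ≤ θ * b.2}

theorem exists_rule_avoiding_unit_slabs {β : ℝ} (hβ : 0 < β) (hβ' : β < 1 / 3) :
    ∃ κ : ℝ, 0 < κ ∧ κ < 1 ∧ ∀ q : ℕ, ∃ m : ℕ, 0 < m ∧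
      ∀ (n : V × ℝ → Fin (q * m) → V) (a : V × ℝ → Fin (q * m) → ℝ),
      ∃ F, IsRule β F ∧ ∀ B : ℕ → V × ℝ, Follows β F B → Tendsto (fun i => (B i).2) atTop (𝓝 0) →
        ∃ b : ℕ → V × ℝ, b 0 = B 0 ∧ (∀ k, 0 < (b k).2) ∧ (∀ k, κ ^ m * (b k).2 ≤ (b (k + 1)).2) ∧
          Tendsto (fun k => (b k).2) atTop (𝓝 0) ∧
          (∀ k, closedBall (b k).1 (b k).2 ⊆ closedBall (B 0).1 (B 0).2) ∧
          ∀ x, (∀ i, x ∈ closedBall (B i).1 (B i).2) → ∀ k, x ∈ closedBall (b k).1 (b k).2 ∧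
            ∀ j, ‖n (b k) j‖ = 1 → κ ^ (m + 1) * (b k).2 < |inner ℝ (n (b k) j) x - a (b k) j| := by
  classical
  obtain ⟨η, hη, hη1', hslab⟩ := exists_good_slab (V := V) hβ hβ'
  have hη1 := hη1'.le
  set d := Module.finrank ℝ V
  have hκ : 0 < β * η := mul_pos hβ hη
  have hκ1 : β * η < 1 := by nlinarith
  refine ⟨β * η, hκ, hκ1, fun q => ?_⟩
  obtain ⟨m, hm, hm1⟩ := exists_mul_pow_lt d q
  refine ⟨m, hm, fun n a => ?_⟩
  -- In the first m rounds of a window the radius is still at least κ^(m-1) times the initial one,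
  -- with κ = β η. So slabs of half-width θ times the initial radius are at most η times the current
  -- radius wide in every round, and `exists_good_slab` always applies.
  set θ : ℝ := (β * η) ^ (m + 1) with hθ
  let R := openTasks θ n a
  have hRmem : ∀ {b b' j}, j ∈ R b b' ↔ ‖n b j‖ = 1 ∧ ∃ x ∈ closedBall b'.1 b'.2,
      |inner ℝ (n b j) x - a b j| ≤ θ * b.2 := by
    intro b b' j
    simp [R, openTasks]
  -- the choice of the hyperplane
  have hsel : ∀ b b' : V × ℝ, ∃ ans : AffineSubspace ℝ V × ℝ, (0 < b'.2 →
      (IsHyperplane ans.1 ∧ 0 < ans.2 ∧ ans.2 ≤ β * b'.2)) ∧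
      (0 < b'.2 → θ * b.2 ≤ η * b'.2 → ∀ b'' : V × ℝ, 0 < b''.2 → closedBall b''.1 b''.2 ⊆
        closedBall b'.1 b'.2 \ thickening ans.2 (ans.1 : Set V) → b''.2 ≤ η * b'.2 →
        (d + 2) * (R b b'').card ≤ (d + 1) * (R b b').card) := by
    intro b b'
    by_cases hb' : 0 < b'.2
    swap
    · exact ⟨dummyAnswer β b', fun h => absurd h hb', fun h => absurd h hb'⟩
    have hmono : ∀ b'' : V × ℝ, closedBall b''.1 b''.2 ⊆ closedBall b'.1 b'.2 → R b b'' ⊆ R b b' := by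
      intro b'' h j hj
      obtain ⟨h1, x, hx, h2⟩ := hRmem.1 hj
      exact hRmem.2 ⟨h1, x, h hx, h2⟩
    by_cases hθb : θ * b.2 ≤ η * b'.2
    swap
    · exact ⟨dummyAnswer β b', fun _ => dummyAnswer_legal hβ _ hb', fun _ h => absurd h hθb⟩
    rcases (R b b').eq_empty_or_nonempty with hemp | hne
    · refine ⟨dummyAnswer β b', fun _ => dummyAnswer_legal hβ _ hb', fun _ _ b'' _ hsub _ => ?_⟩
      have := hmono b'' (hsub.trans sdiff_subset)
      rw [hemp, Finset.subset_empty] at this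
      simp [this]
    have hlip : ∀ j ∈ R b b', ∀ x y : V,
        |inner ℝ (n b j) x - a b j| ≤ |inner ℝ (n b j) y - a b j| + dist x y := by
      intro j hj x y
      have h3 : |inner ℝ (n b j) (x - y)| ≤ dist x y := by
        refine (abs_real_inner_le_norm _ _).trans ?_
        rw [(hRmem.1 hj).1, one_mul, dist_eq_norm]
      have h4 : inner ℝ (n b j) x - a b j =
          (inner ℝ (n b j) y - a b j) + inner ℝ (n b j) (x - y) := by
        rw [inner_sub_right]; ring
      rw [h4]
      exact (abs_add_le _ _).trans (by linarith)
    obtain ⟨i, hi, hgood⟩ := hslab (R b b') hne (n b) (a b) (fun j hj => (hRmem.1 hj).1) b'.1 b'.2 hb'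
      (fun j hj => by
        obtain ⟨h1, x, hx, h2⟩ := hRmem.1 hj
        have h3 := hlip j hj b'.1 x
        rw [mem_closedBall, dist_comm] at hx
        nlinarith)
    have hin := (hRmem.1 hi).1
    refine ⟨(AffineSubspace.mk' (a b i • n b i) (ℝ ∙ n b i)ᗮ, β * b'.2), fun _ =>
      ⟨isHyperplane_mk' (norm_ne_zero_iff.1 (by rw [hin]; norm_num)) _, mul_pos hβ hb', le_rfl⟩,
      fun _ _ b'' hb'' hsub hrad => ?_⟩
    have hc := hsub (mem_closedBall_self hb''.le)
    refine hgood b''.1 hc.1 (not_lt.1 fun h => hc.2 (mem_thickening_mk' hin h)) _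
      (hmono b'' (hsub.trans sdiff_subset)) fun j hj => ?_
    obtain ⟨-, x, hx, h2⟩ := hRmem.1 hj
    have h3 := hlip j (hmono b'' (hsub.trans sdiff_subset) hj) b''.1 x
    rw [mem_closedBall, dist_comm] at hx
    linarith
  choose ans hlegal hans using hsel
  -- Windows consist of m rounds; `m * (i / m)` is the first round of the window that contains round
  -- `i`.
  let F0 : ℕ → (ℕ → V × ℝ) → AffineSubspace ℝ V × ℝ := fun i B => ans (B (m * (i / m))) (B i)
  have hF0 : IsRule β F0 := by
    refine ⟨fun i B B' h => ?_, fun i B h => hlegal _ _ h⟩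
    simp only [F0, h i le_rfl, h _ (Nat.mul_div_le i m)]
  refine ⟨thinnedRule β η F0, isRule_thinnedRule η hβ hF0, fun B hB hr => ?_⟩
  obtain ⟨C, hC0, hC, hCη, hCx⟩ := exists_thinned_play hβ hη hη1 hF0 hB hr
  have hClim : Tendsto (fun i => (C i).2) atTop (𝓝 0) := by
    have h1 : ∀ i, (C i).2 ≤ η ^ i * (C 0).2 := by
      intro i
      induction i with
      | zero => simp
      | succ i ih =>
        calc (C (i + 1)).2 ≤ η * (C i).2 := hCη i
          _ ≤ η * (η ^ i * (C 0).2) := by gcongr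
          _ = _ := by ring
    refine squeeze_zero (fun i => (hC.pos i).le) h1 ?_
    simpa using (tendsto_pow_atTop_nhds_zero_of_lt_one hη.le hη1').mul_const (C 0).2
  -- After `l` rounds of a window at most ((d + 1)/(d + 2))^l of its q m slabs still meet the ball.
  -- For l = m the bound is below 1 by the choice of `m`, so none is left.
  have hred : ∀ k l, l ≤ m → ((d : ℝ) + 2) ^ l * (R (C (m * k)) (C (m * k + l))).card ≤
      (d + 1) ^ l * ((q * m : ℕ) : ℝ) := by
    intro k l
    induction l with
    | zero =>
      intro _
      simp only [pow_zero, one_mul]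
      exact_mod_cast (Finset.card_le_univ _).trans (by simp)
    | succ l ih =>
      intro hl
      have h1 := ih (by omega)
      have hw : m * ((m * k + l) / m) = m * k := by
        rw [Nat.mul_add_div hm, Nat.div_eq_of_lt (by omega), add_zero]
      have h2 := hC.subset (m * k + l)
      simp only [F0, hw] at h2
      have h3 : θ * (C (m * k)).2 ≤ η * (C (m * k + l)).2 := by
        have h4 := hC.pow_mul_le hκ.le (m * k) l
        have h5 : (β * η) ^ m ≤ (β * η) ^ l := pow_le_pow_of_le_one hκ.le hκ1.le (by omega)
        have h6 := hC.pos (m * k)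
        calc θ * (C (m * k)).2 = η * (β * ((β * η) ^ m * (C (m * k)).2)) := by rw [hθ]; ring
          _ ≤ η * (1 * ((β * η) ^ l * (C (m * k)).2)) := by gcongr; linarith
          _ ≤ _ := by rw [one_mul]; gcongr
      have h4 := hans _ _ (hC.pos _) h3 _ (hC.pos _) h2 (hCη _)
      have h5 : ((d : ℝ) + 2) * (R (C (m * k)) (C (m * k + l + 1))).card ≤
          (d + 1) * (R (C (m * k)) (C (m * k + l))).card := by exact_mod_cast h4
      calc ((d : ℝ) + 2) ^ (l + 1) * (R (C (m * k)) (C (m * k + (l + 1)))).card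
          = (d + 2) ^ l * ((d + 2) * (R (C (m * k)) (C (m * k + l + 1))).card) := by
            rw [pow_succ, mul_assoc]; rfl
        _ ≤ (d + 2) ^ l * ((d + 1) * (R (C (m * k)) (C (m * k + l))).card) := by gcongr
        _ = (d + 1) * ((d + 2) ^ l * (R (C (m * k)) (C (m * k + l))).card) := by ring
        _ ≤ (d + 1) * ((d + 1) ^ l * ((q * m : ℕ) : ℝ)) := by gcongr
        _ = _ := by ring
  refine ⟨fun k => C (m * k), by simpa using hC0, fun k => hC.pos _, fun k => ?_, ?_, fun k => ?_, ?_⟩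
  · have := hC.pow_mul_le hκ.le (m * k) m
    simpa [mul_add] using this
  · exact hClim.comp (tendsto_id.const_mul_atTop' hm)
  · rw [← hC0]; exact hC.antitone (Nat.zero_le _)
  · intro x hx k
    refine ⟨hCx x hx _, fun j hj => not_le.1 fun h => ?_⟩
    have h1 : j ∈ R (C (m * k)) (C (m * k + m)) := hRmem.2 ⟨hj, x, hCx x hx _, h⟩
    have h2 : (1 : ℝ) ≤ (R (C (m * k)) (C (m * k + m))).card := by
      exact_mod_cast Finset.card_pos.2 ⟨j, h1⟩
    have h3 := hred k m le_rfl
    have h4 : ((d : ℝ) + 2) ^ m ≤ (d + 1) ^ m * ((q * m : ℕ) : ℝ) :=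
      (le_mul_of_one_le_right (by positivity) h2).trans h3
    rw [div_pow, div_mul_eq_mul_div, div_lt_one (by positivity)] at hm1
    linarith

/-- In each of a sequence of rounds, whose lengths are bounded by the factor `κ ^ m`, Alice can
avoid `q * m` thin slabs of her choice. -/
theorem exists_rule_avoiding_slabs {β : ℝ} (hβ : 0 < β) (hβ' : β < 1 / 3) :
    ∃ κ : ℝ, 0 < κ ∧ κ < 1 ∧ ∀ q : ℕ, ∃ m : ℕ, 0 < m ∧
      ∀ (g : V × ℝ → Fin (q * m) → StrongDual ℝ V) (a : V × ℝ → Fin (q * m) → ℝ),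
      ∃ F, IsRule β F ∧ ∀ B : ℕ → V × ℝ, Follows β F B → Tendsto (fun i => (B i).2) atTop (𝓝 0) →
        ∃ b : ℕ → V × ℝ, b 0 = B 0 ∧ (∀ k, 0 < (b k).2) ∧ (∀ k, κ ^ m * (b k).2 ≤ (b (k + 1)).2) ∧
          Tendsto (fun k => (b k).2) atTop (𝓝 0) ∧
          (∀ k, closedBall (b k).1 (b k).2 ⊆ closedBall (B 0).1 (B 0).2) ∧
          ∀ x, (∀ i, x ∈ closedBall (B i).1 (B i).2) → ∀ k, x ∈ closedBall (b k).1 (b k).2 ∧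
            ∀ j, g (b k) j ≠ 0 →
              κ ^ (m + 1) * (b k).2 * ‖g (b k) j‖ < |g (b k) j x - a (b k) j| := by
  obtain ⟨κ, hκ, hκ1, h⟩ := exists_rule_avoiding_unit_slabs (V := V) hβ hβ'
  refine ⟨κ, hκ, hκ1, fun q => ?_⟩
  obtain ⟨m, hm, h⟩ := h q
  refine ⟨m, hm, fun g a => ?_⟩
  -- The functionals are normalized and represented by vectors. A zero functional becomes the zero
  -- vector, which is not of norm 1 and hence is ignored.
  obtain ⟨F, hF, h⟩ := h (fun b j => ‖g b j‖⁻¹ • (InnerProductSpace.toDual ℝ V).symm (g b j))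
    (fun b j => ‖g b j‖⁻¹ * a b j)
  refine ⟨F, hF, fun B hB hr => ?_⟩
  obtain ⟨b, h0, hpos, hrad, hlim, hsub, hx⟩ := h B hB hr
  refine ⟨b, h0, hpos, hrad, hlim, hsub, fun x hxB k => ⟨(hx x hxB k).1, fun j hj => ?_⟩⟩
  have hg : 0 < ‖g (b k) j‖ := norm_pos_iff.2 hj
  have h1 := (hx x hxB k).2 j (by
    rw [norm_smul, LinearIsometryEquiv.norm_map, norm_inv, norm_norm, inv_mul_cancel₀ hg.ne'])
  rw [real_inner_smul_left, InnerProductSpace.toDual_symm_apply, ← mul_sub, abs_mul,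
    abs_of_pos (inv_pos.2 hg), inv_mul_eq_div, lt_div_iff₀ hg] at h1
  exact h1

end Tasks

/-! ### Scheduling the bad times of an expanding system -/

section Expanding

variable {V : Type*} [NormedAddCommGroup V] [InnerProductSpace ℝ V] [FiniteDimensional ℝ V]

/-- If, at every time `n`, the points that are bad at time `n` lie close to a hyperplane, on the
scale on which the `n`-th iterate expands a ball to a fixed size, then Alice can avoid the bad
points. -/
theorem canForce_of_expanding {β : ℝ} (hβ : 0 < β) (hβ' : β < 1 / 3) {ρ : ℝ} (hρ : 1 < ρ)
    {τ : ℕ → ℝ} (hτ0 : 0 < τ 0) (hτ : ∀ n, ρ * τ n ≤ τ (n + 1)) {c : ℝ} (hc : 0 < c)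
    (b₀ : V × ℝ) (bad : ℝ → ℕ → V → Prop)
    (h : ∀ κ > 0, ∃ δ₀ > 0, ∀ δ > 0, δ ≤ δ₀ → ∃ ε > 0, ∀ p r, 0 < r →
      closedBall p r ⊆ closedBall b₀.1 b₀.2 → ∀ n, τ n * r ≤ δ →
      ∃ (g : StrongDual ℝ V) (a : ℝ), c * τ n ≤ ‖g‖ ∧
        ∀ x ∈ closedBall p r, bad ε n x → |g x - a| ≤ κ * δ) :
    CanForce β (fun b => b = b₀) {x | ∃ ε > 0, ∀ n, ¬ bad ε n x} := by
  classical
  by_cases hb₀ : 0 < b₀.2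
  swap
  · refine ⟨fun i B => dummyAnswer β (B i), ⟨fun i B B' hB => by rw [hB i le_rfl],
        fun i B hB => dummyAnswer_legal hβ _ hB⟩, fun B hB h0 => ?_⟩
    exact absurd (h0 ▸ hB.pos 0) hb₀
  obtain ⟨κ, hκ, hκ1, hP⟩ := exists_rule_avoiding_slabs (V := V) hβ hβ'
  -- As κ⁻¹ < ρ^q, the numbers τ n grow by more than κ^(-m) within q m steps. Therefore at most q m
  -- times `n` satisfy κ^m δ < τ n * r ≤ δ for a given radius `r`.
  obtain ⟨q, hq⟩ := pow_unbounded_of_one_lt κ⁻¹ hρ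
  obtain ⟨m, hm, hP⟩ := hP q
  have hpow : ∀ n k, ρ ^ k * τ n ≤ τ (n + k) := by
    intro n k
    induction k with
    | zero => simp
    | succ k ih =>
      calc ρ ^ (k + 1) * τ n = ρ * (ρ ^ k * τ n) := by ring
        _ ≤ ρ * τ (n + k) := by gcongr
        _ ≤ _ := hτ _
  have hτn : ∀ n, τ 0 ≤ τ n := fun n => by
    have := hpow 0 n
    rw [zero_add] at this
    exact (le_mul_of_one_le_left hτ0.le (one_le_pow₀ hρ.le)).trans this
  have hτpos : ∀ n, 0 < τ n := fun n => hτ0.trans_le (hτn n)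
  have hτlim : Tendsto τ atTop atTop := by
    refine tendsto_atTop_mono (fun n => ?_)
      ((tendsto_pow_atTop_atTop_of_one_lt hρ).atTop_mul_const hτ0)
    simpa using hpow 0 n
  -- A window of radius `r` lets Alice avoid half-width κ^(m+1) r ‖g‖ ≥ κ^(m+1) r c τ n. Time `n` is
  -- treated when τ n * r > κ^m δ, and there this exceeds κ^(2m+1) c δ.
  obtain ⟨δ₀, hδ₀, h⟩ := h (κ ^ (2 * m + 1) * c) (by positivity)
  -- The second bound says that at the start every time `n` is still at too coarse a scale, so that
  -- no time is missed.
  obtain ⟨δ, hδ, hδ1, hδ2⟩ : ∃ δ > 0, δ ≤ δ₀ ∧ δ < τ 0 * b₀.2 :=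
    ⟨min δ₀ (τ 0 * b₀.2 / 2), by positivity, min_le_left _ _,
      (min_le_right _ _).trans_lt (half_lt_self (by positivity))⟩
  obtain ⟨ε, hε, h⟩ := h δ hδ hδ1
  have h' : ∀ (b : V × ℝ) (n : ℕ), ∃ (g : StrongDual ℝ V) (a : ℝ), 0 < b.2 →
      closedBall b.1 b.2 ⊆ closedBall b₀.1 b₀.2 → τ n * b.2 ≤ δ → c * τ n ≤ ‖g‖ ∧
        ∀ x ∈ closedBall b.1 b.2, bad ε n x → |g x - a| ≤ κ ^ (2 * m + 1) * c * δ := by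
    intro b n
    by_cases hb : 0 < b.2 ∧ closedBall b.1 b.2 ⊆ closedBall b₀.1 b₀.2 ∧ τ n * b.2 ≤ δ
    · obtain ⟨g, a, hg⟩ := h b.1 b.2 hb.1 hb.2.1 n hb.2.2
      exact ⟨g, a, fun _ _ _ => hg⟩
    · exact ⟨0, 0, fun h1 h2 h3 => absurd ⟨h1, h2, h3⟩ hb⟩
  choose g a hga using h'
  -- `n₀ r` is the first time not yet too fine for radius `r`. The q m tasks of a window of radius
  -- `r` are the times n₀ r, n₀ r + 1, and so on.
  have hstart : ∀ r : ℝ, ∃ n₀ : ℕ, 0 < r → κ ^ m * δ < τ n₀ * r ∧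
      ∀ n, κ ^ m * δ < τ n * r → n₀ ≤ n := by
    intro r
    by_cases hr : 0 < r
    · have hex : ∃ n, κ ^ m * δ < τ n * r :=
        ((hτlim.atTop_mul_const hr).eventually_gt_atTop (κ ^ m * δ)).exists
      exact ⟨Nat.find hex, fun _ => ⟨Nat.find_spec hex, fun n hn => Nat.find_le hn⟩⟩
    · exact ⟨0, fun h => absurd h hr⟩
  choose n₀ hn₀ using hstart
  obtain ⟨F, hF, hP⟩ := hP (fun b j => g b (n₀ b.2 + j)) (fun b j => a b (n₀ b.2 + j))
  refine ⟨F, hF, fun B hB hB0 hr x hx => ⟨ε, hε, fun n hbad => ?_⟩⟩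
  obtain ⟨b, hb0, hbpos, hbrad, hblim, hbsub, hbx⟩ := hP B hB hr
  rw [hB0] at hb0 hbsub
  have hex : ∃ k, τ n * (b k).2 ≤ δ := by
    have h1 := hblim.const_mul (τ n)
    rw [mul_zero] at h1
    obtain ⟨k, hk⟩ := (h1.eventually (gt_mem_nhds hδ)).exists
    exact ⟨k, hk.le⟩
  obtain ⟨k, hk⟩ : ∃ k, Nat.find hex = k + 1 := Nat.exists_eq_succ_of_ne_zero fun h0 => by
    have h1 := Nat.find_spec hex
    rw [h0, hb0] at h1
    -- At the initial ball, τ n * b₀.2 ≥ τ 0 * b₀.2 > δ; so the first window with τ n * r ≤ δ has a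
    -- predecessor, which bounds its radius from below.
    have h2 := mul_le_mul_of_nonneg_right (hτn n) hb₀.le
    linarith
  have hk1 : τ n * (b (k + 1)).2 ≤ δ := hk ▸ Nat.find_spec hex
  have hk2 : δ < τ n * (b k).2 := not_le.1 (Nat.find_min hex (by omega))
  have hk3 : κ ^ m * δ < τ n * (b (k + 1)).2 := by
    calc κ ^ m * δ < κ ^ m * (τ n * (b k).2) := by gcongr
      _ = τ n * (κ ^ m * (b k).2) := by ring
      _ ≤ _ := by have := hτpos n; gcongr; exact hbrad k
  obtain ⟨h1, h2⟩ := hn₀ _ (hbpos (k + 1))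
  obtain ⟨j, hj⟩ := Nat.exists_eq_add_of_le (h2 n hk3)
  have hjlt : j < q * m := by
    by_contra! hge
    have h3 : (κ⁻¹) ^ m * τ (n₀ (b (k + 1)).2) ≤ τ n := by
      rw [hj]
      calc (κ⁻¹) ^ m * τ (n₀ (b (k + 1)).2) ≤ (ρ ^ q) ^ m * τ (n₀ (b (k + 1)).2) := by
            have := hτpos (n₀ (b (k + 1)).2); gcongr
        _ = ρ ^ (q * m) * τ (n₀ (b (k + 1)).2) := by rw [pow_mul]
        _ ≤ ρ ^ j * τ (n₀ (b (k + 1)).2) := by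
            have := hτpos (n₀ (b (k + 1)).2); gcongr; exact hρ.le
        _ ≤ _ := hpow _ _
    have h4 : (κ⁻¹) ^ m * (κ ^ m * δ) < (κ⁻¹) ^ m * (τ (n₀ (b (k + 1)).2) * (b (k + 1)).2) := by
      gcongr
    have h5 : (κ⁻¹) ^ m * (κ ^ m * δ) = δ := by
      rw [← mul_assoc, ← mul_pow, inv_mul_cancel₀ hκ.ne', one_pow, one_mul]
    have h6 : (κ⁻¹) ^ m * (τ (n₀ (b (k + 1)).2) * (b (k + 1)).2) ≤ τ n * (b (k + 1)).2 := by
      rw [← mul_assoc]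
      have := hbpos (k + 1)
      gcongr
    linarith
  obtain ⟨hxb, hxj⟩ := hbx x hx (k + 1)
  have hxj := hxj ⟨j, hjlt⟩
  simp only [← hj] at hxj
  obtain ⟨hg1, hg2⟩ := hga (b (k + 1)) n (hbpos _) (hbsub _) hk1
  have hgpos : 0 < ‖g (b (k + 1)) n‖ := (mul_pos hc (hτpos n)).trans_le hg1
  have h3 := hxj (norm_pos_iff.1 hgpos)
  have h4 := hg2 x hxb hbad
  have h5 : κ ^ (2 * m + 1) * c * δ ≤ κ ^ (m + 1) * (b (k + 1)).2 * ‖g (b (k + 1)) n‖ := by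
    calc κ ^ (2 * m + 1) * c * δ = κ ^ (m + 1) * c * (κ ^ m * δ) := by ring
      _ ≤ κ ^ (m + 1) * c * (τ n * (b (k + 1)).2) := by gcongr
      _ = κ ^ (m + 1) * (b (k + 1)).2 * (c * τ n) := by ring
      _ ≤ _ := by have := hbpos (k + 1); gcongr
  linarith

end Expanding

end NondenseOrbits

end

open scoped Manifold ContDiff Topology Polynomial

noncomputable section

namespace NondenseOrbits

open Filter Asymptotics

/-! ### The growth of the powers of a linear transformation -/

section Growth

/-- The binomial expansion of (N + z)^n, with N = T - z. The sum runs over j < k instead of j ≤ n so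
that the number of terms is independent of n: terms with j ≥ k vanish by nilpotency, those with j >
n because of the binomial coefficient. -/
lemma pow_apply_eq_sum {W : Type*} [AddCommGroup W] [Module ℂ W] (T : Module.End ℂ W) (z : ℂ)
    (x : W) (k : ℕ) (hx : ((T - algebraMap ℂ _ z) ^ k) x = 0) (n : ℕ) :
    (T ^ n) x = ∑ j ∈ Finset.range k,
      ((n.choose j : ℂ) * z ^ (n - j)) • ((T - algebraMap ℂ _ z) ^ j) x := by
  set N := T - algebraMap ℂ (Module.End ℂ W) z with hN
  have hT : T = N + algebraMap ℂ _ z := by rw [hN]; abel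
  have hc : Commute N (algebraMap ℂ _ z) := (Algebra.commutes z N).symm
  have h1 : (T ^ n) x = ∑ j ∈ Finset.range (n + 1),
      ((n.choose j : ℂ) * z ^ (n - j)) • (N ^ j) x := by
    rw [hT, hc.add_pow, LinearMap.sum_apply]
    refine Finset.sum_congr rfl fun j _ => ?_
    rw [mul_assoc, Module.End.mul_apply, ← map_pow]
    have : (algebraMap ℂ (Module.End ℂ W) (z ^ (n - j)) * (n.choose j : Module.End ℂ W)) x =
        ((n.choose j : ℂ) * z ^ (n - j)) • x := by
      rw [mul_comm ((n.choose j : ℂ)), mul_smul, Module.End.mul_apply, Module.algebraMap_end_apply]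
      congr 1
      rw [Module.End.natCast_apply, Nat.cast_smul_eq_nsmul]
    rw [this, map_smul]
  have h2 : ∀ K, n + 1 ≤ K → k ≤ K → ∑ j ∈ Finset.range (n + 1),
      ((n.choose j : ℂ) * z ^ (n - j)) • (N ^ j) x = ∑ j ∈ Finset.range k,
      ((n.choose j : ℂ) * z ^ (n - j)) • (N ^ j) x := by
    intro K hK hK'
    rw [Finset.sum_subset (Finset.range_mono hK), ← Finset.sum_subset (Finset.range_mono hK')]
    · intro j _ hj
      obtain ⟨l, rfl⟩ := Nat.exists_eq_add_of_le (not_lt.1 (fun h => hj (Finset.mem_range.2 h)))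
      rw [add_comm, pow_add, Module.End.mul_apply, hx, map_zero, smul_zero]
    · intro j _ hj
      rw [Nat.choose_eq_zero_of_lt (by simpa using hj)]
      simp
  rw [h1, h2 _ (le_max_left _ _) (le_max_right _ _)]

/-- The order of growth of the powers of `T`. -/
def growth (s : ℕ) (ρ : ℝ) (n : ℕ) : ℝ := ((max n 1 : ℕ) : ℝ) ^ (s - 1) * ρ ^ n

/-- The factor max n 1 in `growth` keeps it positive at n = 0, even when s > 1. -/
lemma growth_pos (s : ℕ) {ρ : ℝ} (hρ : 0 < ρ) (n : ℕ) : 0 < growth s ρ n := by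
  have : 0 < max n 1 := by omega
  unfold growth
  positivity

lemma mul_growth_le (s : ℕ) {ρ : ℝ} (hρ : 0 < ρ) (n : ℕ) :
    ρ * growth s ρ n ≤ growth s ρ (n + 1) := by
  unfold growth
  rw [pow_succ ρ n]
  have : ((max n 1 : ℕ) : ℝ) ^ (s - 1) ≤ ((max (n + 1) 1 : ℕ) : ℝ) ^ (s - 1) := by
    gcongr; omega
  calc ρ * (((max n 1 : ℕ) : ℝ) ^ (s - 1) * ρ ^ n)
      = ((max n 1 : ℕ) : ℝ) ^ (s - 1) * (ρ ^ n * ρ) := by ring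
    _ ≤ _ := by gcongr

lemma choose_mul_pow_isBigO {ρ : ℝ} (hρ : 0 < ρ) {s j : ℕ} (hj : j ≤ s - 1) {z : ℂ} (hz : ‖z‖ = ρ) :
    (fun n : ℕ => (n.choose j : ℂ) * z ^ (n - j)) =O[atTop] growth s ρ := by
  refine IsBigO.of_bound (ρ⁻¹ ^ j) ?_
  filter_upwards [eventually_ge_atTop j] with n hn
  rw [norm_mul, norm_pow, hz, Complex.norm_natCast, Real.norm_of_nonneg (growth_pos s hρ n).le,
    growth, inv_pow, pow_sub₀ _ hρ.ne' hn]
  have h1 : (n.choose j : ℝ) ≤ ((max n 1 : ℕ) : ℝ) ^ (s - 1) := by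
    exact_mod_cast (Nat.choose_le_pow n j).trans
      ((Nat.pow_le_pow_left (le_max_left n 1) j).trans (Nat.pow_le_pow_right (by omega) hj))
  calc (n.choose j : ℝ) * (ρ ^ n * (ρ ^ j)⁻¹) ≤ ((max n 1 : ℕ) : ℝ) ^ (s - 1) * (ρ ^ n * (ρ ^ j)⁻¹) := by
        gcongr
    _ = _ := by ring

lemma choose_mul_pow_isLittleO {ρ : ℝ} (hρ : 0 < ρ) {s j : ℕ} (hj : j < s - 1) {z : ℂ}
    (hz : ‖z‖ = ρ) :
    (fun n : ℕ => (n.choose j : ℂ) * z ^ (n - j)) =o[atTop] growth s ρ := by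
  refine (choose_mul_pow_isBigO (s := j + 1) hρ le_rfl hz).trans_isLittleO ?_
  have h1 : (fun n : ℕ => ((max n 1 : ℕ) : ℝ) ^ j) =o[atTop]
      fun n : ℕ => ((max n 1 : ℕ) : ℝ) ^ (s - 1) := by
    have h2 : Tendsto (fun n : ℕ => ((max n 1 : ℕ) : ℝ)) atTop atTop :=
      tendsto_natCast_atTop_atTop.comp (tendsto_atTop_mono (fun n => le_max_left n 1) tendsto_id)
    exact (isLittleO_pow_pow_atTop_of_lt hj).comp_tendsto h2
  exact h1.mul_isBigO (isBigO_refl (fun n : ℕ => ρ ^ n) _)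

lemma choose_mul_pow_isLittleO_of_lt {ρ : ℝ} (s j : ℕ) {z : ℂ} (hz : ‖z‖ < ρ) :
    (fun n : ℕ => (n.choose j : ℂ) * z ^ (n - j)) =o[atTop] growth s ρ := by
  have hρ : 0 < ρ := (norm_nonneg z).trans_lt hz
  -- A radius below ρ that is at least ‖z‖ and nonzero even for z = 0; the gap between μ and ρ
  -- absorbs the polynomial factor.
  set μ := max ‖z‖ (ρ / 2) with hμ
  have hμ0 : 0 < μ := lt_of_lt_of_le (half_pos hρ) (le_max_right _ _)
  have hμρ : μ < ρ := max_lt hz (half_lt_self hρ)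
  have h1 : (fun n : ℕ => (n.choose j : ℂ) * z ^ (n - j)) =O[atTop]
      fun n : ℕ => (n : ℝ) ^ j * μ ^ n := by
    refine IsBigO.of_bound (μ⁻¹ ^ j) ?_
    filter_upwards [eventually_ge_atTop j] with n hn
    rw [norm_mul, norm_pow, Complex.norm_natCast, Real.norm_of_nonneg (by positivity)]
    have h1 : (n.choose j : ℝ) ≤ (n : ℝ) ^ j := by exact_mod_cast Nat.choose_le_pow n j
    have h2 : ‖z‖ ^ (n - j) ≤ μ ^ n * (μ ^ j)⁻¹ := by
      rw [← pow_sub₀ _ hμ0.ne' hn]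
      gcongr; exact le_max_left _ _
    calc (n.choose j : ℝ) * ‖z‖ ^ (n - j) ≤ (n : ℝ) ^ j * (μ ^ n * (μ ^ j)⁻¹) := by gcongr
      _ = _ := by rw [inv_pow]; ring
  refine h1.trans_isLittleO ?_
  have h2 : (fun n : ℕ => (n : ℝ) ^ j * μ ^ n) =o[atTop] fun n : ℕ => ρ ^ n :=
    isLittleO_pow_const_mul_const_pow_const_pow_of_norm_lt j (by rwa [Real.norm_of_nonneg hμ0.le])
  refine h2.trans_isBigO (IsBigO.of_bound 1 (Eventually.of_forall fun n => ?_))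
  rw [one_mul, Real.norm_of_nonneg (by positivity), Real.norm_of_nonneg (growth_pos s hρ n).le]
  refine le_mul_of_one_le_left (by positivity) (one_le_pow₀ ?_)
  exact_mod_cast le_max_right n 1

/-- The complexification of a linear transformation. -/
abbrev complexify {V : Type*} [AddCommGroup V] [Module ℝ V] (T : V →ₗ[ℝ] V) :
    Module.End ℂ (TensorProduct ℝ ℂ V) := T.baseChange ℂ

variable {V : Type*} [AddCommGroup V] [Module ℝ V]

lemma aeval_baseChange_complexMinpoly (T : V →ₗ[ℝ] V) :
    Polynomial.aeval (complexify T) (complexMinpoly T) = 0 := by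
  rw [complexMinpoly, Polynomial.aeval_map_algebraMap]
  have h3 := Polynomial.aeval_algHom_apply (Module.End.baseChangeHom ℝ ℂ V) T (minpoly ℝ T)
  rw [minpoly.aeval, map_zero] at h3
  exact h3

lemma mem_complexEigenvalues_of_mem_maxGenEigenspace (T : V →ₗ[ℝ] V) {z : ℂ}
    {x : TensorProduct ℝ ℂ V} (hx0 : x ≠ 0)
    (hx : x ∈ (complexify T).maxGenEigenspace z) :
    z ∈ complexEigenvalues T := by
  have h : (complexify T).HasUnifEigenvalue z ⊤ :=
    fun h => hx0 (by rw [Module.End.maxGenEigenspace, h] at hx; exact (Submodule.mem_bot ℂ).1 hx)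
  exact h.lt one_pos

variable [FiniteDimensional ℝ V]

/-- A generalized eigenvector for `z` is killed by the power of `T - z` given by the multiplicity of
`z` in the minimal polynomial. -/
lemma pow_minpolyMultiplicity_apply (T : V →ₗ[ℝ] V) (z : ℂ) (x : TensorProduct ℝ ℂ V)
    (hx : x ∈ (complexify T).maxGenEigenspace z) :
    (((complexify T) - algebraMap ℂ _ z) ^
      minpolyMultiplicity T z) x = 0 := by
  set Tc := complexify T with hTc
  obtain ⟨k, hk⟩ := (Module.End.mem_maxGenEigenspace _ _ _).1 hx
  obtain ⟨R, hR, hcop⟩ := Polynomial.exists_eq_pow_rootMultiplicity_mul_and_not_dvd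
    (complexMinpoly T) (complexMinpoly_ne_zero T) z
  -- With `complexMinpoly T` = (X - z)^s R, R is coprime to (X - z)^k. By Bézout, (X - z)^s is a
  -- combination of the minimal polynomial, which kills everything, and (X - z)^k, which kills `x`.
  have hco : IsCoprime R ((Polynomial.X - Polynomial.C z) ^ k) :=
    (((Polynomial.irreducible_X_sub_C z).coprime_iff_not_dvd.2 hcop).symm).pow_right
  obtain ⟨a, b, hab⟩ := hco
  have key : ∀ n, ((Tc - algebraMap ℂ _ z) ^ n) =
      Polynomial.aeval Tc ((Polynomial.X - Polynomial.C z) ^ n) := by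
    intro n; simp [Algebra.algebraMap_eq_smul_one]
  have h1 : (Polynomial.X - Polynomial.C z) ^ minpolyMultiplicity T z =
      a * complexMinpoly T + ((Polynomial.X - Polynomial.C z) ^ minpolyMultiplicity T z * b) *
        (Polynomial.X - Polynomial.C z) ^ k := by
    have h2 : complexMinpoly T = (Polynomial.X - Polynomial.C z) ^ minpolyMultiplicity T z * R := hR
    rw [h2]
    linear_combination (-(Polynomial.X - Polynomial.C z) ^ minpolyMultiplicity T z) * hab
  have h4 : ((Tc - algebraMap ℂ _ z) ^ k) x = 0 := by
    rw [Algebra.algebraMap_eq_smul_one]; exact hk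
  rw [key, h1, map_add, map_mul, map_mul, aeval_baseChange_complexMinpoly, ← key k]
  simp [h4]

lemma norm_le_rho (T : V →ₗ[ℝ] V) {z : ℂ} (hz : z ∈ complexEigenvalues T) : ‖z‖ ≤ rho T :=
  le_csSup ((finite_complexEigenvalues T).image _).bddAbove ⟨z, hz, rfl⟩

lemma minpolyMultiplicity_le (T : V →ₗ[ℝ] V) {z : ℂ} (hz : z ∈ complexEigenvalues T)
    (hz' : ‖z‖ = rho T) : minpolyMultiplicity T z ≤ maxMultiplicity T :=
  le_csSup (((finite_complexEigenvalues T).subset fun _ h => h.1).image _).bddAbove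
    ⟨z, ⟨hz, hz'⟩, rfl⟩

lemma minpolyMultiplicity_pos (T : V →ₗ[ℝ] V) {z : ℂ} (hz : z ∈ complexEigenvalues T) :
    0 < minpolyMultiplicity T z :=
  (Polynomial.rootMultiplicity_pos (complexMinpoly_ne_zero T)).2
    ((mem_complexEigenvalues_iff T z).1 hz)

/-- The action of `p_T(T)` on the generalized eigenvectors. -/
lemma aeval_leadingPolynomial_apply (T : V →ₗ[ℝ] V) {z : ℂ} (hz : z ∈ complexEigenvalues T)
    (x : TensorProduct ℝ ℂ V)
    (hx : x ∈ (complexify T).maxGenEigenspace z) :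
    ((‖z‖ = rho T ∧ minpolyMultiplicity T z = maxMultiplicity T) ∧
      ((Polynomial.aeval T (leadingPolynomial T)).baseChange ℂ) x =
      (((complexify T) - algebraMap ℂ _ z) ^
        (maxMultiplicity T - 1)) x) ∨
    (¬ (‖z‖ = rho T ∧ minpolyMultiplicity T z = maxMultiplicity T) ∧
      ((Polynomial.aeval T (leadingPolynomial T)).baseChange ℂ) x = 0) := by
  have hp := (existsUnique_isLeadingPolynomial T).choose_spec.1.2 z hz
  change _ ∣ (leadingPolynomial T).map (algebraMap ℝ ℂ) - _ at hp
  obtain ⟨R, hR⟩ := hp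
  set Tc := complexify T with hTc
  have h1 : ((Polynomial.aeval T (leadingPolynomial T)).baseChange ℂ) =
      Polynomial.aeval Tc ((leadingPolynomial T).map (algebraMap ℝ ℂ)) := by
    rw [Polynomial.aeval_map_algebraMap]
    exact (Polynomial.aeval_algHom_apply (Module.End.baseChangeHom ℝ ℂ V) T (leadingPolynomial T)).symm
  have key : ∀ n, Polynomial.aeval Tc ((Polynomial.X - Polynomial.C z) ^ n) =
      ((Tc - algebraMap ℂ _ z) ^ n) := by
    intro n; simp [Algebra.algebraMap_eq_smul_one]
  have h2 : Polynomial.aeval Tc ((Polynomial.X - Polynomial.C z) ^ minpolyMultiplicity T z * R) x = 0 := by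
    rw [mul_comm, map_mul, key, Module.End.mul_apply, pow_minpolyMultiplicity_apply T z x hx, map_zero]
  rw [← hR, map_sub, LinearMap.sub_apply, sub_eq_zero, ← h1] at h2
  by_cases hc : ‖z‖ = rho T ∧ minpolyMultiplicity T z = maxMultiplicity T
  · left
    rw [if_pos hc, key] at h2
    exact ⟨hc, h2⟩
  · right
    rw [if_neg hc, map_zero] at h2
    exact ⟨hc, h2⟩

/-- A property that holds for generalized eigenvectors and is preserved by sums holds always. -/
lemma maxGenEigenspace_induction (T : V →ₗ[ℝ] V) {P : TensorProduct ℝ ℂ V → Prop}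
    (zero : P 0) (add : ∀ x y, P x → P y → P (x + y))
    (eigen : ∀ z ∈ complexEigenvalues T, ∀ x,
      x ∈ (complexify T).maxGenEigenspace z → P x)
    (x : TensorProduct ℝ ℂ V) : P x := by
  have h : x ∈ ⨆ z, (complexify T).maxGenEigenspace z := by
    rw [Module.End.iSup_maxGenEigenspace_eq_top]; trivial
  refine Submodule.iSup_induction _ (motive := P) h (fun z y hy => ?_) zero add
  by_cases hy0 : y = 0
  · rw [hy0]; exact zero
  · exact eigen z (mem_complexEigenvalues_of_mem_maxGenEigenspace T hy0 hy) y hy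

/-- On a generalized eigenvector, only the term j = s - 1 of the binomial expansion can have full
order of growth, and only if z has modulus ρ and multiplicity s. There p_T(T) is (T - z)^(s-1), so
this term is the one subtracted; on the other generalized eigenspaces p_T(T) vanishes. Testing with
functionals avoids choosing a norm on the complexification. -/
lemma complex_pow_sub_isLittleO (T : V →ₗ[ℝ] V) (hρ : 0 < rho T) (x : TensorProduct ℝ ℂ V)
    (Ξ : TensorProduct ℝ ℂ V →ₗ[ℂ] ℂ) :
    (fun n : ℕ => Ξ (((complexify T) ^ n) x -
      (n.choose (maxMultiplicity T - 1) : ℂ) • ((complexify T) ^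
        (n - (maxMultiplicity T - 1))) ((Polynomial.aeval T (leadingPolynomial T)).baseChange ℂ x)))
      =o[atTop] growth (maxMultiplicity T) (rho T) := by
  refine maxGenEigenspace_induction T (P := fun x => (fun n : ℕ => Ξ (((complexify T) ^ n) x -
      (n.choose (maxMultiplicity T - 1) : ℂ) • ((complexify T) ^
        (n - (maxMultiplicity T - 1))) ((Polynomial.aeval T (leadingPolynomial T)).baseChange ℂ x)))
      =o[atTop] growth (maxMultiplicity T) (rho T)) ?_ ?_ ?_ x
  · simp
  · intro x y hx hy
    refine (hx.add hy).congr_left fun n => ?_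
    rw [← map_add]
    congr 1
    simp only [map_add, smul_add]
    abel
  intro z hz x hx
  set Tc := complexify T with hTc
  have hk := pow_minpolyMultiplicity_apply T z x hx
  have hsum : ∀ k, (∀ j < k, (fun n : ℕ => (n.choose j : ℂ) * z ^ (n - j)) =o[atTop]
      growth (maxMultiplicity T) (rho T)) →
      (fun n : ℕ => Ξ (∑ j ∈ Finset.range k, ((n.choose j : ℂ) * z ^ (n - j)) •
        ((Tc - algebraMap ℂ _ z) ^ j) x)) =o[atTop] growth (maxMultiplicity T) (rho T) := by
    intro k h
    simp only [map_sum, map_smul, smul_eq_mul]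
    refine IsLittleO.fun_sum fun j hj => ?_
    exact ((h j (Finset.mem_range.1 hj)).const_mul_left (Ξ (((Tc - algebraMap ℂ _ z) ^ j) x))).congr_left
      fun n => mul_comm _ _
  rcases aeval_leadingPolynomial_apply T hz x hx with ⟨⟨hz1, hz2⟩, hQ⟩ | ⟨hz1, hQ⟩
  · have hs : 0 < maxMultiplicity T := hz2 ▸ minpolyMultiplicity_pos T hz
    rw [hz2] at hk
    set s := maxMultiplicity T
    have hs1 : s = (s - 1) + 1 := by omega
    have hNs : ∀ k, (Tc ^ k) (((Tc - algebraMap ℂ _ z) ^ (s - 1)) x) =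
        z ^ k • ((Tc - algebraMap ℂ _ z) ^ (s - 1)) x := by
      have h1 : Tc (((Tc - algebraMap ℂ _ z) ^ (s - 1)) x) =
          z • ((Tc - algebraMap ℂ _ z) ^ (s - 1)) x := by
        rw [hs1, pow_succ', Module.End.mul_apply, LinearMap.sub_apply, sub_eq_zero,
          Module.algebraMap_end_apply] at hk
        exact hk
      intro k
      induction k with
      | zero => simp
      | succ k ih => rw [pow_succ, Module.End.mul_apply, h1, map_smul, ih, smul_smul, pow_succ']
    refine (hsum (s - 1) fun j hj => choose_mul_pow_isLittleO hρ hj hz1).congr_left fun n => ?_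
    congr 1
    have h2 := pow_apply_eq_sum Tc z x (s - 1 + 1) (by rw [← hs1]; exact hk) n
    rw [Finset.sum_range_succ] at h2
    rw [h2, hQ, hNs, smul_smul, add_sub_cancel_right]
  · refine (hsum (minpolyMultiplicity T z) fun j hj => ?_).congr_left fun n => ?_
    · rcases (norm_le_rho T hz).lt_or_eq with h | h
      · exact choose_mul_pow_isLittleO_of_lt _ _ h
      · have h1 := minpolyMultiplicity_le T hz h
        have h2 : minpolyMultiplicity T z ≠ maxMultiplicity T := fun h2 => hz1 ⟨h, h2⟩
        exact choose_mul_pow_isLittleO hρ (by omega) h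
    · rw [hQ, map_zero, smul_zero, sub_zero, ← pow_apply_eq_sum Tc z x _ hk n]

/-- Since (T - z)^s kills x, T - z kills (T - z)^(s-1) x. So the complexified image of p_T(T) is
spanned by eigenvectors with eigenvalues of modulus ρ, and on it T and its inverse have powers of
exact exponential order. -/
lemma complexify_leadingPolynomial_eigenvector (T : V →ₗ[ℝ] V) {z : ℂ}
    (hz : z ∈ complexEigenvalues T) (x : TensorProduct ℝ ℂ V)
    (hx : x ∈ (complexify T).maxGenEigenspace z) :
    (‖z‖ = rho T ∧ complexify T ((Polynomial.aeval T (leadingPolynomial T)).baseChange ℂ x) =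
      z • (Polynomial.aeval T (leadingPolynomial T)).baseChange ℂ x) ∨
    (Polynomial.aeval T (leadingPolynomial T)).baseChange ℂ x = 0 := by
  rcases aeval_leadingPolynomial_apply T hz x hx with ⟨⟨hz1, hz2⟩, hQ⟩ | ⟨-, hQ⟩
  · left
    have hk := pow_minpolyMultiplicity_apply T z x hx
    have hs : 0 < maxMultiplicity T := hz2 ▸ minpolyMultiplicity_pos T hz
    have hs1 : maxMultiplicity T = (maxMultiplicity T - 1) + 1 := by omega
    rw [hz2, hs1, pow_succ', Module.End.mul_apply, LinearMap.sub_apply, sub_eq_zero,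
      Module.algebraMap_end_apply] at hk
    rw [hQ]
    exact ⟨hz1, hk⟩
  · exact Or.inr hQ

lemma complex_pow_isBigO (T : V →ₗ[ℝ] V) (x : TensorProduct ℝ ℂ V)
    (Ξ : TensorProduct ℝ ℂ V →ₗ[ℂ] ℂ) :
    (fun n : ℕ => Ξ (((complexify T) ^ n)
      ((Polynomial.aeval T (leadingPolynomial T)).baseChange ℂ x))) =O[atTop] fun n => (rho T) ^ n := by
  refine maxGenEigenspace_induction T (P := fun x => (fun n : ℕ => Ξ ((complexify T ^ n)
      ((Polynomial.aeval T (leadingPolynomial T)).baseChange ℂ x))) =O[atTop]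
      fun n => (rho T) ^ n) ?_ ?_ ?_ x
  · simpa using isBigO_zero _ _
  · intro x y hx hy
    refine (hx.add hy).congr_left fun n => ?_
    simp only [map_add]
  intro z hz x hx
  rcases complexify_leadingPolynomial_eigenvector T hz x hx with ⟨hz1, hQ⟩ | hQ
  · refine IsBigO.of_bound ‖Ξ ((Polynomial.aeval T (leadingPolynomial T)).baseChange ℂ x)‖
      (Eventually.of_forall fun n => ?_)
    have h1 : (complexify T ^ n) ((Polynomial.aeval T (leadingPolynomial T)).baseChange ℂ x) =
        z ^ n • ((Polynomial.aeval T (leadingPolynomial T)).baseChange ℂ x) := by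
      induction n with
      | zero => simp
      | succ n ih => rw [pow_succ, Module.End.mul_apply, hQ, map_smul, ih, smul_smul, pow_succ']
    rw [h1, map_smul, norm_smul, norm_pow, norm_pow, hz1, mul_comm, Real.norm_eq_abs,
      abs_of_nonneg (hz1 ▸ norm_nonneg z)]
  · simpa [hQ] using isBigO_zero _ _

lemma complex_inverse_pow_isBigO (T S : V →ₗ[ℝ] V) (hST : S ∘ₗ T = LinearMap.id)
    (x : TensorProduct ℝ ℂ V) (Ξ : TensorProduct ℝ ℂ V →ₗ[ℂ] ℂ) :
    (fun n : ℕ => Ξ ((complexify S ^ n)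
      ((Polynomial.aeval T (leadingPolynomial T)).baseChange ℂ x))) =O[atTop]
      fun n => (rho T)⁻¹ ^ n := by
  refine maxGenEigenspace_induction T (P := fun x => (fun n : ℕ => Ξ ((complexify S ^ n)
      ((Polynomial.aeval T (leadingPolynomial T)).baseChange ℂ x))) =O[atTop]
      fun n => (rho T)⁻¹ ^ n) ?_ ?_ ?_ x
  · simpa using isBigO_zero _ _
  · intro x y hx hy
    refine (hx.add hy).congr_left fun n => ?_
    simp only [map_add]
  intro z hz x hx
  rcases complexify_leadingPolynomial_eigenvector T hz x hx with ⟨hz1, hQ⟩ | hQ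
  · refine IsBigO.of_bound ‖Ξ ((Polynomial.aeval T (leadingPolynomial T)).baseChange ℂ x)‖
      (Eventually.of_forall fun n => ?_)
    set y := (Polynomial.aeval T (leadingPolynomial T)).baseChange ℂ x with hy
    have hSy : complexify S y = z⁻¹ • y := by
      have h1 : complexify S (complexify T y) = y := by
        change (S.baseChange ℂ ∘ₗ T.baseChange ℂ) y = y
        rw [← LinearMap.baseChange_comp, hST, LinearMap.baseChange_id, LinearMap.id_apply]
      rw [hQ, map_smul] at h1
      -- If z = 0, then y = S T y = 0, and the identity holds trivially.
      by_cases hz0 : z = 0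
      · rw [hz0, zero_smul] at h1
        rw [← h1]; simp
      · rw [eq_inv_smul_iff₀ hz0, h1]
    have h1 : (complexify S ^ n) y = z⁻¹ ^ n • y := by
      induction n with
      | zero => simp
      | succ n ih => rw [pow_succ, Module.End.mul_apply, hSy, map_smul, ih, smul_smul, pow_succ']
    rw [h1, map_smul, norm_smul, norm_pow, norm_pow, norm_inv, hz1, mul_comm, Real.norm_eq_abs,
      abs_of_nonneg (inv_nonneg.2 (hz1 ▸ norm_nonneg z))]
  · simpa [hQ] using isBigO_zero _ _

end Growth

/-! ### Growth of powers on the real space, and small preimages -/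

section RealGrowth

variable {V : Type*} [NormedAddCommGroup V] [NormedSpace ℝ V]

/-- A real functional, extended to the complexification. -/
lemma exists_complex_functional (ξ : V →ₗ[ℝ] ℝ) :
    ∃ Ξ : TensorProduct ℝ ℂ V →ₗ[ℂ] ℂ, ∀ v, Ξ (TensorProduct.tmul ℝ 1 v) = ξ v := by
  refine ⟨(TensorProduct.AlgebraTensorModule.rid ℝ ℂ ℂ).toLinearMap ∘ₗ ξ.baseChange ℂ, fun v => ?_⟩
  simp

lemma complexify_pow_tmul (T : V →ₗ[ℝ] V) (n : ℕ) (v : V) :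
    (complexify T ^ n) (TensorProduct.tmul ℝ 1 v) = TensorProduct.tmul ℝ 1 ((T ^ n) v) := by
  induction n generalizing v with
  | zero => simp
  | succ n ih => rw [pow_succ, Module.End.mul_apply, LinearMap.baseChange_tmul, ih, pow_succ,
      Module.End.mul_apply]

variable [FiniteDimensional ℝ V]

lemma isLittleO_of_forall_linearMap {v : ℕ → V} {τ : ℕ → ℝ}
    (h : ∀ ξ : V →ₗ[ℝ] ℝ, (fun n => ξ (v n)) =o[atTop] τ) : v =o[atTop] τ := by
  let b := Module.finBasis ℝ V
  have h1 : v = fun n => ∑ i, b.coord i (v n) • b i := by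
    funext n; exact (b.sum_repr (v n)).symm
  rw [h1]
  refine IsLittleO.fun_sum fun i _ => ?_
  have := (h (b.coord i)).smul_isBigO (isBigO_refl (fun _ : ℕ => b i) atTop)
  refine this.trans_isBigO (IsBigO.of_bound ‖b i‖ (Eventually.of_forall fun n => ?_))
  rw [norm_smul, mul_comm]

lemma isBigO_of_forall_linearMap {v : ℕ → V} {τ : ℕ → ℝ}
    (h : ∀ ξ : V →ₗ[ℝ] ℝ, (fun n => ξ (v n)) =O[atTop] τ) : v =O[atTop] τ := by
  let b := Module.finBasis ℝ V
  have h1 : v = fun n => ∑ i, b.coord i (v n) • b i := by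
    funext n; exact (b.sum_repr (v n)).symm
  rw [h1]
  refine IsBigO.fun_sum fun i _ => ?_
  have := (h (b.coord i)).smul (isBigO_refl (fun _ : ℕ => b i) atTop)
  refine this.trans (IsBigO.of_bound ‖b i‖ (Eventually.of_forall fun n => ?_))
  rw [norm_smul, mul_comm]

/-- Pointwise smallness of linear maps is uniform. -/
lemma eventually_norm_apply_le (A : ℕ → V →ₗ[ℝ] V) {τ : ℕ → ℝ}
    (h : ∀ w, (fun n => A n w) =o[atTop] τ) {ε : ℝ} (hε : 0 < ε) :
    ∀ᶠ n in atTop, ∀ w, ‖A n w‖ ≤ ε * ‖τ n‖ * ‖w‖ := by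
  let b := Module.finBasis ℝ V
  set C := ∑ i, ‖LinearMap.toContinuousLinearMap (b.coord i)‖ with hC
  have hC0 : 0 ≤ C := Finset.sum_nonneg fun i _ => norm_nonneg _
  have h1 : ∀ᶠ n in atTop, ∀ i, ‖A n (b i)‖ ≤ ε / (C + 1) * ‖τ n‖ :=
    eventually_all.2 fun i => (h (b i)).bound (by positivity)
  filter_upwards [h1] with n hn w
  have h2 : A n w = ∑ i, b.coord i w • A n (b i) := by
    conv_lhs => rw [← b.sum_repr w, map_sum]
    simp
  rw [h2]
  calc ‖∑ i, b.coord i w • A n (b i)‖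
      ≤ ∑ i, ‖LinearMap.toContinuousLinearMap (b.coord i)‖ * ‖w‖ * (ε / (C + 1) * ‖τ n‖) := by
        refine (norm_sum_le _ _).trans (Finset.sum_le_sum fun i _ => ?_)
        rw [norm_smul]
        gcongr
        · exact (LinearMap.toContinuousLinearMap (b.coord i)).le_opNorm w
        · exact hn i
    _ = C / (C + 1) * (ε * ‖τ n‖ * ‖w‖) := by
        rw [← Finset.sum_mul, ← Finset.sum_mul, ← hC]; ring
    _ ≤ 1 * (ε * ‖τ n‖ * ‖w‖) := by
        gcongr
        rw [div_le_one (by positivity)]; linarith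
    _ = _ := one_mul _

lemma exists_norm_apply_le (A : ℕ → V →ₗ[ℝ] V) {τ : ℕ → ℝ} (hτ : ∀ n, 0 < τ n)
    (h : ∀ w, (fun n => A n w) =O[atTop] τ) :
    ∃ C, 0 < C ∧ ∀ n w, ‖A n w‖ ≤ C * τ n * ‖w‖ := by
  let b := Module.finBasis ℝ V
  have h1 : ∀ i, ∃ C, ∀ n, ‖A n (b i)‖ ≤ C * ‖τ n‖ := fun i =>
    (isBigO_nat_atTop_iff fun n hn => absurd hn (hτ n).ne').1 (h (b i))
  choose C hC using h1
  refine ⟨1 + ∑ i, ‖LinearMap.toContinuousLinearMap (b.coord i)‖ * |C i|, ?_, fun n w => ?_⟩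
  · have : 0 ≤ ∑ i, ‖LinearMap.toContinuousLinearMap (b.coord i)‖ * |C i| :=
      Finset.sum_nonneg fun i _ => by positivity
    linarith
  have h2 : A n w = ∑ i, b.coord i w • A n (b i) := by
    conv_lhs => rw [← b.sum_repr w, map_sum]
    simp
  rw [h2]
  have hτn := hτ n
  calc ‖∑ i, b.coord i w • A n (b i)‖
      ≤ ∑ i, ‖LinearMap.toContinuousLinearMap (b.coord i)‖ * ‖w‖ * (|C i| * τ n) := by
        refine (norm_sum_le _ _).trans (Finset.sum_le_sum fun i _ => ?_)
        rw [norm_smul]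
        gcongr
        · exact (LinearMap.toContinuousLinearMap (b.coord i)).le_opNorm w
        · refine (hC i n).trans ?_
          rw [Real.norm_of_nonneg (hτ n).le]
          gcongr; exact le_abs_self _
    _ = (∑ i, ‖LinearMap.toContinuousLinearMap (b.coord i)‖ * |C i|) * τ n * ‖w‖ := by
        rw [Finset.sum_mul, Finset.sum_mul]
        exact Finset.sum_congr rfl fun i _ => by ring
    _ ≤ _ := by gcongr; linarith

lemma pow_sub_isLittleO (T : V →ₗ[ℝ] V) (hρ : 0 < rho T) (w : V) :
    (fun n : ℕ => (T ^ n) w - (n.choose (maxMultiplicity T - 1) : ℝ) •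
      (T ^ (n - (maxMultiplicity T - 1))) (Polynomial.aeval T (leadingPolynomial T) w))
      =o[atTop] growth (maxMultiplicity T) (rho T) := by
  refine isLittleO_of_forall_linearMap fun ξ => ?_
  obtain ⟨Ξ, hΞ⟩ := exists_complex_functional ξ
  have h := complex_pow_sub_isLittleO T hρ (TensorProduct.tmul ℝ 1 w) Ξ
  rw [← isLittleO_norm_left] at h ⊢
  refine h.congr_left fun n => ?_
  rw [LinearMap.baseChange_tmul, complexify_pow_tmul, complexify_pow_tmul, map_sub, map_smul, hΞ, hΞ,
    map_sub, map_smul, ← Complex.norm_real]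
  congr 1
  push_cast [smul_eq_mul]
  rfl

lemma pow_leadingPolynomial_isBigO (T : V →ₗ[ℝ] V) (w : V) :
    (fun n : ℕ => (T ^ n) (Polynomial.aeval T (leadingPolynomial T) w))
      =O[atTop] fun n => rho T ^ n := by
  refine isBigO_of_forall_linearMap fun ξ => ?_
  obtain ⟨Ξ, hΞ⟩ := exists_complex_functional ξ
  have h := complex_pow_isBigO T (TensorProduct.tmul ℝ 1 w) Ξ
  rw [← isBigO_norm_left] at h ⊢
  refine h.congr_left fun n => ?_
  rw [LinearMap.baseChange_tmul, complexify_pow_tmul, hΞ, Complex.norm_real]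

lemma inverse_pow_leadingPolynomial_isBigO (T S : V →ₗ[ℝ] V) (hST : S ∘ₗ T = LinearMap.id) (w : V) :
    (fun n : ℕ => (S ^ n) (Polynomial.aeval T (leadingPolynomial T) w))
      =O[atTop] fun n => (rho T)⁻¹ ^ n := by
  refine isBigO_of_forall_linearMap fun ξ => ?_
  obtain ⟨Ξ, hΞ⟩ := exists_complex_functional ξ
  have h := complex_inverse_pow_isBigO T S hST (TensorProduct.tmul ℝ 1 w) Ξ
  rw [← isBigO_norm_left] at h ⊢
  refine h.congr_left fun n => ?_
  rw [LinearMap.baseChange_tmul, complexify_pow_tmul, hΞ, Complex.norm_real]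

/-- The powers of `T` grow at most like `growth`. -/
theorem exists_norm_pow_le (T : V →ₗ[ℝ] V) (hρ : 0 < rho T) :
    ∃ C, 0 < C ∧ ∀ n w, ‖(T ^ n) w‖ ≤ C * growth (maxMultiplicity T) (rho T) n * ‖w‖ := by
  refine exists_norm_apply_le (fun n => T ^ n) (growth_pos _ hρ) fun w => ?_
  set s := maxMultiplicity T
  set Q := Polynomial.aeval T (leadingPolynomial T)
  have h1 : (fun n : ℕ => (n.choose (s - 1) : ℝ) • (T ^ (n - (s - 1))) (Q w)) =O[atTop]
      growth s (rho T) := by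
    have h2 : (fun n : ℕ => (T ^ (n - (s - 1))) (Q w)) =O[atTop] fun n => rho T ^ (n - (s - 1)) :=
      (pow_leadingPolynomial_isBigO T w).comp_tendsto (tendsto_sub_atTop_nat (s - 1))
    have h3 := (isBigO_refl (fun n : ℕ => (n.choose (s - 1) : ℝ)) atTop).smul h2
    refine h3.trans ?_
    have h4 := choose_mul_pow_isBigO (s := s) hρ le_rfl (z := (rho T : ℂ))
      (by rw [Complex.norm_real, Real.norm_of_nonneg hρ.le])
    rw [← isBigO_norm_left] at h4 ⊢
    refine h4.congr_left fun n => ?_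
    simp
  exact ((pow_sub_isLittleO T hρ w).isBigO.add h1).congr_left fun n => by
    rw [sub_add_cancel]

lemma mem_maxExpandingSubspace_iff (T : V →ₗ[ℝ] V) (hρ : 1 < rho T) (v : V) :
    v ∈ maxExpandingSubspace T ↔ ∃ w, Polynomial.aeval T (leadingPolynomial T) w = v := by
  rw [maxExpandingSubspace, if_pos hρ, LinearMap.mem_range]

lemma map_mem_maxExpandingSubspace (T S : V →ₗ[ℝ] V) (hc : Commute S T) {v : V}
    (hv : v ∈ maxExpandingSubspace T) : S v ∈ maxExpandingSubspace T := by
  by_cases hρ : 1 < rho T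
  · rw [mem_maxExpandingSubspace_iff T hρ] at hv ⊢
    obtain ⟨w, rfl⟩ := hv
    refine ⟨S w, ?_⟩
    have h : Commute S (Polynomial.aeval T (leadingPolynomial T)) := by
      induction leadingPolynomial T using Polynomial.induction_on' with
      | add p q hp hq => rw [map_add]; exact hp.add_right hq
      | monomial n a =>
        rw [Polynomial.aeval_monomial]
        exact Commute.mul_right (Algebra.commutes a S).symm (hc.pow_right n)
    rw [← Module.End.mul_apply, ← h.eq, Module.End.mul_apply]
  · rw [maxExpandingSubspace, if_neg hρ, Submodule.mem_bot] at hv ⊢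
    rw [hv, map_zero]

lemma commute_of_comp_eq_id {T S : V →ₗ[ℝ] V} (hST : S ∘ₗ T = LinearMap.id) : Commute S T := by
  have h : S * T = 1 := hST
  rw [Commute, SemiconjBy, h, (mul_eq_one_comm.1 h)]

lemma exists_norm_inverse_pow_le (T S : V →ₗ[ℝ] V) (hST : S ∘ₗ T = LinearMap.id) (hρ : 1 < rho T)
    {v : V} (hv : v ∈ maxExpandingSubspace T) :
    ∃ C, ∀ n, ‖(S ^ n) v‖ ≤ C * (rho T)⁻¹ ^ n := by
  obtain ⟨w, rfl⟩ := (mem_maxExpandingSubspace_iff T hρ v).1 hv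
  have hpos : ∀ n : ℕ, 0 < (rho T)⁻¹ ^ n := fun n => by positivity
  obtain ⟨C, hC⟩ := (isBigO_nat_atTop_iff fun n hn => absurd hn (hpos n).ne').1
    (inverse_pow_leadingPolynomial_isBigO T S hST w)
  refine ⟨C, fun n => ?_⟩
  have := hC n
  rwa [Real.norm_of_nonneg (hpos n).le] at this

lemma pow_mul_pow_eq_one_of_comp {T S : V →ₗ[ℝ] V} (hST : S ∘ₗ T = LinearMap.id) (n : ℕ) (v : V) :
    (T ^ n) ((S ^ n) v) = v := by
  have h : T * S = 1 := mul_eq_one_comm.1 hST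
  have hc : Commute T S := (commute_of_comp_eq_id hST).symm
  rw [← Module.End.mul_apply, ← hc.mul_pow, h, one_pow, Module.End.one_apply]

/-- For n ≥ 2s + 1 one has n + 1 - (s - 1) ≥ n / 2, and binom(n, k) ≥ (n + 1 - k)^k / k!. So the
main term of T^n is of the full order of growth. -/
lemma growth_le_choose_mul (s : ℕ) {ρ : ℝ} (hρ : 0 < ρ) :
    ∃ c > 0, ∀ n ≥ 2 * s + 1, c * growth s ρ n ≤ (n.choose (s - 1) : ℝ) * ρ ^ (n - (s - 1)) := by
  refine ⟨(2 ^ (s - 1) * (s - 1).factorial : ℝ)⁻¹ * (ρ ^ (s - 1))⁻¹, by positivity, fun n hn => ?_⟩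
  have h1 : ((n + 1 - (s - 1) : ℕ) : ℝ) ^ (s - 1) / ((s - 1).factorial : ℝ) ≤ n.choose (s - 1) :=
    Nat.pow_le_choose (α := ℝ) (s - 1) n
  have h2 : ((max n 1 : ℕ) : ℝ) / 2 ≤ ((n + 1 - (s - 1) : ℕ) : ℝ) := by
    rw [div_le_iff₀ two_pos]
    exact_mod_cast (by omega : max n 1 ≤ (n + 1 - (s - 1)) * 2)
  have h3 : (((max n 1 : ℕ) : ℝ) / 2) ^ (s - 1) / ((s - 1).factorial : ℝ) ≤ n.choose (s - 1) := by
    refine le_trans ?_ h1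
    gcongr
  rw [growth, pow_sub₀ ρ hρ.ne' (show s - 1 ≤ n by omega)]
  calc (2 ^ (s - 1) * (s - 1).factorial : ℝ)⁻¹ * (ρ ^ (s - 1))⁻¹ * (((max n 1 : ℕ) : ℝ) ^ (s - 1) * ρ ^ n)
      = ((((max n 1 : ℕ) : ℝ) / 2) ^ (s - 1) / ((s - 1).factorial : ℝ)) * (ρ ^ n * (ρ ^ (s - 1))⁻¹) := by
        rw [div_pow]; field_simp
    _ ≤ _ := by gcongr

/-- Each vector in the maximally expanding subspace is almost the image, under the `n`-th power of
`T`, of a vector which is as small as the growth of the powers permits. -/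
theorem exists_small_preimage (T S : V →ₗ[ℝ] V) (hST : S ∘ₗ T = LinearMap.id) (hρ : 1 < rho T)
    {v : V} (hv : v ∈ maxExpandingSubspace T) {ε : ℝ} (hε : 0 < ε) :
    ∃ C, 0 < C ∧ ∀ n, ∃ w, ‖w‖ * growth (maxMultiplicity T) (rho T) n ≤ C ∧ ‖(T ^ n) w - v‖ ≤ ε := by
  have hρ0 : 0 < rho T := one_pos.trans hρ
  set s := maxMultiplicity T with hs
  set Q : V →ₗ[ℝ] V := Polynomial.aeval T (leadingPolynomial T) with hQ
  obtain ⟨C₀, hC₀⟩ := exists_norm_inverse_pow_le T S hST hρ hv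
  have hC₀0 : 0 ≤ C₀ := by simpa using (norm_nonneg _).trans (hC₀ 0)
  -- A linear section of Q onto its image gives preimages with a uniform bound on their norm.
  obtain ⟨R, hR⟩ := LinearMap.exists_rightInverse_of_surjective Q.rangeRestrict
    (LinearMap.range_eq_top.2 Q.surjective_rangeRestrict)
  set K := ‖LinearMap.toContinuousLinearMap R‖ with hK
  have hpre : ∀ y ∈ maxExpandingSubspace T, ∃ w, Q w = y ∧ ‖w‖ ≤ K * ‖y‖ := by
    intro y hy
    obtain ⟨x, hx⟩ := (mem_maxExpandingSubspace_iff T hρ y).1 hy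
    have hy' : y ∈ LinearMap.range Q := ⟨x, hx⟩
    refine ⟨R ⟨y, hy'⟩, ?_, (LinearMap.toContinuousLinearMap R).le_opNorm ⟨y, hy'⟩⟩
    have := LinearMap.congr_fun hR ⟨y, hy'⟩
    exact congrArg Subtype.val this
  obtain ⟨c, hc, hgrow⟩ := growth_le_choose_mul s hρ0
  set C₁ := K * C₀ / c with hC₁
  have hC₁0 : 0 ≤ C₁ := by positivity
  have hsmall := eventually_norm_apply_le
    (fun n : ℕ => T ^ n - (n.choose (s - 1) : ℝ) • ((T ^ (n - (s - 1))) * Q))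
    (pow_sub_isLittleO T hρ0) (ε := ε / (C₁ + 1)) (by positivity)
  obtain ⟨N, hN⟩ := eventually_atTop.1 (hsmall.and (eventually_ge_atTop (2 * s + 1)))
  have hlarge : ∀ n ≥ N, ∃ w, ‖w‖ * growth s (rho T) n ≤ C₁ ∧ ‖(T ^ n) w - v‖ ≤ ε := by
    intro n hn
    obtain ⟨h1, h2⟩ := hN n hn
    -- The main term binom(n, s-1) T^(n-s+1) Q of T^n takes the value v exactly at binom(n, s-1)⁻¹ w
    -- when Q w = S^(n-s+1) v. The vector S^(n-s+1) v stays in Im Q and has norm O(ρ^(-(n-s+1))),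
    -- which gives the required size.
    have hu : (S ^ (n - (s - 1))) v ∈ maxExpandingSubspace T :=
      map_mem_maxExpandingSubspace T _ ((commute_of_comp_eq_id hST).pow_left _) hv
    obtain ⟨w, hw, hwn⟩ := hpre _ hu
    have hg := growth_pos s hρ0 n
    have hch : 0 < (n.choose (s - 1) : ℝ) := by
      exact_mod_cast Nat.choose_pos (by omega)
    have hwb : ‖((n.choose (s - 1) : ℝ))⁻¹ • w‖ * growth s (rho T) n ≤ C₁ := by
      rw [norm_smul, norm_inv, Real.norm_of_nonneg hch.le]
      have h3 : ‖w‖ ≤ K * (C₀ * (rho T)⁻¹ ^ (n - (s - 1))) := hwn.trans (by gcongr; exact hC₀ _)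
      have h4 := hgrow n h2
      rw [hC₁, le_div_iff₀ hc]
      calc ((n.choose (s - 1) : ℝ))⁻¹ * ‖w‖ * growth s (rho T) n * c
          = ((n.choose (s - 1) : ℝ))⁻¹ * ‖w‖ * (c * growth s (rho T) n) := by ring
        _ ≤ ((n.choose (s - 1) : ℝ))⁻¹ * (K * (C₀ * (rho T)⁻¹ ^ (n - (s - 1)))) *
            ((n.choose (s - 1) : ℝ) * (rho T) ^ (n - (s - 1))) := by gcongr
        _ = K * C₀ := by
          rw [inv_pow]
          field_simp
    refine ⟨_, hwb, ?_⟩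
    have h3 := h1 (((n.choose (s - 1) : ℝ))⁻¹ • w)
    have h4 : (T ^ n - (n.choose (s - 1) : ℝ) • ((T ^ (n - (s - 1))) * Q))
        (((n.choose (s - 1) : ℝ))⁻¹ • w) = (T ^ n) (((n.choose (s - 1) : ℝ))⁻¹ • w) - v := by
      rw [LinearMap.sub_apply, LinearMap.smul_apply, Module.End.mul_apply, map_smul Q,
        map_smul (T ^ (n - (s - 1))), smul_smul, mul_inv_cancel₀ hch.ne', one_smul, hw,
        pow_mul_pow_eq_one_of_comp hST]
    rw [h4, Real.norm_of_nonneg hg.le] at h3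
    refine h3.trans ?_
    calc ε / (C₁ + 1) * growth s (rho T) n * ‖((n.choose (s - 1) : ℝ))⁻¹ • w‖
        = ε / (C₁ + 1) * (‖((n.choose (s - 1) : ℝ))⁻¹ • w‖ * growth s (rho T) n) := by ring
      _ ≤ ε / (C₁ + 1) * (C₁ + 1) := by gcongr; linarith
      _ = ε := by field_simp
  -- For the finitely many n < N the exact preimage S^n v is used, and its size is added to the
  -- constant.
  refine ⟨C₁ + 1 + ∑ n ∈ Finset.range N, ‖(S ^ n) v‖ * growth s (rho T) n, ?_, fun n => ?_⟩
  · have : 0 ≤ ∑ n ∈ Finset.range N, ‖(S ^ n) v‖ * growth s (rho T) n :=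
      Finset.sum_nonneg fun i _ => mul_nonneg (norm_nonneg _) (growth_pos s hρ0 i).le
    linarith
  · have hnn : ∀ i ∈ Finset.range N, 0 ≤ ‖(S ^ i) v‖ * growth s (rho T) i :=
      fun i _ => mul_nonneg (norm_nonneg _) (growth_pos s hρ0 i).le
    rcases le_or_gt N n with h | h
    · obtain ⟨w, hw, hw'⟩ := hlarge n h
      exact ⟨w, by linarith [Finset.sum_nonneg hnn], hw'⟩
    · refine ⟨(S ^ n) v, ?_, ?_⟩
      · have := Finset.single_le_sum hnn (Finset.mem_range.2 h)
        linarith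
      · rw [pow_mul_pow_eq_one_of_comp hST, sub_self, norm_zero]; exact hε.le

/-- The growth is slower than that of the powers of `(rho T) ^ 2`. -/
lemma growth_mul_inv_pow_tendsto (s : ℕ) {ρ : ℝ} (hρ : 1 < ρ) :
    Tendsto (fun n => growth s ρ n * (ρ⁻¹ ^ n) ^ 2) atTop (𝓝 0) := by
  have h1 : Tendsto (fun n : ℕ => (n : ℝ) ^ (s - 1) * ρ⁻¹ ^ n) atTop (𝓝 0) := by
    refine tendsto_pow_const_mul_const_pow_of_abs_lt_one (s - 1) ?_
    rw [abs_of_pos (by positivity)]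
    exact inv_lt_one_of_one_lt₀ hρ
  refine h1.congr' ?_
  filter_upwards [eventually_ge_atTop 1] with n hn
  rw [growth, max_eq_left hn, inv_pow]
  field_simp

end RealGrowth

end NondenseOrbits

end

open scoped Manifold ContDiff Topology Polynomial

noncomputable section

namespace NondenseOrbits

open Filter Metric Set

/-! ### Local coordinates at the identity of a Lie group -/

section Coordinates

variable {d : ℕ} {G : Type*} [TopologicalSpace G] [ChartedSpace (EuclideanSpace ℝ (Fin d)) G]
  [Group G]

variable (d) in
/-- The coordinates at the identity given by the preferred chart, centered at `0`. -/
def coord (h : G) : EuclideanSpace ℝ (Fin d) :=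
  chartAt (EuclideanSpace ℝ (Fin d)) (1 : G) h - chartAt (EuclideanSpace ℝ (Fin d)) (1 : G) 1

variable (d G) in
/-- The point with given coordinates. -/
def uncoord (v : EuclideanSpace ℝ (Fin d)) : G :=
  (chartAt (EuclideanSpace ℝ (Fin d)) (1 : G)).symm
    (v + chartAt (EuclideanSpace ℝ (Fin d)) (1 : G) 1)

variable (d G) in
/-- The domain of the coordinates at the identity. -/
def coordSource : Set G := (chartAt (EuclideanSpace ℝ (Fin d)) (1 : G)).source

variable (d G) in
/-- The range of the coordinates at the identity. -/
def coordTarget : Set (EuclideanSpace ℝ (Fin d)) :=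
  {v | v + chartAt (EuclideanSpace ℝ (Fin d)) (1 : G) 1 ∈
    (chartAt (EuclideanSpace ℝ (Fin d)) (1 : G)).target}

@[simp] lemma coord_one : coord d (1 : G) = 0 := by simp [coord]

@[simp] lemma uncoord_zero : uncoord d G 0 = 1 := by simp [uncoord]

lemma isOpen_coordSource : IsOpen (coordSource d G) := (chartAt _ (1 : G)).open_source

lemma isOpen_coordTarget : IsOpen (coordTarget d G) :=
  (chartAt (EuclideanSpace ℝ (Fin d)) (1 : G)).open_target.preimage (by fun_prop)

lemma one_mem_coordSource : (1 : G) ∈ coordSource d G := mem_chart_source _ _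

lemma zero_mem_coordTarget : (0 : EuclideanSpace ℝ (Fin d)) ∈ coordTarget d G := by
  simp [coordTarget]

lemma uncoord_coord {h : G} (hh : h ∈ coordSource d G) : uncoord d G (coord d h) = h := by
  rw [uncoord, coord, sub_add_cancel]
  exact (chartAt _ (1 : G)).left_inv hh

lemma coord_uncoord {v : EuclideanSpace ℝ (Fin d)} (hv : v ∈ coordTarget d G) :
    coord d (uncoord d G v) = v := by
  rw [uncoord, coord, (chartAt _ (1 : G)).right_inv hv, add_sub_cancel_right]

lemma uncoord_mem {v : EuclideanSpace ℝ (Fin d)} (hv : v ∈ coordTarget d G) :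
    uncoord d G v ∈ coordSource d G := (chartAt _ (1 : G)).map_target hv

lemma continuousAt_coord {h : G} (hh : h ∈ coordSource d G) : ContinuousAt (coord d) h :=
  ((chartAt _ (1 : G)).continuousAt hh).sub continuousAt_const

lemma continuousAt_uncoord {v : EuclideanSpace ℝ (Fin d)} (hv : v ∈ coordTarget d G) :
    ContinuousAt (uncoord d G) v := by
  have h1 := (chartAt (EuclideanSpace ℝ (Fin d)) (1 : G)).continuousAt_symm hv
  have h2 : ContinuousAt (fun v : EuclideanSpace ℝ (Fin d) =>
    v + chartAt (EuclideanSpace ℝ (Fin d)) (1 : G) 1) v := by fun_prop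
  exact ContinuousAt.comp (f := fun v : EuclideanSpace ℝ (Fin d) =>
    v + chartAt (EuclideanSpace ℝ (Fin d)) (1 : G) 1) h1 h2

variable [LieGroup (𝓡 d) ∞ G]

lemma contMDiffAt_coord {h : G} (hh : h ∈ coordSource d G) :
    ContMDiffAt (𝓡 d) (𝓡 d) ∞ (coord d) h := by
  have : IsManifold (𝓡 d) ∞ G := LieGroup.toContMDiffMul.toIsManifold
  have h1 : ContMDiffAt (𝓡 d) (𝓡 d) ∞ (chartAt (EuclideanSpace ℝ (Fin d)) (1 : G)) h :=
    (contMDiffOn_chart (I := 𝓡 d)).contMDiffAt ((chartAt _ (1 : G)).open_source.mem_nhds hh)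
  have h2 : ContDiff ℝ ∞ fun v : EuclideanSpace ℝ (Fin d) =>
    v - chartAt (EuclideanSpace ℝ (Fin d)) (1 : G) 1 := contDiff_id.sub contDiff_const
  exact ContMDiffAt.comp (g := fun v : EuclideanSpace ℝ (Fin d) =>
    v - chartAt (EuclideanSpace ℝ (Fin d)) (1 : G) 1) h h2.contMDiff.contMDiffAt h1

lemma contMDiffAt_uncoord {v : EuclideanSpace ℝ (Fin d)} (hv : v ∈ coordTarget d G) :
    ContMDiffAt (𝓡 d) (𝓡 d) ∞ (uncoord d G) v := by
  have : IsManifold (𝓡 d) ∞ G := LieGroup.toContMDiffMul.toIsManifold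
  have h1 : ContMDiffAt (𝓡 d) (𝓡 d) ∞ (chartAt (EuclideanSpace ℝ (Fin d)) (1 : G)).symm
      (v + chartAt (EuclideanSpace ℝ (Fin d)) (1 : G) 1) :=
    (contMDiffOn_chart_symm (I := 𝓡 d)).contMDiffAt ((chartAt _ (1 : G)).open_target.mem_nhds hv)
  have h2 : ContDiff ℝ ∞ fun v : EuclideanSpace ℝ (Fin d) =>
    v + chartAt (EuclideanSpace ℝ (Fin d)) (1 : G) 1 := contDiff_id.add contDiff_const
  exact ContMDiffAt.comp (f := fun v : EuclideanSpace ℝ (Fin d) =>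
    v + chartAt (EuclideanSpace ℝ (Fin d)) (1 : G) 1) v h1 h2.contMDiff.contMDiffAt

lemma contDiffAt_coord_mul : ContDiffAt ℝ ∞
    (fun p : EuclideanSpace ℝ (Fin d) × EuclideanSpace ℝ (Fin d) =>
      coord d (uncoord d G p.1 * uncoord d G p.2)) (0, 0) := by
  rw [← contMDiffAt_iff_contDiffAt]
  have h0 := contMDiffAt_uncoord (G := G) (zero_mem_coordTarget (d := d) (G := G))
  have h1 : ContMDiffAt 𝓘(ℝ, EuclideanSpace ℝ (Fin d) × EuclideanSpace ℝ (Fin d)) (𝓡 d) ∞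
      (fun p : EuclideanSpace ℝ (Fin d) × EuclideanSpace ℝ (Fin d) =>
        uncoord d G p.1 * uncoord d G p.2) (0, 0) :=
    (ContMDiffAt.comp (0, 0) (g := uncoord d G) (f := Prod.fst) h0 contDiffAt_fst.contMDiffAt).mul
      (ContMDiffAt.comp (0, 0) (g := uncoord d G) (f := Prod.snd) h0 contDiffAt_snd.contMDiffAt)
  refine ContMDiffAt.comp (0, 0) (g := coord d) ?_ h1
  exact contMDiffAt_coord (by simpa using one_mem_coordSource)

lemma contDiffAt_coord_inv_mul : ContDiffAt ℝ ∞
    (fun p : EuclideanSpace ℝ (Fin d) × EuclideanSpace ℝ (Fin d) =>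
      coord d ((uncoord d G p.1)⁻¹ * uncoord d G p.2)) (0, 0) := by
  rw [← contMDiffAt_iff_contDiffAt]
  have h0 := contMDiffAt_uncoord (G := G) (zero_mem_coordTarget (d := d) (G := G))
  have h1 : ContMDiffAt 𝓘(ℝ, EuclideanSpace ℝ (Fin d) × EuclideanSpace ℝ (Fin d)) (𝓡 d) ∞
      (fun p : EuclideanSpace ℝ (Fin d) × EuclideanSpace ℝ (Fin d) =>
        (uncoord d G p.1)⁻¹ * uncoord d G p.2) (0, 0) :=
    (ContMDiffAt.comp (0, 0) (g := uncoord d G) (f := Prod.fst) h0 contDiffAt_fst.contMDiffAt).inv.mul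
      (ContMDiffAt.comp (0, 0) (g := uncoord d G) (f := Prod.snd) h0 contDiffAt_snd.contMDiffAt)
  refine ContMDiffAt.comp (0, 0) (g := coord d) ?_ h1
  exact contMDiffAt_coord (by simpa using one_mem_coordSource)

/-- Quadratic estimates for a smooth map near the origin. -/
lemma exists_quadratic_estimate {E F : Type*} [NormedAddCommGroup E] [NormedSpace ℝ E]
    [NormedAddCommGroup F] [NormedSpace ℝ F] {f : E → F} (hf : ContDiffAt ℝ ∞ f 0) :
    ∃ R > 0, ∃ C > 0, ∀ p, ‖p‖ ≤ R → DifferentiableAt ℝ f p ∧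
      ‖fderiv ℝ f p - fderiv ℝ f 0‖ ≤ C * ‖p‖ ∧ ‖f p - f 0 - fderiv ℝ f 0 p‖ ≤ C * ‖p‖ ^ 2 := by
  have h1 : ∀ᶠ p in 𝓝 (0 : E), DifferentiableAt ℝ f p := by
    have h2 : ContDiffAt ℝ 1 f 0 := hf.of_le (by exact_mod_cast le_top)
    exact (h2.eventually (by simp)).mono fun p hp => hp.differentiableAt (by simp)
  have h2 : DifferentiableAt ℝ (fderiv ℝ f) 0 :=
    (hf.fderiv_right (m := 1) (by rw [one_add_one_eq_two]; exact WithTop.coe_le_coe.2 le_top)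
      ).differentiableAt (by simp)
  obtain ⟨C, hC, h3⟩ := h2.isBigO_sub.exists_pos
  rw [Asymptotics.isBigOWith_iff] at h3
  obtain ⟨R, hR, h4⟩ := Metric.eventually_nhds_iff_ball.1 (h1.and h3)
  have hball : ∀ p : E, ‖p‖ ≤ R / 2 → DifferentiableAt ℝ f p ∧
      ‖fderiv ℝ f p - fderiv ℝ f 0‖ ≤ C * ‖p‖ := fun p hp => by
    have := h4 p (by rw [mem_ball, dist_zero_right]; linarith)
    simpa using this
  refine ⟨R / 2, half_pos hR, C, hC, fun p hp => ⟨(hball p hp).1, (hball p hp).2, ?_⟩⟩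
  have h5 := (convex_closedBall (0 : E) ‖p‖).norm_image_sub_le_of_norm_fderiv_le'
    (𝕜 := ℝ) (f := f) (φ := fderiv ℝ f 0) (C := C * ‖p‖) (x := 0) (y := p)
    (fun x hx => (hball x ((mem_closedBall_zero_iff.1 hx).trans hp)).1)
    (fun x hx => (hball x ((mem_closedBall_zero_iff.1 hx).trans hp)).2.trans (by
      gcongr; exact mem_closedBall_zero_iff.1 hx)) (by simp) (by simp)
  rw [sub_zero] at h5
  exact h5.trans (le_of_eq (by ring))

variable (d G) in
/-- The estimates for multiplication and division in coordinates that are used below. -/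
structure CoordEstimates (R C : ℝ) : Prop where
  R_pos : 0 < R
  C_pos : 0 < C
  mem : ∀ v : EuclideanSpace ℝ (Fin d), ‖v‖ ≤ R → v ∈ coordTarget d G
  mul : ∀ a : EuclideanSpace ℝ (Fin d), ‖a‖ ≤ R →
    ∃ A : EuclideanSpace ℝ (Fin d) →L[ℝ] EuclideanSpace ℝ (Fin d),
      HasFDerivAt (fun b => coord d (uncoord d G a * uncoord d G b)) A 0 ∧
        ‖A - ContinuousLinearMap.id ℝ _‖ ≤ C * ‖a‖
  inv_mul : ∀ a : EuclideanSpace ℝ (Fin d), ‖a‖ ≤ R →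
    ∃ A : EuclideanSpace ℝ (Fin d) →L[ℝ] EuclideanSpace ℝ (Fin d),
      HasFDerivAt (fun b => coord d ((uncoord d G a)⁻¹ * uncoord d G b)) A a ∧
        ‖A - ContinuousLinearMap.id ℝ _‖ ≤ C * ‖a‖
  inv_mul_mem : ∀ a b : EuclideanSpace ℝ (Fin d), ‖a‖ ≤ R → ‖b‖ ≤ R →
    (uncoord d G a)⁻¹ * uncoord d G b ∈ coordSource d G ∧
      ‖coord d ((uncoord d G a)⁻¹ * uncoord d G b) - (b - a)‖ ≤ C * (‖a‖ + ‖b‖) ^ 2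

-- In coordinates, (a, b) ↦ ab and (a, b) ↦ a⁻¹b are smooth at the origin, and at a = 0 both are the
-- identity in b. The second map vanishes on the diagonal, so its derivative at the origin is (a, b)
-- ↦ b - a. The second-order bounds come from `exists_quadratic_estimate`.
variable (d G) in
theorem exists_coordEstimates : ∃ R C : ℝ, CoordEstimates d G R C := by
  have := topologicalGroup_of_lieGroup (𝓡 d) ∞ (G := G)
  obtain ⟨R₁, hR₁, C₁, hC₁, h₁⟩ := exists_quadratic_estimate (contDiffAt_coord_mul (d := d) (G := G))
  obtain ⟨R₂, hR₂, C₂, hC₂, h₂⟩ := exists_quadratic_estimate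
    (contDiffAt_coord_inv_mul (d := d) (G := G))
  obtain ⟨R₃, hR₃, h₃⟩ := Metric.isOpen_iff.1 (isOpen_coordTarget (d := d) (G := G)) 0
    zero_mem_coordTarget
  have h4 : ∀ᶠ p in 𝓝 ((0, 0) : EuclideanSpace ℝ (Fin d) × EuclideanSpace ℝ (Fin d)),
      (uncoord d G p.1)⁻¹ * uncoord d G p.2 ∈ coordSource d G := by
    have h5 : ContinuousAt (fun p : EuclideanSpace ℝ (Fin d) × EuclideanSpace ℝ (Fin d) =>
        (uncoord d G p.1)⁻¹ * uncoord d G p.2) (0, 0) := by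
      have h0 := continuousAt_uncoord (zero_mem_coordTarget (d := d) (G := G))
      exact (ContinuousAt.comp (g := uncoord d G) (f := Prod.fst) (x := ((0, 0) :
          EuclideanSpace ℝ (Fin d) × EuclideanSpace ℝ (Fin d))) h0 continuousAt_fst).inv.mul
        (ContinuousAt.comp (g := uncoord d G) (f := Prod.snd) (x := ((0, 0) :
          EuclideanSpace ℝ (Fin d) × EuclideanSpace ℝ (Fin d))) h0 continuousAt_snd)
    refine h5.preimage_mem_nhds (isOpen_coordSource.mem_nhds ?_)
    simpa using one_mem_coordSource
  obtain ⟨R₄, hR₄, h₄⟩ := Metric.eventually_nhds_iff_ball.1 h4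
  set R := min (min R₁ R₂) (min (R₃ / 2) (R₄ / 2)) with hR
  have hRpos : 0 < R := by positivity
  have hRR₁ : R ≤ R₁ := (min_le_left _ _).trans (min_le_left _ _)
  have hRR₂ : R ≤ R₂ := (min_le_left _ _).trans (min_le_right _ _)
  have hRR₃ : R < R₃ := ((min_le_right _ _).trans (min_le_left _ _)).trans_lt
    (half_lt_self hR₃)
  have hRR₄ : R < R₄ := ((min_le_right _ _).trans (min_le_right _ _)).trans_lt
    (half_lt_self hR₄)
  have hmem : ∀ v : EuclideanSpace ℝ (Fin d), ‖v‖ ≤ R → v ∈ coordTarget d G := fun v hv =>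
    h₃ (by rw [mem_ball, dist_zero_right]; linarith)
  -- the partial derivatives of a map with respect to the second variable
  have hpart : ∀ {f : EuclideanSpace ℝ (Fin d) × EuclideanSpace ℝ (Fin d) → EuclideanSpace ℝ (Fin d)}
      {p}, DifferentiableAt ℝ f p → HasFDerivAt (fun b => f (p.1, b))
        ((fderiv ℝ f p).comp (ContinuousLinearMap.inr ℝ _ _)) p.2 := by
    intro f p hf
    have h5 := hf.hasFDerivAt
    exact HasFDerivAt.comp (f := fun b => (p.1, b)) p.2 h5 (hasFDerivAt_prodMk_right p.1 p.2)
  have hid : ∀ {f : EuclideanSpace ℝ (Fin d) × EuclideanSpace ℝ (Fin d) → EuclideanSpace ℝ (Fin d)},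
      DifferentiableAt ℝ f (0, 0) → (∀ b ∈ coordTarget d G, f (0, b) = b) →
        (fderiv ℝ f 0).comp (ContinuousLinearMap.inr ℝ _ _) = ContinuousLinearMap.id ℝ _ := by
    intro f hf hfb
    refine (hpart hf).unique ?_
    refine (hasFDerivAt_id (𝕜 := ℝ) (0 : EuclideanSpace ℝ (Fin d))).congr_of_eventuallyEq ?_
    filter_upwards [(isOpen_coordTarget (d := d) (G := G)).mem_nhds zero_mem_coordTarget]
      with b hb using hfb b hb
  have hd₁ := hid (h₁ 0 (by simpa using hR₁.le)).1 fun b hb => by simp [coord_uncoord hb]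
  have hd₂ := hid (h₂ 0 (by simpa using hR₂.le)).1 fun b hb => by simp [coord_uncoord hb]
  have hinr : ∀ L : EuclideanSpace ℝ (Fin d) × EuclideanSpace ℝ (Fin d) →L[ℝ]
      EuclideanSpace ℝ (Fin d), ‖L.comp (ContinuousLinearMap.inr ℝ _ _)‖ ≤ ‖L‖ := fun L => by
    refine (L.opNorm_comp_le _).trans (mul_le_of_le_one_right (norm_nonneg _) ?_)
    exact ContinuousLinearMap.norm_inr_le_one _ _ _
  refine ⟨R, max C₁ C₂, hRpos, lt_max_of_lt_left hC₁, hmem, fun a ha => ?_, fun a ha => ?_, fun a b ha hb => ?_⟩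
  · have hn : ‖(a, (0 : EuclideanSpace ℝ (Fin d)))‖ = ‖a‖ := by simp [Prod.norm_def]
    obtain ⟨h5, h6, -⟩ := h₁ (a, 0) (by rw [hn]; linarith)
    refine ⟨_, hpart h5, ?_⟩
    rw [← hd₁, ← ContinuousLinearMap.sub_comp]
    refine (hinr _).trans (h6.trans ?_)
    rw [hn]
    gcongr
    exact le_max_left _ _
  · have hn : ‖(a, a)‖ = ‖a‖ := by simp [Prod.norm_def]
    obtain ⟨h5, h6, -⟩ := h₂ (a, a) (by rw [hn]; linarith)
    refine ⟨_, hpart h5, ?_⟩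
    rw [← hd₂, ← ContinuousLinearMap.sub_comp]
    refine (hinr _).trans (h6.trans ?_)
    rw [hn]
    gcongr
    exact le_max_right _ _
  · have hn : ‖(a, b)‖ ≤ R := by rw [Prod.norm_def]; exact max_le ha hb
    refine ⟨h₄ (a, b) (by rw [mem_ball, ← Prod.zero_eq_mk, dist_zero_right]; linarith), ?_⟩
    obtain ⟨-, -, h7⟩ := h₂ (a, b) (by linarith)
    have hdiag : fderiv ℝ (fun p : EuclideanSpace ℝ (Fin d) × EuclideanSpace ℝ (Fin d) =>
        coord d ((uncoord d G p.1)⁻¹ * uncoord d G p.2)) 0 (a, a) = 0 := by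
      have h8 := (h₂ 0 (by simpa using hR₂.le)).1.hasFDerivAt
      have h9 : HasFDerivAt (fun x : EuclideanSpace ℝ (Fin d) => (x, x))
          ((ContinuousLinearMap.id ℝ _).prod (ContinuousLinearMap.id ℝ _)) 0 :=
        (hasFDerivAt_id (𝕜 := ℝ) (0 : EuclideanSpace ℝ (Fin d))).prodMk (hasFDerivAt_id _)
      have h10 := HasFDerivAt.comp (f := fun x : EuclideanSpace ℝ (Fin d) => (x, x)) 0 h8 h9
      have h11 : HasFDerivAt ((fun p : EuclideanSpace ℝ (Fin d) × EuclideanSpace ℝ (Fin d) =>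
        coord d ((uncoord d G p.1)⁻¹ * uncoord d G p.2)) ∘ fun x => (x, x))
          (0 : EuclideanSpace ℝ (Fin d) →L[ℝ] EuclideanSpace ℝ (Fin d)) 0 := by
        have : ((fun p : EuclideanSpace ℝ (Fin d) × EuclideanSpace ℝ (Fin d) =>
          coord d ((uncoord d G p.1)⁻¹ * uncoord d G p.2)) ∘ fun x => (x, x)) = fun _ => 0 := by
          funext x; simp
        rw [this]
        exact hasFDerivAt_const _ _
      exact DFunLike.congr_fun (h10.unique h11) a
    have hder : fderiv ℝ (fun p : EuclideanSpace ℝ (Fin d) × EuclideanSpace ℝ (Fin d) =>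
        coord d ((uncoord d G p.1)⁻¹ * uncoord d G p.2)) 0 (a, b) = b - a := by
      have h8 : (a, b) = (a, a) + (ContinuousLinearMap.inr ℝ (EuclideanSpace ℝ (Fin d))
        (EuclideanSpace ℝ (Fin d))) (b - a) := by simp
      rw [h8, map_add, hdiag, zero_add, ← ContinuousLinearMap.comp_apply, hd₂]
      rfl
    rw [hder] at h7
    simp only [Prod.fst_zero, Prod.snd_zero, uncoord_zero, inv_one, mul_one, coord_one, sub_zero] at h7
    refine h7.trans ?_
    have h12 : ‖(a, b)‖ ≤ ‖a‖ + ‖b‖ := by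
      rw [Prod.norm_def]
      exact max_le (le_add_of_nonneg_right (norm_nonneg _)) (le_add_of_nonneg_left (norm_nonneg _))
    gcongr
    exact le_max_right _ _

end Coordinates

/-! ### Curves and homomorphisms in coordinates -/

section Curves

variable {d : ℕ} {G : Type*} [TopologicalSpace G] [ChartedSpace (EuclideanSpace ℝ (Fin d)) G]
  [Group G]

variable (d) in
/-- The curve `γ` has left logarithmic derivative `w t` at all times `t` in `[0, 1]`. -/
def HasLogDeriv (γ : ℝ → G) (w : ℝ → EuclideanSpace ℝ (Fin d)) : Prop :=
  ∀ t ∈ Icc (0 : ℝ) 1, ContinuousAt γ t ∧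
    HasDerivAt (fun s => coord d ((γ t)⁻¹ * γ (t + s))) (w t) 0

variable (d) in
/-- The differential of an endomorphism at the identity, as a map of the model space. -/
def derivOne (τ : G →* G) : EuclideanSpace ℝ (Fin d) →ₗ[ℝ] EuclideanSpace ℝ (Fin d) :=
  differentialAtOne d τ

variable (d) in
/-- The velocity of a curve at time `0`, as a vector of the model space. -/
def initialVelocity (φ : ℝ → G) : EuclideanSpace ℝ (Fin d) := velocity d φ

lemma IsOneParameterSubgroup.map_zero {φ : ℝ → G} (hφ : IsOneParameterSubgroup d φ) : φ 0 = 1 := by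
  have := hφ.map_add 0 0
  simpa using this

lemma IsOneParameterSubgroup.hasDerivAt {φ : ℝ → G} (hφ : IsOneParameterSubgroup d φ) :
    HasDerivAt (fun s => coord d (φ s)) (initialVelocity d φ) 0 := by
  have hm : MDifferentiableAt 𝓘(ℝ, ℝ) (𝓡 d) φ 0 :=
    hφ.contMDiff.contMDiffAt.mdifferentiableAt (by simp)
  have h1 := hm.hasMFDerivAt.2
  simp only [writtenInExtChartAt, extChartAt, mfld_simps] at h1
  rw [hφ.map_zero] at h1
  obtain ⟨L, hL⟩ : ∃ L : ℝ →L[ℝ] EuclideanSpace ℝ (Fin d), L = mfderiv 𝓘(ℝ, ℝ) (𝓡 d) φ 0 :=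
    ⟨_, rfl⟩
  have h2 : HasFDerivAt (chartAt (EuclideanSpace ℝ (Fin d)) (1 : G) ∘ φ) L 0 := by
    rw [hL]; exact hasFDerivWithinAt_univ.1 h1
  have h3 : initialVelocity d φ = L 1 := by rw [hL]; rfl
  rw [h3]
  exact h2.hasDerivAt.sub_const _

lemma IsOneParameterSubgroup.hasLogDeriv {φ : ℝ → G} (hφ : IsOneParameterSubgroup d φ) (c : ℝ) :
    HasLogDeriv d (fun t => φ (c * t))
      fun _ => c • (initialVelocity d φ) := by
  intro t _
  refine ⟨(hφ.contMDiff.continuous.comp (by fun_prop)).continuousAt, ?_⟩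
  have h1 : ∀ s, (φ (c * t))⁻¹ * φ (c * (t + s)) = φ (c * s) := fun s => by
    rw [mul_add, hφ.map_add, inv_mul_cancel_left]
  simp only [h1]
  have h2 : HasDerivAt (fun s : ℝ => c * s) c 0 := by simpa using (hasDerivAt_id (0 : ℝ)).const_mul c
  exact HasDerivAt.scomp (g₁ := fun s => coord d (φ s)) (h := fun s : ℝ => c * s) 0
    (by rw [mul_zero]; exact hφ.hasDerivAt) h2

/-- A smooth homomorphism has the expected derivative in coordinates. -/
lemma hasFDerivAt_hom (τ : G →* G) (hτ : ContMDiff (𝓡 d) (𝓡 d) ∞ τ) :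
    HasFDerivAt (fun v => coord d (τ (uncoord d G v)))
      (LinearMap.toContinuousLinearMap (derivOne d τ)) 0 := by
  have hm : MDifferentiableAt (𝓡 d) (𝓡 d) τ 1 := hτ.contMDiffAt.mdifferentiableAt (by simp)
  have h1 := hm.hasMFDerivAt.2
  simp only [writtenInExtChartAt, extChartAt, map_one, mfld_simps] at h1
  replace h1 : HasFDerivAt (E := EuclideanSpace ℝ (Fin d)) (F := EuclideanSpace ℝ (Fin d))
      (chartAt (EuclideanSpace ℝ (Fin d)) (1 : G) ∘ τ ∘
        (chartAt (EuclideanSpace ℝ (Fin d)) (1 : G)).symm) (mfderiv (𝓡 d) (𝓡 d) τ 1)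
      (chartAt (EuclideanSpace ℝ (Fin d)) (1 : G) 1) := hasFDerivWithinAt_univ.1 h1
  have h2 : HasFDerivAt (fun v : EuclideanSpace ℝ (Fin d) =>
      v + chartAt (EuclideanSpace ℝ (Fin d)) (1 : G) 1) (ContinuousLinearMap.id ℝ _) 0 :=
    (hasFDerivAt_id _).add_const _
  have h3 := HasFDerivAt.comp (f := fun v : EuclideanSpace ℝ (Fin d) =>
      v + chartAt (EuclideanSpace ℝ (Fin d)) (1 : G) 1) 0 (by rw [zero_add]; exact h1) h2
  exact h3.sub_const _

variable [LieGroup (𝓡 d) ∞ G]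

/-- Differentiate γ(t + s) = γ(t) · (γ(t)⁻¹ γ(t + s)): the derivative of left translation by a point
near 1 differs little from the identity. -/
lemma HasLogDeriv.exists_hasDerivAt {R C : ℝ} (hE : CoordEstimates d G R C) {γ : ℝ → G}
    {w : ℝ → EuclideanSpace ℝ (Fin d)} (hγ : HasLogDeriv d γ w) {t : ℝ} (ht : t ∈ Icc (0 : ℝ) 1)
    (hs : γ t ∈ coordSource d G) (hR : ‖coord d (γ t)‖ ≤ R) :
    ∃ v, HasDerivAt (fun u => coord d (γ u)) v t ∧
      ‖v - w t‖ ≤ C * ‖coord d (γ t)‖ * ‖w t‖ := by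
  have := topologicalGroup_of_lieGroup (𝓡 d) ∞ (G := G)
  obtain ⟨hc, hd⟩ := hγ t ht
  obtain ⟨A, hA, hA'⟩ := hE.mul _ hR
  rw [uncoord_coord hs] at hA
  have h0 : coord d ((γ t)⁻¹ * γ (t + 0)) = 0 := by simp
  have h1 : HasDerivAt (fun s => coord d (γ t * uncoord d G (coord d ((γ t)⁻¹ * γ (t + s)))))
      (A (w t)) 0 := by
    refine HasFDerivAt.comp_hasDerivAt (l := fun b => coord d (γ t * uncoord d G b)) 0 ?_ hd
    rw [h0]; exact hA
  have h2 : ∀ᶠ s in 𝓝 (0 : ℝ), (γ t)⁻¹ * γ (t + s) ∈ coordSource d G := by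
    have h3 : ContinuousAt (fun s => (γ t)⁻¹ * γ (t + s)) 0 := by
      refine continuousAt_const.mul (ContinuousAt.comp (g := γ) (f := fun s => t + s) ?_ (by fun_prop))
      simpa using hc
    refine h3.preimage_mem_nhds (isOpen_coordSource.mem_nhds ?_)
    simpa using one_mem_coordSource
  have h3 : HasDerivAt (fun s => coord d (γ (t + s))) (A (w t)) 0 := by
    refine h1.congr_of_eventuallyEq ?_
    filter_upwards [h2] with s hs
    rw [uncoord_coord hs, mul_inv_cancel_left]
  refine ⟨A (w t), ?_, ?_⟩
  · have h4 := HasDerivAt.comp_sub_const t t (f := fun s => coord d (γ (t + s))) (f' := A (w t))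
      (by simpa using h3)
    simpa using h4
  · have h4 : A (w t) - w t = (A - ContinuousLinearMap.id ℝ (EuclideanSpace ℝ (Fin d))) (w t) := by simp
    rw [h4]
    exact (ContinuousLinearMap.le_opNorm _ _).trans (by gcongr)

/-- A curve that stays near the identity is close to the integral of its logarithmic derivative. -/
lemma HasLogDeriv.norm_coord_sub_le {R C : ℝ} (hE : CoordEstimates d G R C) {γ : ℝ → G}
    {w : ℝ → EuclideanSpace ℝ (Fin d)} (hγ : HasLogDeriv d γ w) (h0 : γ 0 = 1) {η μ ε : ℝ}
    (hη : η ≤ R) (hs : ∀ t ∈ Icc (0 : ℝ) 1, γ t ∈ coordSource d G ∧ ‖coord d (γ t)‖ ≤ η)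
    (w₀ : EuclideanSpace ℝ (Fin d)) (hw : ∀ t ∈ Icc (0 : ℝ) 1, ‖w t‖ ≤ μ ∧ ‖w t - w₀‖ ≤ ε) :
    ‖coord d (γ 1) - w₀‖ ≤ C * η * μ + ε := by
  have hη0 : 0 ≤ η := (norm_nonneg _).trans (hs 0 (by simp)).2
  have h1 : ∀ t, ∃ v, t ∈ Icc (0 : ℝ) 1 → HasDerivAt (fun u => coord d (γ u)) v t ∧
      ‖v - w t‖ ≤ C * ‖coord d (γ t)‖ * ‖w t‖ := by
    intro t
    by_cases ht : t ∈ Icc (0 : ℝ) 1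
    · obtain ⟨v, hv⟩ := hγ.exists_hasDerivAt hE ht (hs t ht).1 ((hs t ht).2.trans hη)
      exact ⟨v, fun _ => hv⟩
    · exact ⟨0, fun h => absurd h ht⟩
  choose v hv using h1
  have h2 := norm_image_sub_le_of_norm_deriv_le_segment_01' (f := fun u => coord d (γ u) - u • w₀)
    (f' := fun t => v t - w₀) (C := C * η * μ + ε) (fun t ht => by
      have h3 := (hv t ht).1.sub ((hasDerivAt_id t).smul_const w₀)
      rw [one_smul] at h3
      exact h3.hasDerivWithinAt) (fun t ht => by
      have ht' := Ico_subset_Icc_self ht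
      have h4 : v t - w₀ = (v t - w t) + (w t - w₀) := by abel
      rw [h4]
      refine (norm_add_le _ _).trans (add_le_add ((hv t ht').2.trans ?_) (hw t ht').2)
      have := hE.C_pos
      gcongr
      · exact (hs t ht').2
      · exact (hw t ht').1)
  simpa [h0] using h2

/-- A curve with small logarithmic derivative stays near the identity. -/
lemma HasLogDeriv.mem_coordSource [T2Space G] {R C : ℝ} (hE : CoordEstimates d G R C) {γ : ℝ → G}
    {w : ℝ → EuclideanSpace ℝ (Fin d)} (hγ : HasLogDeriv d γ w) (h0 : γ 0 = 1) {μ : ℝ}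
    (hμ0 : 0 < μ) (hμ : 2 * μ < R) (hμ' : 4 * C * μ ≤ 1)
    (hw : ∀ t ∈ Icc (0 : ℝ) 1, ‖w t‖ ≤ μ) :
    ∀ t ∈ Icc (0 : ℝ) 1, γ t ∈ coordSource d G ∧ ‖coord d (γ t)‖ ≤ 2 * μ * t := by
  have hRpos := hE.R_pos
  -- The chart domain is only open. Its compact part K is closed because G is Hausdorff, which makes
  -- the set `S` of good times closed.
  set K : Set G := uncoord d G '' closedBall 0 R with hK
  have hKcpt : IsCompact K := by
    refine (isCompact_closedBall _ _).image_of_continuousOn fun v hv => ?_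
    exact (continuousAt_uncoord (hE.mem v (mem_closedBall_zero_iff.1 hv))).continuousWithinAt
  have hKs : K ⊆ coordSource d G := by
    rintro _ ⟨v, hv, rfl⟩
    exact uncoord_mem (hE.mem v (mem_closedBall_zero_iff.1 hv))
  have hKmem : ∀ h ∈ coordSource d G, ‖coord d h‖ ≤ R → h ∈ K := fun h hh hR =>
    ⟨coord d h, mem_closedBall_zero_iff.2 hR, uncoord_coord hh⟩
  have hcont : ContinuousOn γ (Icc 0 1) := fun t ht => (hγ t ht).1.continuousWithinAt
  set S : Set ℝ := {t | t ∈ Icc (0 : ℝ) 1 ∧ γ t ∈ K ∧ ‖coord d (γ t)‖ ≤ 2 * μ * t} with hS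
  have hsub : Icc (0 : ℝ) 1 ⊆ S := by
    refine IsClosed.Icc_subset_of_forall_exists_gt ?_ ?_ ?_
    · have h1 : IsClosed (Icc (0 : ℝ) 1 ∩ γ ⁻¹' K) :=
        hcont.preimage_isClosed_of_isClosed isClosed_Icc hKcpt.isClosed
      have h2 : ContinuousOn (fun t => ‖coord d (γ t)‖ - 2 * μ * t) (Icc (0 : ℝ) 1 ∩ γ ⁻¹' K) := by
        intro t ht
        refine ContinuousAt.continuousWithinAt ?_
        have h3 : ContinuousAt (fun t => coord d (γ t)) t :=
          ContinuousAt.comp (g := coord d) (f := γ) (continuousAt_coord (hKs ht.2)) (hγ t ht.1).1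
        exact h3.norm.sub (by fun_prop)
      have h3 := h2.preimage_isClosed_of_isClosed h1 (isClosed_Iic (a := (0 : ℝ)))
      convert h3 using 1
      ext t
      simp only [hS, mem_inter_iff, mem_ofPred_eq, mem_preimage, mem_Iic, sub_nonpos]
      tauto
    · refine ⟨by simp, ?_, by simp [h0]⟩
      rw [h0]; exact hKmem 1 one_mem_coordSource (by simpa using hRpos.le)
    · rintro t ⟨⟨ht, htK, htn⟩, ht'⟩ y hy
      have hbound : ‖coord d (γ t)‖ ≤ 2 * μ := htn.trans (by nlinarith [ht.2])
      obtain ⟨v, hv, hvw⟩ := hγ.exists_hasDerivAt hE ht (hKs htK) (hbound.trans hμ.le)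
      -- At a good time the speed is at most μ + C (2μ) μ ≤ 3μ/2, by 4Cμ ≤ 1. The strict inequality
      -- lets the bound 2μt persist a little longer.
      have hv2 : ‖v‖ < 2 * μ := by
        have h1 : ‖v‖ ≤ ‖v - w t‖ + ‖w t‖ := by
          simpa using norm_add_le (v - w t) (w t)
        have h2 : C * ‖coord d (γ t)‖ * ‖w t‖ ≤ C * (2 * μ) * μ := by
          have := hE.C_pos
          gcongr
          exact hw t ht
        have h3 := hw t ht
        nlinarith
      have h1 := hv.hasDerivWithinAt (s := Ici t) |>.limsup_norm_slope_le hv2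
      have h2 : ∀ᶠ z in 𝓝[>] t, γ z ∈ coordSource d G := by
        refine nhdsWithin_le_nhds ((hγ t ht).1.preimage_mem_nhds ?_)
        exact isOpen_coordSource.mem_nhds (hKs htK)
      have h1' : ∀ᶠ z in 𝓝[>] t, ‖z - t‖⁻¹ * ‖coord d (γ z) - coord d (γ t)‖ < 2 * μ :=
        nhdsWithin_mono _ Ioi_subset_Ici_self h1
      have h3 : ∀ᶠ z in 𝓝[>] t, z ∈ Ioc t (min y 1) :=
        Ioc_mem_nhdsGT (lt_min hy ht'.2)
      obtain ⟨z, hz1, hz2, hz3⟩ := (h1'.and (h2.and h3)).exists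
      have hzt : 0 < z - t := sub_pos.2 hz3.1
      have hz1' : ‖coord d (γ z) - coord d (γ t)‖ ≤ 2 * μ * (z - t) := by
        rw [Real.norm_of_nonneg hzt.le, inv_mul_lt_iff₀ hzt] at hz1
        linarith
      have hzn : ‖coord d (γ z)‖ ≤ 2 * μ * z := by
        have : ‖coord d (γ z)‖ ≤ ‖coord d (γ z) - coord d (γ t)‖ + ‖coord d (γ t)‖ := by
          simpa using norm_add_le (coord d (γ z) - coord d (γ t)) (coord d (γ t))
        linarith
      have hz01 : z ∈ Icc (0 : ℝ) 1 := ⟨ht.1.trans hz3.1.le, hz3.2.trans (min_le_right _ _)⟩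
      refine ⟨z, ⟨hz01, hKmem _ hz2 (hzn.trans ?_), hzn⟩, hz3.1, hz3.2.trans (min_le_left _ _)⟩
      nlinarith [hz01.2]
  intro t ht
  obtain ⟨-, h1, h2⟩ := hsub ht
  exact ⟨hKs h1, h2⟩

/-- The end point of a curve with small logarithmic derivative. -/
lemma HasLogDeriv.endpoint [T2Space G] {R C : ℝ} (hE : CoordEstimates d G R C) {γ : ℝ → G}
    {w : ℝ → EuclideanSpace ℝ (Fin d)} (hγ : HasLogDeriv d γ w) (h0 : γ 0 = 1) {μ ε : ℝ}
    (hμ0 : 0 < μ) (hμ : 2 * μ < R) (hμ' : 4 * C * μ ≤ 1) (w₀ : EuclideanSpace ℝ (Fin d))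
    (hw : ∀ t ∈ Icc (0 : ℝ) 1, ‖w t‖ ≤ μ ∧ ‖w t - w₀‖ ≤ ε) :
    γ 1 ∈ coordSource d G ∧ ‖coord d (γ 1) - w₀‖ ≤ 2 * C * μ ^ 2 + ε := by
  have h1 := hγ.mem_coordSource hE h0 hμ0 hμ hμ' fun t ht => (hw t ht).1
  refine ⟨(h1 1 (by simp)).1, ?_⟩
  have h2 := hγ.norm_coord_sub_le hE h0 (η := 2 * μ) hμ.le (fun t ht => ⟨(h1 t ht).1,
    (h1 t ht).2.trans (by nlinarith [ht.2])⟩) w₀ hw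
  exact h2.trans (le_of_eq (by ring))

/-- A homomorphism is close to its linearization, uniformly in the homomorphism. -/
theorem coord_hom_sub_le [T2Space G] {R C : ℝ} (hE : CoordEstimates d G R C) (τ : G →* G)
    (hτ : ContMDiff (𝓡 d) (𝓡 d) ∞ τ) {K : ℝ}
    (hK : ∀ v : EuclideanSpace ℝ (Fin d), ‖(derivOne d τ) v‖ ≤ K * ‖v‖)
    {δ : ℝ} (hδ0 : 0 < δ) (hδR : 4 * δ < R) (hδC : 8 * C * δ ≤ 1)
    {v : EuclideanSpace ℝ (Fin d)} (hv : ‖v‖ ≤ δ)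
    (hKv : K * ‖v‖ ≤ δ) :
    τ (uncoord d G v) ∈ coordSource d G ∧
      ‖coord d (τ (uncoord d G v)) - derivOne d τ v‖ ≤ 9 * C * δ ^ 2 := by
  have := topologicalGroup_of_lieGroup (𝓡 d) ∞ (G := G)
  have hCpos := hE.C_pos
  set L := derivOne d τ with hL
  have hvt : ∀ t ∈ Icc (0 : ℝ) 1, ‖t • v‖ ≤ δ := fun t ht => by
    rw [norm_smul, Real.norm_of_nonneg ht.1]
    exact (mul_le_of_le_one_left (norm_nonneg _) ht.2).trans hv
  have hRt : ∀ t ∈ Icc (0 : ℝ) 1, ‖t • v‖ ≤ R := fun t ht => (hvt t ht).trans (by linarith)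
  have h1 : ∀ t, ∃ A : EuclideanSpace ℝ (Fin d) →L[ℝ] EuclideanSpace ℝ (Fin d),
      t ∈ Icc (0 : ℝ) 1 →
      HasFDerivAt (fun b => coord d ((uncoord d G (t • v))⁻¹ * uncoord d G b)) A (t • v) ∧
        ‖A - ContinuousLinearMap.id ℝ _‖ ≤ C * ‖t • v‖ := by
    intro t
    by_cases ht : t ∈ Icc (0 : ℝ) 1
    · obtain ⟨A, hA⟩ := hE.inv_mul _ (hRt t ht)
      exact ⟨A, fun _ => hA⟩
    · exact ⟨0, fun h => absurd h ht⟩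
  choose A hA using h1
  have hcont : ∀ t ∈ Icc (0 : ℝ) 1, ContinuousAt (fun t : ℝ => uncoord d G (t • v)) t := fun t ht =>
    ContinuousAt.comp (g := uncoord d G) (f := fun t : ℝ => t • v)
      (continuousAt_uncoord (hE.mem _ (hRt t ht))) (by fun_prop)
  -- `τ` is applied to the segment from 0 to `v`. A homomorphism transforms logarithmic derivatives
  -- by its differential at 1 alone, so no second derivative of `τ` occurs and the constants depend
  -- on the group only. This makes the estimate usable for all powers of one automorphism.
  have hγ : HasLogDeriv d (fun t => τ (uncoord d G (t • v))) fun t => L (A t v) := by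
    intro t ht
    refine ⟨ContinuousAt.comp hτ.continuous.continuousAt (hcont t ht), ?_⟩
    have h2 : HasDerivAt (fun s : ℝ => (t + s) • v) v 0 := by
      have := ((hasDerivAt_id (0 : ℝ)).const_add t).smul_const v
      simpa using this
    have h3 : HasDerivAt (fun s : ℝ => coord d ((uncoord d G (t • v))⁻¹ * uncoord d G ((t + s) • v)))
        (A t v) 0 := by
      refine HasFDerivAt.comp_hasDerivAt
        (l := fun b => coord d ((uncoord d G (t • v))⁻¹ * uncoord d G b)) 0 ?_ h2
      rw [add_zero]; exact (hA t ht).1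
    have h4 : HasDerivAt (fun s : ℝ => coord d (τ (uncoord d G (coord d
        ((uncoord d G (t • v))⁻¹ * uncoord d G ((t + s) • v)))))) (L (A t v)) 0 := by
      refine HasFDerivAt.comp_hasDerivAt (l := fun v => coord d (τ (uncoord d G v)))
        (l' := LinearMap.toContinuousLinearMap L) 0 ?_ h3
      rw [add_zero, inv_mul_cancel, coord_one]
      exact hasFDerivAt_hom τ hτ
    refine h4.congr_of_eventuallyEq ?_
    have h5 : ∀ᶠ s in 𝓝 (0 : ℝ), (uncoord d G (t • v))⁻¹ * uncoord d G ((t + s) • v) ∈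
        coordSource d G := by
      have h6 : ContinuousAt (fun s : ℝ => (uncoord d G (t • v))⁻¹ * uncoord d G ((t + s) • v)) 0 := by
        refine continuousAt_const.mul (ContinuousAt.comp (g := fun t : ℝ => uncoord d G (t • v))
          (f := fun s => t + s) ?_ (by fun_prop))
        rw [add_zero]; exact hcont t ht
      refine h6.preimage_mem_nhds (isOpen_coordSource.mem_nhds ?_)
      simpa using one_mem_coordSource
    filter_upwards [h5] with s hs
    rw [uncoord_coord hs, map_mul, map_inv]
  have hAv : ∀ t ∈ Icc (0 : ℝ) 1, ‖A t v - v‖ ≤ C * δ * ‖v‖ := by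
    intro t ht
    have h2 : A t v - v = (A t - ContinuousLinearMap.id ℝ (EuclideanSpace ℝ (Fin d))) v := by simp
    rw [h2]
    refine (ContinuousLinearMap.le_opNorm _ _).trans ?_
    gcongr
    exact (hA t ht).2.trans (by gcongr; exact hvt t ht)
  have hK0 : v ≠ 0 → 0 ≤ K := fun hv0 => by
    have h2 := (norm_nonneg _).trans (hK v)
    exact nonneg_of_mul_nonneg_left h2 (norm_pos_iff.2 hv0)
  have hLe : ∀ t ∈ Icc (0 : ℝ) 1, ‖L (A t v) - L v‖ ≤ C * δ ^ 2 := by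
    intro t ht
    by_cases hv0 : v = 0
    · rw [hv0]; simp; positivity
    have hK1 := hK0 hv0
    rw [← map_sub]
    calc ‖L (A t v - v)‖ ≤ K * ‖A t v - v‖ := hK _
      _ ≤ K * (C * δ * ‖v‖) := by gcongr; exact hAv t ht
      _ = C * δ * (K * ‖v‖) := by ring
      _ ≤ C * δ * δ := by gcongr
      _ = _ := by ring
  -- With μ = 2δ and ε = Cδ², the bound 2Cμ² + ε is 9Cδ².
  have h2 := hγ.endpoint hE (by simp) (μ := 2 * δ) (ε := C * δ ^ 2) (by linarith) (by linarith)
    (by linarith) (L v) (fun t ht => ⟨?_, hLe t ht⟩)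
  · simp only [one_smul] at h2
    refine ⟨h2.1, h2.2.trans (le_of_eq (by ring))⟩
  · have h3 : ‖L (A t v)‖ ≤ ‖L (A t v) - L v‖ + ‖L v‖ := by
      simpa using norm_add_le (L (A t v) - L v) (L v)
    have h4 := (hK v).trans hKv
    have h5 := hLe t ht
    nlinarith

end Curves

/-! ### The Lie algebra of the maximally expanding subgroup -/

section Homs

variable {d : ℕ} {G : Type*} [TopologicalSpace G] [ChartedSpace (EuclideanSpace ℝ (Fin d)) G]
  [Group G]

lemma derivOne_comp (τ₁ τ₂ : G →* G) (h₁ : ContMDiff (𝓡 d) (𝓡 d) ∞ τ₁)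
    (h₂ : ContMDiff (𝓡 d) (𝓡 d) ∞ τ₂) :
    derivOne d (τ₁.comp τ₂) = derivOne d τ₁ ∘ₗ derivOne d τ₂ := by
  have h3 := hasFDerivAt_hom (τ₁.comp τ₂) (h₁.comp h₂)
  have h4 := HasFDerivAt.comp (g := fun v => coord d (τ₁ (uncoord d G v)))
    (f := fun v => coord d (τ₂ (uncoord d G v))) 0 (by simpa using hasFDerivAt_hom τ₁ h₁)
    (hasFDerivAt_hom τ₂ h₂)
  have h5 : (fun v => coord d ((τ₁.comp τ₂) (uncoord d G v))) =ᶠ[𝓝 0]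
      (fun v => coord d (τ₁ (uncoord d G v))) ∘ fun v => coord d (τ₂ (uncoord d G v)) := by
    have h6 : ContinuousAt (fun v => τ₂ (uncoord d G v)) 0 :=
      ContinuousAt.comp h₂.continuous.continuousAt (continuousAt_uncoord zero_mem_coordTarget)
    have h7 := h6.preimage_mem_nhds (isOpen_coordSource.mem_nhds (by
      simpa using one_mem_coordSource (d := d) (G := G)))
    filter_upwards [h7] with v hv
    simp only [Function.comp, MonoidHom.comp_apply]
    rw [uncoord_coord hv]
  have h8 := h3.unique (h4.congr_of_eventuallyEq h5)
  ext v : 1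
  exact DFunLike.congr_fun h8 v

lemma derivOne_id : derivOne d (MonoidHom.id G) = LinearMap.id := by
  ext v : 1
  change mfderiv (𝓡 d) (𝓡 d) (id : G → G) 1 v = v
  rw [mfderiv_id]
  rfl

lemma contMDiff_end_pow (τ : Monoid.End G) (h : ContMDiff (𝓡 d) (𝓡 d) ∞ τ) (n : ℕ) :
    ContMDiff (𝓡 d) (𝓡 d) ∞ (τ ^ n : Monoid.End G) := by
  induction n with
  | zero => exact contMDiff_id
  | succ n ih => rw [pow_succ]; exact ih.comp h

lemma derivOne_pow (τ : Monoid.End G) (h : ContMDiff (𝓡 d) (𝓡 d) ∞ τ) (n : ℕ) :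
    derivOne d (τ ^ n : Monoid.End G) = derivOne d τ ^ n := by
  induction n with
  | zero => exact derivOne_id
  | succ n ih =>
    rw [pow_succ, pow_succ, ← ih]
    exact derivOne_comp (τ ^ n : Monoid.End G) τ (contMDiff_end_pow τ h n) h

lemma IsOneParameterSubgroup.comp_hom {φ : ℝ → G} (hφ : IsOneParameterSubgroup d φ) (τ : G →* G)
    (h : ContMDiff (𝓡 d) (𝓡 d) ∞ τ) : IsOneParameterSubgroup d fun t => τ (φ t) :=
  ⟨h.comp hφ.contMDiff, fun s t => by rw [hφ.map_add, map_mul]⟩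

lemma IsOneParameterSubgroup.initialVelocity_comp_hom {φ : ℝ → G}
    (hφ : IsOneParameterSubgroup d φ) (τ : G →* G) (h : ContMDiff (𝓡 d) (𝓡 d) ∞ τ) :
    initialVelocity d (fun t => τ (φ t)) = derivOne d τ (initialVelocity d φ) := by
  have h1 := (hφ.comp_hom τ h).hasDerivAt
  have h2 : HasDerivAt (fun s => coord d (τ (uncoord d G (coord d (φ s)))))
      (derivOne d τ (initialVelocity d φ)) 0 := by
    refine HasFDerivAt.comp_hasDerivAt (l := fun v => coord d (τ (uncoord d G v)))
      (l' := LinearMap.toContinuousLinearMap (derivOne d τ)) 0 ?_ hφ.hasDerivAt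
    rw [hφ.map_zero, coord_one]
    exact hasFDerivAt_hom τ h
  refine h1.unique (h2.congr_of_eventuallyEq ?_)
  have h3 := hφ.contMDiff.continuous.continuousAt.preimage_mem_nhds (x := 0)
    (isOpen_coordSource.mem_nhds (by rw [hφ.map_zero]; exact one_mem_coordSource (d := d) (G := G)))
  filter_upwards [h3] with s hs
  rw [uncoord_coord hs]

variable [LieGroup (𝓡 d) ∞ G] [T2Space G]

/-- The logarithmic derivative vanishes, so the endpoint estimate holds for every small μ > 0; let μ
tend to 0. -/
lemma IsOneParameterSubgroup.eq_one_of_initialVelocity_eq_zero {φ : ℝ → G}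
    (hφ : IsOneParameterSubgroup d φ) (h : initialVelocity d φ = 0) : φ 1 = 1 := by
  obtain ⟨R, C, hE⟩ := exists_coordEstimates d G
  have hC := hE.C_pos
  have hR := hE.R_pos
  have key : ∀ᶠ μ in 𝓝[>] (0 : ℝ), φ 1 ∈ coordSource d G ∧ ‖coord d (φ 1)‖ ≤ 2 * C * μ ^ 2 := by
    have h1 : ∀ᶠ μ in 𝓝 (0 : ℝ), 2 * μ < R ∧ 4 * C * μ < 1 := by
      have h2 : Tendsto (fun μ : ℝ => 2 * μ) (𝓝 0) (𝓝 (2 * 0)) := by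
        exact tendsto_id.const_mul 2
      have h3 : Tendsto (fun μ : ℝ => 4 * C * μ) (𝓝 0) (𝓝 (4 * C * 0)) := tendsto_id.const_mul _
      rw [mul_zero] at h2 h3
      exact (h2.eventually (gt_mem_nhds hR)).and (h3.eventually (gt_mem_nhds one_pos))
    filter_upwards [nhdsWithin_le_nhds h1, self_mem_nhdsWithin] with μ hμ hμ0
    have h2 := (hφ.hasLogDeriv 1).endpoint hE (by simpa using hφ.map_zero) (ε := 0) hμ0 hμ.1 hμ.2.le 0
      (fun t _ => by rw [h]; simpa using le_of_lt hμ0)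
    simpa using h2
  obtain ⟨μ, hs, -⟩ := key.exists
  have h2 : ‖coord d (φ 1)‖ ≤ 0 := by
    have h3 : Tendsto (fun μ : ℝ => 2 * C * μ ^ 2) (𝓝[>] 0) (𝓝 (2 * C * 0 ^ 2)) :=
      (((continuous_id.pow 2).const_mul (2 * C)).tendsto 0).mono_left nhdsWithin_le_nhds
    rw [zero_pow two_ne_zero, mul_zero] at h3
    exact ge_of_tendsto h3 (key.mono fun μ h => h.2)
  have h3 : coord d (φ 1) = 0 := norm_le_zero_iff.1 h2
  rw [← uncoord_coord hs, h3, uncoord_zero]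

/-- The backward orbit of `h` tends to the identity along `𝔥`, with rate `θ`. -/
def ContractsAlong (τ' : Monoid.End G) (θ : ℝ) (𝔥 : Submodule ℝ (EuclideanSpace ℝ (Fin d)))
    (h : G) : Prop :=
  ∃ K : ℝ, ∀ᶠ n : ℕ in atTop, (τ' ^ n : Monoid.End G) h ∈ coordSource d G ∧
    ‖coord d ((τ' ^ n : Monoid.End G) h)‖ ≤ K * θ ^ n ∧
    ∃ u ∈ 𝔥, ‖coord d ((τ' ^ n : Monoid.End G) h) - u‖ ≤ K * (θ ^ n) ^ 2

lemma eventually_mul_pow_lt {θ : ℝ} (h0 : 0 < θ) (h1 : θ < 1) (K : ℝ) {r : ℝ} (hr : 0 < r) :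
    ∀ᶠ n : ℕ in atTop, K * θ ^ n < r := by
  have h2 := (tendsto_pow_atTop_nhds_zero_of_lt_one h0.le h1).const_mul K
  rw [mul_zero] at h2
  exact h2.eventually (gt_mem_nhds hr)

omit [LieGroup (𝓡 d) ∞ G] [T2Space G] in
/-- The difference of two points that are close to the identity, and close to `𝔥`. -/
lemma coord_inv_mul_estimate {R C : ℝ} (hE : CoordEstimates d G R C)
    {𝔥 : Submodule ℝ (EuclideanSpace ℝ (Fin d))} {a b : G} {K r : ℝ} (hKr : K * r ≤ R)
    (ha : a ∈ coordSource d G) (hb : b ∈ coordSource d G) (ha' : ‖coord d a‖ ≤ K * r)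
    (hb' : ‖coord d b‖ ≤ K * r) {u u' : EuclideanSpace ℝ (Fin d)} (hu : u ∈ 𝔥) (hu' : u' ∈ 𝔥)
    (hau : ‖coord d a - u‖ ≤ K * r ^ 2) (hbu : ‖coord d b - u'‖ ≤ K * r ^ 2) (hr : 0 ≤ r)
    (hr1 : r ≤ 1) :
    a⁻¹ * b ∈ coordSource d G ∧ ‖coord d (a⁻¹ * b)‖ ≤ (2 * K + 4 * C * K ^ 2) * r ∧
      ∃ u ∈ 𝔥, ‖coord d (a⁻¹ * b) - u‖ ≤ (2 * K + 4 * C * K ^ 2) * r ^ 2 := by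
  have hC := hE.C_pos
  have h1 := hE.inv_mul_mem _ _ (ha'.trans hKr) (hb'.trans hKr)
  rw [uncoord_coord ha, uncoord_coord hb] at h1
  have h2 : ‖coord d (a⁻¹ * b) - (coord d b - coord d a)‖ ≤ 4 * C * K ^ 2 * r ^ 2 := by
    refine h1.2.trans ?_
    calc C * (‖coord d a‖ + ‖coord d b‖) ^ 2 ≤ C * (K * r + K * r) ^ 2 := by gcongr
      _ = _ := by ring
  refine ⟨h1.1, ?_, u' - u, 𝔥.sub_mem hu' hu, ?_⟩
  · have h3 : coord d (a⁻¹ * b) = (coord d (a⁻¹ * b) - (coord d b - coord d a)) +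
        (coord d b - coord d a) := by abel
    have h4 : r ^ 2 ≤ r := by nlinarith
    have h5 : 4 * C * K ^ 2 * r ^ 2 ≤ 4 * C * K ^ 2 * r := by gcongr
    have h6 := norm_sub_le (coord d b) (coord d a)
    rw [h3]
    refine (norm_add_le _ _).trans ?_
    linarith
  · have h3 : coord d (a⁻¹ * b) - (u' - u) = (coord d (a⁻¹ * b) - (coord d b - coord d a)) +
        ((coord d b - u') - (coord d a - u)) := by abel
    have h6 := norm_sub_le (coord d b - u') (coord d a - u)
    rw [h3]
    refine (norm_add_le _ _).trans ?_
    linarith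

-- This makes the contracting elements a subgroup. The constant changes from K to 2K + 4CK², so it
-- is not uniform over the group generated; uniformity is recovered later by Baire's theorem.
omit [LieGroup (𝓡 d) ∞ G] [T2Space G] in
lemma ContractsAlong.inv_mul {R C : ℝ} (hE : CoordEstimates d G R C) {τ' : Monoid.End G} {θ : ℝ}
    (h0 : 0 < θ) (h1 : θ < 1) {𝔥 : Submodule ℝ (EuclideanSpace ℝ (Fin d))} {a b : G}
    (ha : ContractsAlong τ' θ 𝔥 a) (hb : ContractsAlong τ' θ 𝔥 b) :
    ContractsAlong τ' θ 𝔥 (a⁻¹ * b) := by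
  obtain ⟨K₁, ha⟩ := ha
  obtain ⟨K₂, hb⟩ := hb
  set K := max K₁ K₂
  refine ⟨2 * K + 4 * C * K ^ 2, ?_⟩
  filter_upwards [ha, hb, eventually_mul_pow_lt h0 h1 K hE.R_pos] with n ⟨ha1, ha2, u, hu, ha3⟩
    ⟨hb1, hb2, u', hu', hb3⟩ hn
  rw [map_mul, map_inv]
  have hθ : 0 ≤ θ ^ n := by positivity
  refine coord_inv_mul_estimate hE hn.le ha1 hb1 (ha2.trans ?_) (hb2.trans ?_) hu hu' (ha3.trans ?_)
    (hb3.trans ?_) hθ (pow_le_one₀ h0.le h1.le)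
  · gcongr; exact le_max_left _ _
  · gcongr; exact le_max_right _ _
  · gcongr; exact le_max_left _ _
  · gcongr; exact le_max_right _ _

omit [LieGroup (𝓡 d) ∞ G] [T2Space G] in
lemma contractsAlong_one (τ' : Monoid.End G) (θ : ℝ)
    (𝔥 : Submodule ℝ (EuclideanSpace ℝ (Fin d))) : ContractsAlong τ' θ 𝔥 (1 : G) :=
  ⟨0, Eventually.of_forall fun n => by
    rw [map_one]
    exact ⟨one_mem_coordSource, by simp, 0, 𝔥.zero_mem, by simp⟩⟩

/-- The n-th backward image of the one-parameter subgroup is again one, with velocity in 𝔥 of size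
O(θ^n). Its point at time 1 differs from that velocity by a quadratic error. -/
lemma contractsAlong_of_oneParameter {R C : ℝ} (hE : CoordEstimates d G R C) {τ' : Monoid.End G}
    (hτ' : ContMDiff (𝓡 d) (𝓡 d) ∞ τ') {θ : ℝ} (h0 : 0 < θ) (h1 : θ < 1)
    {𝔥 : Submodule ℝ (EuclideanSpace ℝ (Fin d))}
    (hinv : ∀ u ∈ 𝔥, derivOne d τ' u ∈ 𝔥)
    {φ : ℝ → G} (hφ : IsOneParameterSubgroup d φ) (hv : initialVelocity d φ ∈ 𝔥) {K : ℝ}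
    (hK : ∀ n, ‖(derivOne d τ' ^ n) (initialVelocity d φ)‖ ≤ K * θ ^ n) :
    ContractsAlong τ' θ 𝔥 (φ 1) := by
  have hC := hE.C_pos
  have hR := hE.R_pos
  have hK0 : 0 ≤ K := by simpa using (norm_nonneg _).trans (hK 0)
  refine ⟨2 * (K + 1) + 2 * C * (K + 1) ^ 2, ?_⟩
  filter_upwards [eventually_mul_pow_lt h0 h1 (K + 1) (half_pos hR),
    eventually_mul_pow_lt h0 h1 (4 * C * (K + 1)) one_pos] with n hn hn'
  have hτn := contMDiff_end_pow τ' hτ' n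
  have hφn := hφ.comp_hom (τ' ^ n : Monoid.End G) hτn
  have hvel := hφ.initialVelocity_comp_hom (τ' ^ n : Monoid.End G) hτn
  rw [derivOne_pow τ' hτ'] at hvel
  have hθ : 0 < θ ^ n := by positivity
  have h2 := (hφn.hasLogDeriv 1).endpoint hE (by simpa using hφn.map_zero) (μ := (K + 1) * θ ^ n)
    (ε := 0) (by positivity) (by linarith) (by linarith)
    ((derivOne d τ' ^ n) (initialVelocity d φ)) (fun t _ => by
      rw [hvel, one_smul, sub_self, norm_zero]
      exact ⟨(hK n).trans (by gcongr; linarith), le_rfl⟩)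
  simp only [mul_one, add_zero] at h2
  have hmem : ∀ m : ℕ, (derivOne d τ' ^ m) (initialVelocity d φ) ∈ 𝔥 := by
    intro m
    induction m with
    | zero => exact hv
    | succ m ih => rw [pow_succ', Module.End.mul_apply]; exact hinv _ ih
  refine ⟨h2.1, ?_, _, hmem n, h2.2.trans ?_⟩
  · have h3 := norm_add_le (coord d ((τ' ^ n : Monoid.End G) (φ 1)) -
      (derivOne d τ' ^ n) (initialVelocity d φ)) ((derivOne d τ' ^ n) (initialVelocity d φ))
    rw [sub_add_cancel] at h3
    have h4 := hK n
    have h5 : θ ^ n ≤ 1 := pow_le_one₀ h0.le h1.le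
    have h6 : 2 * C * ((K + 1) * θ ^ n) ^ 2 ≤ 2 * C * (K + 1) ^ 2 * θ ^ n := by
      calc 2 * C * ((K + 1) * θ ^ n) ^ 2 = 2 * C * (K + 1) ^ 2 * (θ ^ n * θ ^ n) := by ring
        _ ≤ 2 * C * (K + 1) ^ 2 * (θ ^ n * 1) := by gcongr
        _ = _ := by ring
    have h7 : (2 * (K + 1) + 2 * C * (K + 1) ^ 2) * θ ^ n =
        2 * (K + 1) * θ ^ n + 2 * C * (K + 1) ^ 2 * θ ^ n := by ring
    have h8 : K * θ ^ n ≤ 2 * (K + 1) * θ ^ n := by gcongr; linarith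
    exact h3.trans ((add_le_add (h2.2.trans h6) (h4.trans h8)).trans_eq (by ring))
  · have : 0 ≤ 2 * (K + 1) * (θ ^ n) ^ 2 := by positivity
    nlinarith

/-- If a one-parameter subgroup consists of points whose backward orbits tend to the identity along
`𝔥`, then its velocity belongs to `𝔥`. -/
theorem initialVelocity_mem_of_contractsAlong {R C : ℝ} (hE : CoordEstimates d G R C)
    {τ' : Monoid.End G} (hτ' : ContMDiff (𝓡 d) (𝓡 d) ∞ τ') {θ : ℝ} (h0 : 0 < θ) (h1 : θ < 1)
    {𝔥 : Submodule ℝ (EuclideanSpace ℝ (Fin d))}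
    {T : EuclideanSpace ℝ (Fin d) →ₗ[ℝ] EuclideanSpace ℝ (Fin d)}
    (hT : T ∘ₗ derivOne d τ' = LinearMap.id) (hinv : ∀ u ∈ 𝔥, T u ∈ 𝔥)
    {τ : ℕ → ℝ} (hτ0 : ∀ n, 0 ≤ τ n) (hTn : ∀ n w, ‖(T ^ n) w‖ ≤ τ n * ‖w‖)
    (hlim : Tendsto (fun n => τ n * (θ ^ n) ^ 2) atTop (𝓝 0))
    {φ : ℝ → G} (hφ : IsOneParameterSubgroup d φ) (hcon : ∀ t, ContractsAlong τ' θ 𝔥 (φ t)) :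
    initialVelocity d φ ∈ 𝔥 := by
  have hC := hE.C_pos
  have hR := hE.R_pos
  have hcl : IsClosed (𝔥 : Set (EuclideanSpace ℝ (Fin d))) := 𝔥.closed_of_finiteDimensional
  have hne : (𝔥 : Set (EuclideanSpace ℝ (Fin d))).Nonempty := ⟨0, 𝔥.zero_mem⟩
  let D : ℕ → ℕ → Set (EuclideanSpace ℝ (Fin d)) := fun K n =>
    {a | ‖a‖ ≤ R ∧ ‖a‖ ≤ K * θ ^ n ∧ infDist a 𝔥 ≤ K * (θ ^ n) ^ 2}
  have hD : ∀ K n, IsCompact (D K n) := fun K n => by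
    refine IsCompact.of_isClosed_subset (isCompact_closedBall 0 R) ?_
      (fun a ha => mem_closedBall_zero_iff.2 ha.1)
    exact (isClosed_le continuous_norm continuous_const).inter
      ((isClosed_le continuous_norm continuous_const).inter
        (isClosed_le (continuous_infDist_pt _) continuous_const))
  -- The natural number K serves both as the constant and as the threshold for n. The sets F K are
  -- closed and cover the line, so one of them contains an interval, on which the contraction is
  -- uniform.
  let F : ℕ → Set ℝ := fun K =>
    {t | ∀ n ≥ K, (τ' ^ n : Monoid.End G) (φ t) ∈ uncoord d G '' D K n}
  have hF : ∀ K, IsClosed (F K) := by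
    intro K
    have : F K = ⋂ n ≥ K, (fun t => (τ' ^ n : Monoid.End G) (φ t)) ⁻¹' (uncoord d G '' D K n) := by
      ext t; simp [F]
    rw [this]
    refine isClosed_biInter fun n _ => IsClosed.preimage
      ((contMDiff_end_pow τ' hτ' n).continuous.comp hφ.contMDiff.continuous) ?_
    refine ((hD K n).image_of_continuousOn fun v hv => ?_).isClosed
    exact (continuousAt_uncoord (hE.mem v hv.1)).continuousWithinAt
  have hU : ⋃ K, F K = univ := by
    refine eq_univ_of_forall fun t => ?_
    obtain ⟨K, hK⟩ := hcon t
    obtain ⟨N, hN⟩ := eventually_atTop.1 (hK.and (eventually_mul_pow_lt h0 h1 K hR))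
    obtain ⟨M, hM⟩ := exists_nat_ge K
    refine mem_iUnion.2 ⟨max M N, fun n hn => ?_⟩
    obtain ⟨⟨h3, h4, u, hu, h5⟩, h6⟩ := hN n ((le_max_right _ _).trans hn)
    have hKM : K ≤ (max M N : ℕ) := hM.trans (by exact_mod_cast le_max_left _ _)
    refine ⟨_, ⟨h4.trans h6.le, h4.trans (by gcongr), ?_⟩, uncoord_coord h3⟩
    refine (infDist_le_dist_of_mem hu).trans ?_
    rw [dist_eq_norm]
    exact h5.trans (by gcongr)
  obtain ⟨K, t₀, ht₀⟩ := nonempty_interior_of_iUnion_of_closed hF hU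
  obtain ⟨ε, hε, hball⟩ := Metric.isOpen_iff.1 isOpen_interior t₀ ht₀
  have hFt : ∀ t, |t - t₀| < ε → ∀ n ≥ K, (τ' ^ n : Monoid.End G) (φ t) ∈ coordSource d G ∧
      ‖coord d ((τ' ^ n : Monoid.End G) (φ t))‖ ≤ K * θ ^ n ∧
      ∃ u ∈ 𝔥, ‖coord d ((τ' ^ n : Monoid.End G) (φ t)) - u‖ ≤ K * (θ ^ n) ^ 2 := by
    intro t ht n hn
    obtain ⟨a, ⟨ha1, ha2, ha3⟩, ha4⟩ := interior_subset (hball (show t ∈ ball t₀ ε from ht)) n hn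
    rw [← ha4, coord_uncoord (hE.mem a ha1)]
    obtain ⟨u, hu, hu'⟩ := hcl.exists_infDist_eq_dist hne a
    exact ⟨uncoord_mem (hE.mem a ha1), ha2, u, hu, by rw [← dist_eq_norm, ← hu']; exact ha3⟩
  set e := ε / 2 with he
  have he0 : 0 < e := half_pos hε
  set K₁ : ℝ := 2 * K + 4 * C * K ^ 2 with hK₁
  have hK₁0 : 0 ≤ K₁ := by positivity
  set S := derivOne d τ' with hS
  set v := initialVelocity d φ with hv
  -- Quotients of points of the interval cover φ on [0, e] with uniform constants. The curve s ↦
  -- τ'^n(φ(e s)) has constant logarithmic derivative e S^n v and stays O(θ^n) close to 1. This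
  -- first bounds e S^n v by O(θ^n), then its distance from the endpoint, and so from 𝔥, by
  -- O(θ^(2n)).
  have hmain : ∀ᶠ n : ℕ in atTop, ∃ u ∈ 𝔥,
      ‖e • (S ^ n) v - u‖ ≤ (K₁ + 2 * C * K₁ ^ 2) * (θ ^ n) ^ 2 := by
    filter_upwards [eventually_ge_atTop K, eventually_mul_pow_lt h0 h1 K hR,
      eventually_mul_pow_lt h0 h1 K₁ hR, eventually_mul_pow_lt h0 h1 (2 * C * K₁) one_pos]
      with n hn hn1 hn2 hn3
    have hθ : 0 < θ ^ n := by positivity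
    have hτn := contMDiff_end_pow τ' hτ' n
    have hφn := hφ.comp_hom (τ' ^ n : Monoid.End G) hτn
    have hvel := hφ.initialVelocity_comp_hom (τ' ^ n : Monoid.End G) hτn
    rw [derivOne_pow τ' hτ'] at hvel
    have hest : ∀ s ∈ Icc (0 : ℝ) 1, (τ' ^ n : Monoid.End G) (φ (e * s)) ∈ coordSource d G ∧
        ‖coord d ((τ' ^ n : Monoid.End G) (φ (e * s)))‖ ≤ K₁ * θ ^ n ∧
        ∃ u ∈ 𝔥, ‖coord d ((τ' ^ n : Monoid.End G) (φ (e * s))) - u‖ ≤ K₁ * (θ ^ n) ^ 2 := by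
      intro s hs
      obtain ⟨ha1, ha2, u, hu, ha3⟩ := hFt t₀ (by simpa using hε) n hn
      obtain ⟨hb1, hb2, u', hu', hb3⟩ := hFt (t₀ + e * s) (by
        rw [add_sub_cancel_left, abs_of_nonneg (mul_nonneg he0.le hs.1)]
        nlinarith [hs.2]) n hn
      have h3 := coord_inv_mul_estimate hE hn1.le ha1 hb1 ha2 hb2 hu hu' ha3 hb3 hθ.le
        (pow_le_one₀ h0.le h1.le)
      rwa [hφ.map_add, map_mul, inv_mul_cancel_left] at h3
    have h3 := (hφn.hasLogDeriv e).norm_coord_sub_le hE (by simpa using hφn.map_zero) hn2.le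
      (fun t ht => ⟨(hest t ht).1, (hest t ht).2.1⟩) (e • (S ^ n) v) (μ := ‖e • (S ^ n) v‖) (ε := 0)
      (fun t _ => by rw [hvel]; exact ⟨le_rfl, (norm_eq_zero.2 (sub_self _)).le⟩)
    obtain ⟨-, h4, u, hu, h5⟩ := hest 1 (by simp)
    rw [add_zero] at h3
    set y := coord d ((τ' ^ n : Monoid.End G) (φ (e * 1))) with hy
    set w := e • (S ^ n) v with hw
    replace h3 : ‖y - w‖ ≤ C * (K₁ * θ ^ n) * ‖w‖ := h3
    have h6 : ‖w‖ ≤ 2 * K₁ * θ ^ n := by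
      have h7 : ‖w‖ ≤ ‖y - w‖ + ‖y‖ := by
        have := norm_sub_le y (y - w)
        rw [sub_sub_cancel] at this
        linarith
      have h8 : C * (K₁ * θ ^ n) * ‖w‖ ≤ 1 / 2 * ‖w‖ := by
        gcongr; linarith
      linarith
    refine ⟨u, hu, ?_⟩
    have h7 : w - u = (y - u) - (y - w) := by abel
    rw [h7]
    refine (norm_sub_le _ _).trans ?_
    have h8 : C * (K₁ * θ ^ n) * ‖w‖ ≤ C * (K₁ * θ ^ n) * (2 * K₁ * θ ^ n) := by gcongr
    have h9 : C * (K₁ * θ ^ n) * (2 * K₁ * θ ^ n) = 2 * C * K₁ ^ 2 * (θ ^ n) ^ 2 := by ring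
    have h10 : (K₁ + 2 * C * K₁ ^ 2) * (θ ^ n) ^ 2 =
        K₁ * (θ ^ n) ^ 2 + 2 * C * K₁ ^ 2 * (θ ^ n) ^ 2 := by ring
    linarith
  have hTS : ∀ n, (T ^ n) ((S ^ n) v) = v := fun n => by
    have h2 : T * S = 1 := hT
    have hc : Commute T S := commute_of_comp_eq_id hT
    rw [← Module.End.mul_apply, ← hc.mul_pow, h2, one_pow, Module.End.one_apply]
  have hinvn : ∀ n : ℕ, ∀ u ∈ 𝔥, (T ^ n) u ∈ 𝔥 := by
    intro n
    induction n with
    | zero => exact fun u hu => hu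
    | succ n ih => intro u hu; rw [pow_succ, Module.End.mul_apply]; exact ih _ (hinv u hu)
  -- Applying T^n, which preserves 𝔥, multiplies the error O(θ^(2n)) by at most τ n, and the product
  -- tends to zero.
  have hdist : infDist (e • v) 𝔥 ≤ 0 := by
    have h2 := hlim.const_mul (K₁ + 2 * C * K₁ ^ 2)
    rw [mul_zero] at h2
    refine ge_of_tendsto h2 (hmain.mono fun n => ?_)
    rintro ⟨u, hu, hu'⟩
    refine (infDist_le_dist_of_mem (hinvn n u hu)).trans ?_
    rw [dist_eq_norm]
    have h3 : e • v - (T ^ n) u = (T ^ n) (e • (S ^ n) v - u) := by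
      rw [map_sub, map_smul, hTS]
    rw [h3]
    refine (hTn n _).trans ?_
    calc τ n * ‖e • (S ^ n) v - u‖ ≤ τ n * ((K₁ + 2 * C * K₁ ^ 2) * (θ ^ n) ^ 2) := by
          have := hτ0 n; gcongr
      _ = _ := by ring
  have h2 : e • v ∈ 𝔥 := by
    have h3 : infDist (e • v) 𝔥 = 0 := le_antisymm hdist infDist_nonneg
    exact (hcl.mem_iff_infDist_zero hne).2 h3
  exact (𝔥.smul_mem_iff he0.ne').1 h2

variable (d) in
/-- The Lie algebra of the group generated by `exp 𝔥`, where `𝔥` is the maximally expanding subspace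
for a smooth automorphism, is contained in `𝔥`. -/
theorem lieAlgebraOf_connectedLieSubgroup_subset (τ τ' : Monoid.End G)
    (hτ : ContMDiff (𝓡 d) (𝓡 d) ∞ τ) (hτ' : ContMDiff (𝓡 d) (𝓡 d) ∞ τ') (h : τ * τ' = 1)
    (h' : τ' * τ = 1) {φ : ℝ → G} (hφ : IsOneParameterSubgroup d φ)
    (hφH : ∀ t, φ t ∈ (connectedLieSubgroup (maxExpandingSubspace (differentialAtOne d τ)) :
      Subgroup G)) :
    initialVelocity d φ ∈ maxExpandingSubspace (derivOne d τ) := by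
  obtain ⟨R, C, hE⟩ := exists_coordEstimates d G
  by_cases hρ : 1 < rho (derivOne d τ)
  · set T := derivOne d τ with hT
    have hTS : T ∘ₗ derivOne d τ' = LinearMap.id := by
      rw [hT, ← derivOne_comp τ τ' hτ hτ', ← derivOne_id (d := d) (G := G)]
      exact congrArg _ h
    have hST : derivOne d τ' ∘ₗ T = LinearMap.id := by
      rw [hT, ← derivOne_comp τ' τ hτ' hτ, ← derivOne_id (d := d) (G := G)]
      exact congrArg _ h'
    have hθ0 : 0 < (rho T)⁻¹ := inv_pos.2 (one_pos.trans hρ)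
    have hθ1 : (rho T)⁻¹ < 1 := inv_lt_one_of_one_lt₀ hρ
    obtain ⟨K, hK, hKn⟩ := exists_norm_pow_le T (one_pos.trans hρ)
    refine initialVelocity_mem_of_contractsAlong hE hτ' hθ0 hθ1 hTS
      (fun u hu => map_mem_maxExpandingSubspace T T (Commute.refl T) hu)
      (fun n => (mul_pos hK (growth_pos _ (one_pos.trans hρ) n)).le) hKn ?_ hφ fun t => ?_
    · have h2 := (growth_mul_inv_pow_tendsto (maxMultiplicity T) hρ).const_mul K
      rw [mul_zero] at h2
      exact h2.congr fun n => by ring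
    · refine Subgroup.closure_induction (fun x hx => ?_) (contractsAlong_one τ' _ _)
        (fun x y _ _ hx hy => ?_) (fun x _ hx => ?_) (hφH t)
      · obtain ⟨ψ, hψ, hvel, rfl⟩ := hx
        have hvel' : initialVelocity d ψ ∈ maxExpandingSubspace T := hvel
        obtain ⟨K', hK'⟩ := exists_norm_inverse_pow_le T (derivOne d τ') hST hρ hvel'
        exact contractsAlong_of_oneParameter hE hτ' hθ0 hθ1
          (fun u hu => map_mem_maxExpandingSubspace T _ (commute_of_comp_eq_id hST) hu) hψ hvel' hK'
      · have h2 := (hx.inv_mul hE hθ0 hθ1 (contractsAlong_one τ' _ _)).inv_mul hE hθ0 hθ1 hy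
        simpa using h2
      · simpa using hx.inv_mul hE hθ0 hθ1 (contractsAlong_one τ' _ _)
  -- If ρ ≤ 1, the generators are endpoints of one-parameter subgroups with velocity 0, so the group
  -- is trivial.
  · have h2 : ∀ t, φ t = 1 := by
      intro t
      refine Subgroup.closure_induction (p := fun x _ => x = 1) (fun x hx => ?_) rfl
        (fun x y _ _ hx hy => by rw [hx, hy, one_mul]) (fun x _ hx => by rw [hx, inv_one]) (hφH t)
      obtain ⟨ψ, hψ, hvel, rfl⟩ := hx
      have hvel' : initialVelocity d ψ ∈ maxExpandingSubspace (derivOne d τ) := hvel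
      rw [maxExpandingSubspace, if_neg hρ, Submodule.mem_bot] at hvel'
      exact hψ.eq_one_of_initialVelocity_eq_zero hvel'
    have h3 := hφ.hasDerivAt
    simp only [h2] at h3
    rw [h3.unique (hasDerivAt_const _ _)]
    exact Submodule.zero_mem _

end Homs

/-! ### First-order expansions -/

section Expansion

variable {E₁ E₂ E₃ : Type*} [NormedAddCommGroup E₁] [NormedSpace ℝ E₁] [FiniteDimensional ℝ E₁]
  [NormedAddCommGroup E₂] [NormedSpace ℝ E₂] [FiniteDimensional ℝ E₂]
  [NormedAddCommGroup E₃] [NormedSpace ℝ E₃]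

/-- The first-order expansion of a `C^1` map in the second variable is uniform in the first. -/
theorem exists_uniform_expansion {F : E₁ × E₂ → E₃} {a : E₁} (hF : ContDiffAt ℝ 1 F (a, 0)) :
    ∃ (A : E₁ → E₂ →L[ℝ] E₃) (r : ℝ), 0 < r ∧ ContinuousAt A a ∧
      HasFDerivAt (fun w => F (a, w)) (A a) 0 ∧
      ∀ κ > 0, ∃ δ > 0, ∀ y ∈ closedBall a r, ∀ w, ‖w‖ ≤ δ →
        ‖F (y, w) - F (y, 0) - A y w‖ ≤ κ * ‖w‖ := by
  have : ProperSpace E₁ := FiniteDimensional.proper ℝ E₁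
  have : ProperSpace E₂ := FiniteDimensional.proper ℝ E₂
  have h1 : ∀ᶠ p in 𝓝 (a, (0 : E₂)), ContDiffAt ℝ 1 F p := hF.eventually (by simp)
  obtain ⟨R, hR, hball⟩ := Metric.eventually_nhds_iff_ball.1 h1
  have hdiff : ∀ p ∈ ball (a, (0 : E₂)) R, HasFDerivAt F (fderiv ℝ F p) p := fun p hp =>
    ((hball p hp).differentiableAt (by simp)).hasFDerivAt
  have hcont : ContinuousOn (fderiv ℝ F) (ball (a, (0 : E₂)) R) := fun p hp =>
    ((hball p hp).continuousAt_fderiv (by simp)).continuousWithinAt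
  have hK : closedBall a (R / 2) ×ˢ closedBall (0 : E₂) (R / 2) ⊆ ball (a, (0 : E₂)) R := by
    rw [closedBall_prod_same]
    exact closedBall_subset_ball (by linarith)
  -- Uniform continuity of the derivative on a compact neighbourhood makes the expansion in w
  -- uniform in the base point y.
  have huc := ((isCompact_closedBall a (R / 2)).prod (isCompact_closedBall (0 : E₂) (R / 2))
    ).uniformContinuousOn_of_continuous (hcont.mono hK)
  have hpart : ∀ y ∈ closedBall a (R / 2), ∀ w ∈ closedBall (0 : E₂) (R / 2),
      HasFDerivAt (fun w => F (y, w))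
        ((fderiv ℝ F (y, w)).comp (ContinuousLinearMap.inr ℝ E₁ E₂)) w := fun y hy w hw =>
    (hdiff (y, w) (hK ⟨hy, hw⟩)).comp w (hasFDerivAt_prodMk_right y w)
  have ha : a ∈ closedBall a (R / 2) := mem_closedBall_self (by linarith)
  have h0 : (0 : E₂) ∈ closedBall (0 : E₂) (R / 2) := mem_closedBall_self (by linarith)
  refine ⟨fun y => (fderiv ℝ F (y, 0)).comp (ContinuousLinearMap.inr ℝ E₁ E₂), R / 2, half_pos hR,
    ?_, hpart a ha 0 h0, fun κ hκ => ?_⟩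
  · have h2 : ContinuousAt (fun y : E₁ => fderiv ℝ F (y, (0 : E₂))) a :=
      ContinuousAt.comp (f := fun y : E₁ => (y, (0 : E₂))) (g := fderiv ℝ F)
        (hF.continuousAt_fderiv (by simp)) (by fun_prop)
    exact h2.clm_comp continuousAt_const
  obtain ⟨δ, hδ, hδ'⟩ := Metric.uniformContinuousOn_iff.1 huc κ hκ
  refine ⟨min (δ / 2) (R / 2), by positivity, fun y hy w hw => ?_⟩
  have hsub : closedBall (0 : E₂) ‖w‖ ⊆ closedBall 0 (R / 2) :=
    closedBall_subset_closedBall (hw.trans (min_le_right _ _))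
  have h2 := (convex_closedBall (0 : E₂) ‖w‖).norm_image_sub_le_of_norm_hasFDerivWithin_le'
    (f := fun w => F (y, w)) (C := κ)
    (φ := (fderiv ℝ F (y, 0)).comp (ContinuousLinearMap.inr ℝ E₁ E₂))
    (fun x hx => (hpart y hy x (hsub hx)).hasFDerivWithinAt) (fun x hx => by
      rw [← ContinuousLinearMap.sub_comp]
      have h3 : dist (y, x) (y, (0 : E₂)) < δ := by
        rw [dist_prod_same_left]
        have : dist x 0 ≤ ‖w‖ := hx
        linarith [hw.trans (min_le_left _ _)]
      have h4 := hδ' (y, x) ⟨hy, hsub hx⟩ (y, 0) ⟨hy, h0⟩ h3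
      rw [dist_eq_norm] at h4
      refine (ContinuousLinearMap.opNorm_comp_le _ _).trans ?_
      calc _ ≤ κ * 1 := by
            gcongr
            exact ContinuousLinearMap.norm_inr_le_one ℝ E₁ E₂
        _ = κ := mul_one κ)
    (x := 0) (y := w) (mem_closedBall_self (norm_nonneg _)) (by simp)
  simpa using h2

end Expansion

/-! ### Local equations of immersed submanifolds -/

section DefiningFunction

variable {E₁ E₂ : Type*} [NormedAddCommGroup E₁] [NormedSpace ℝ E₁] [FiniteDimensional ℝ E₁]
  [NormedAddCommGroup E₂] [NormedSpace ℝ E₂] [FiniteDimensional ℝ E₂]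

/-- A `C^1` immersed submanifold lies locally in the zero set of a `C^1` function whose derivative
in a given direction transversal to the submanifold does not vanish. -/
theorem exists_defining_function {J : E₁ → E₂} {p₀ : E₁} (hJ : ContDiffAt ℝ 1 J p₀)
    (hinj : Function.Injective (fderiv ℝ J p₀)) {v : E₂} (hv : v ∉ range (fderiv ℝ J p₀)) :
    ∃ u : E₂ → ℝ, ContDiffAt ℝ 1 u (J p₀) ∧ fderiv ℝ u (J p₀) v = 1 ∧
      ∀ᶠ p in 𝓝 p₀, u (J p) = 0 := by
  have : CompleteSpace E₁ := FiniteDimensional.complete ℝ E₁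
  -- P is a left inverse of D, and l a functional that vanishes on the image of D with l v = 1. P ∘
  -- J has derivative the identity at p₀, so it has a local C^1 inverse q.
  set D := fderiv ℝ J p₀ with hD
  obtain ⟨P', hP'⟩ := (D : E₁ →ₗ[ℝ] E₂).exists_leftInverse_of_injective
    (LinearMap.ker_eq_bot.2 hinj)
  obtain ⟨l', hl', hl''⟩ := Submodule.exists_dual_map_eq_bot_of_notMem
    (p := LinearMap.range (D : E₁ →ₗ[ℝ] E₂))
    (x := v) (by simpa using hv) inferInstance
  set P : E₂ →L[ℝ] E₁ := P'.toContinuousLinearMap with hP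
  set l : E₂ →L[ℝ] ℝ := (l' v)⁻¹ • l'.toContinuousLinearMap with hl
  have hlv : l v = 1 := by simp [hl, hl']
  have hlD : ∀ x, l (D x) = 0 := by
    intro x
    have : l' (D x) ∈ Submodule.map l' (LinearMap.range (D : E₁ →ₗ[ℝ] E₂)) :=
      Submodule.mem_map_of_mem ⟨x, rfl⟩
    rw [hl'', Submodule.mem_bot] at this
    simp [hl, this]
  have hPD : ∀ x, P (D x) = x := fun x => LinearMap.congr_fun hP' x
  have hPJ : ContDiffAt ℝ 1 (fun p => P (J p)) p₀ := P.contDiff.contDiffAt.comp p₀ hJ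
  have hJd : HasFDerivAt J D p₀ := (hJ.differentiableAt (by simp)).hasFDerivAt
  have hPJd : HasFDerivAt (fun p => P (J p))
      ((ContinuousLinearEquiv.refl ℝ E₁ : E₁ ≃L[ℝ] E₁) : E₁ →L[ℝ] E₁) p₀ := by
    have h1 := P.hasFDerivAt.comp p₀ hJd
    have h2 : P.comp D = ((ContinuousLinearEquiv.refl ℝ E₁ : E₁ ≃L[ℝ] E₁) : E₁ →L[ℝ] E₁) := by
      ext x; exact hPD x
    rw [h2] at h1
    exact h1
  set q := hPJ.localInverse hPJd (by simp) with hq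
  have hqc : ContDiffAt ℝ 1 q (P (J p₀)) := hPJ.to_localInverse hPJd (by simp)
  have hstrict := hPJ.hasStrictFDerivAt' hPJd (by simp)
  have hqe : ∀ᶠ p in 𝓝 p₀, q (P (J p)) = p := hstrict.eventually_left_inverse
  have hq0 : q (P (J p₀)) = p₀ := hqe.self_of_nhds
  have hc : ContDiffAt ℝ 1 (fun a => J (q (P a))) (J p₀) := by
    have h1 : ContDiffAt ℝ 1 (fun a => q (P a)) (J p₀) :=
      ContDiffAt.comp (J p₀) (g := q) hqc P.contDiff.contDiffAt
    exact ContDiffAt.comp (J p₀) (g := J) (f := fun a => q (P a)) (by rw [hq0]; exact hJ) h1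
  -- J ∘ q ∘ P is a C^1 retraction onto the local image of J, so u vanishes there. Its derivative
  -- has values in the image of D, which l kills; hence du = l at J p₀.
  refine ⟨fun a => l a - l (J (q (P a))), l.contDiff.contDiffAt.sub
    (l.contDiff.contDiffAt.comp (J p₀) hc), ?_, ?_⟩
  · have h1 : DifferentiableAt ℝ (fun a => q (P a)) (J p₀) :=
      (hqc.differentiableAt (by simp)).comp (J p₀) P.differentiableAt
    have h2 : HasFDerivAt (fun a => J (q (P a))) (D.comp (fderiv ℝ (fun a => q (P a)) (J p₀)))
        (J p₀) :=
      HasFDerivAt.comp (J p₀) (g := J) (by rw [hq0]; exact hJd) h1.hasFDerivAt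
    have h3 := (l.hasFDerivAt (x := J p₀)).sub (l.hasFDerivAt.comp (J p₀) h2)
    have h4 := h3.fderiv
    have h5 : fderiv ℝ (fun a => l a - l (J (q (P a)))) (J p₀) =
      l - l.comp (D.comp (fderiv ℝ (fun a => q (P a)) (J p₀))) := h4
    rw [h5]
    simp [hlv, hlD]
  · filter_upwards [hqe] with p hp
    rw [hp, sub_self]

end DefiningFunction

/-! ### The quotient of a Lie group by a discrete subgroup -/

section QuotientGeometry

variable {d : ℕ} {G : Type*} [TopologicalSpace G] [ChartedSpace (EuclideanSpace ℝ (Fin d)) G]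
  [Group G] [LieGroup (𝓡 d) ∞ G] (Γ : Subgroup G) [DiscreteTopology Γ]

lemma contMDiff_quotient_mk : ContMDiff (𝓡 d) (𝓡 d) ∞ (QuotientGroup.mk : G → G ⧸ Γ) := by
  have : IsManifold (𝓡 d) ∞ G := LieGroup.toContMDiffMul.toIsManifold
  intro a
  rw [contMDiffAt_iff_target]
  refine ⟨(isLocalHomeomorph_mk d Γ).continuous.continuousAt, ?_⟩
  have ha : (a : G ⧸ Γ) ∈ (chartAt (EuclideanSpace ℝ (Fin d)) (a : G ⧸ Γ)).source :=
    mem_chart_source _ _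
  obtain ⟨b, hb⟩ : ∃ b : G, chartAt (EuclideanSpace ℝ (Fin d)) (a : G ⧸ Γ) =
      ((isLocalHomeomorph_mk d Γ).localInverseAt b).trans
        (chartAt (EuclideanSpace ℝ (Fin d)) b) := ⟨_, rfl⟩
  rw [hb] at ha
  have h1 := contMDiffAt_localInverse_mk (d := d) Γ b a ha.1
  have h2 : ContMDiffAt (𝓡 d) (𝓡 d) ∞ (chartAt (EuclideanSpace ℝ (Fin d)) b)
      ((isLocalHomeomorph_mk d Γ).localInverseAt b (a : G ⧸ Γ)) :=
    (contMDiffOn_chart (I := 𝓡 d)).contMDiffAt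
      ((chartAt (EuclideanSpace ℝ (Fin d)) b).open_source.mem_nhds ha.2)
  have h3 := ContMDiffAt.comp (g := chartAt (EuclideanSpace ℝ (Fin d)) b) a h2 h1
  refine h3.congr_of_eventuallyEq (Eventually.of_forall fun x => ?_)
  simp [extChartAt, hb]

variable (d) in
/-- A local section of the projection `G → G ⧸ Γ`. -/
def localSection (a : G) : G ⧸ Γ → G := (isLocalHomeomorph_mk d Γ).localInverseAt a

@[simp] lemma localSection_mk (a : G) : localSection d Γ a (a : G ⧸ Γ) = a :=
  (isLocalHomeomorph_mk d Γ).localInverseAt_apply_self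

lemma eventually_mk_localSection (a : G) :
    ∀ᶠ x in 𝓝 (a : G ⧸ Γ), ((localSection d Γ a x : G) : G ⧸ Γ) = x := by
  filter_upwards [((isLocalHomeomorph_mk d Γ).localInverseAt a).open_source.mem_nhds
    (isLocalHomeomorph_mk d Γ).apply_self_mem_localInverseAt_source] with x hx
  exact (isLocalHomeomorph_mk d Γ).apply_localInverseAt_of_mem hx

lemma contMDiffAt_localSection (a : G) :
    ContMDiffAt (𝓡 d) (𝓡 d) ∞ (localSection d Γ a) (a : G ⧸ Γ) := by
  have : IsManifold (𝓡 d) ∞ G := LieGroup.toContMDiffMul.toIsManifold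
  rw [contMDiffAt_iff_source, modelWithCornersSelf_coe, range_id, contMDiffWithinAt_univ]
  obtain ⟨b, hb⟩ : ∃ b : G, chartAt (EuclideanSpace ℝ (Fin d)) (a : G ⧸ Γ) =
      ((isLocalHomeomorph_mk d Γ).localInverseAt b).trans
        (chartAt (EuclideanSpace ℝ (Fin d)) b) := ⟨_, rfl⟩
  set y := extChartAt (𝓡 d) (a : G ⧸ Γ) (a : G ⧸ Γ) with hy
  have hyt : y ∈ (extChartAt (𝓡 d) (a : G ⧸ Γ)).target := mem_extChartAt_target _
  have hyt' : y ∈ (chartAt (EuclideanSpace ℝ (Fin d)) b).target := by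
    simp [extChartAt, hb] at hyt
    exact hyt.1
  have hyi : (((chartAt (EuclideanSpace ℝ (Fin d)) b).symm y : G) : G ⧸ Γ) = a := by
    have := extChartAt_to_inv (I := 𝓡 d) (a : G ⧸ Γ)
    simpa [extChartAt, hb, hy] using this
  have h1 : ContMDiffAt (𝓡 d) (𝓡 d) ∞ (chartAt (EuclideanSpace ℝ (Fin d)) b).symm y :=
    (contMDiffOn_chart_symm (I := 𝓡 d)).contMDiffAt
      ((chartAt (EuclideanSpace ℝ (Fin d)) b).open_target.mem_nhds hyt')
  have h2 := contMDiffAt_localInverse_mk (d := d) Γ a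
    ((chartAt (EuclideanSpace ℝ (Fin d)) b).symm y) (by
      rw [hyi]; exact (isLocalHomeomorph_mk d Γ).apply_self_mem_localInverseAt_source)
  have h3 := ContMDiffAt.comp (g := fun x : G => localSection d Γ a (x : G ⧸ Γ)) y h2 h1
  refine h3.congr_of_eventuallyEq (Eventually.of_forall fun x => ?_)
  simp [extChartAt, hb]

lemma contMDiff_smul_const (x : G ⧸ Γ) : ContMDiff (𝓡 d) (𝓡 d) ∞ fun h : G => h • x := by
  induction x using QuotientGroup.induction_on with
  | H a => exact (contMDiff_quotient_mk (d := d) Γ).comp (contMDiff_mul_right (a := a))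

variable (d) in
/-- The coordinates, centered at `a Γ`, given by the action of `G`. -/
def orbitCoord (a : G) (x : G ⧸ Γ) : EuclideanSpace ℝ (Fin d) :=
  coord d (localSection d Γ a x * a⁻¹)

lemma orbitCoord_self (a : G) : orbitCoord d Γ a (a : G ⧸ Γ) = 0 := by
  simp [orbitCoord]

lemma contMDiffAt_orbitCoord (a : G) :
    ContMDiffAt (𝓡 d) (𝓡 d) ∞ (orbitCoord d Γ a) (a : G ⧸ Γ) := by
  have h1 : ContMDiffAt (𝓡 d) (𝓡 d) ∞ (fun x => localSection d Γ a x * a⁻¹) (a : G ⧸ Γ) :=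
    (contMDiffAt_localSection Γ a).mul contMDiffAt_const
  exact ContMDiffAt.comp (g := coord d) _
    (contMDiffAt_coord (by simpa using one_mem_coordSource)) h1

lemma eventually_uncoord_orbitCoord (a : G) :
    ∀ᶠ x in 𝓝 (a : G ⧸ Γ), uncoord d G (orbitCoord d Γ a x) • (a : G ⧸ Γ) = x := by
  have h1 : ContinuousAt (fun x => localSection d Γ a x * a⁻¹) (a : G ⧸ Γ) :=
    ((contMDiffAt_localSection (d := d) Γ a).mul contMDiffAt_const).continuousAt
  have h2 := h1.preimage_mem_nhds (isOpen_coordSource.mem_nhds (by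
    simpa using one_mem_coordSource (d := d) (G := G)))
  filter_upwards [h2, eventually_mk_localSection (d := d) Γ a] with x hx hx'
  rw [orbitCoord, uncoord_coord hx]
  change ((localSection d Γ a x * a⁻¹ * a : G) : G ⧸ Γ) = x
  rw [inv_mul_cancel_right, hx']

/-- Near `0`, the map `v ↦ uncoord v • z` is injective. -/
lemma exists_injOn_uncoord_smul (z : G ⧸ Γ) :
    ∃ r > 0, ball 0 r ⊆ coordTarget d G ∧ InjOn (fun v => uncoord d G v • z) (ball 0 r) := by
  induction z using QuotientGroup.induction_on with
  | H a =>
    have hc : ContinuousAt (fun v : EuclideanSpace ℝ (Fin d) => uncoord d G v * a) 0 :=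
      ((contMDiffAt_uncoord zero_mem_coordTarget).mul contMDiffAt_const).continuousAt
    have h1 := hc.preimage_mem_nhds
      (((isLocalHomeomorph_mk d Γ).localInverseAt a).open_target.mem_nhds (by simp))
    have h2 := isOpen_coordTarget.mem_nhds (zero_mem_coordTarget (d := d) (G := G))
    obtain ⟨r, hr, hball⟩ := Metric.mem_nhds_iff.1 (inter_mem h1 h2)
    refine ⟨r, hr, fun v hv => (hball hv).2, fun v hv w hw hvw => ?_⟩
    have h3 := (isLocalHomeomorph_mk d Γ).injOn_localInverseAt_target (hball hv).1 (hball hw).1 hvw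
    have h4 := mul_right_cancel h3
    rw [← coord_uncoord (hball hv).2, ← coord_uncoord (hball hw).2, h4]

/-- The map `v ↦ uncoord v • z` is open. -/
lemma image_uncoord_smul_mem_nhds (z : G ⧸ Γ) {v : EuclideanSpace ℝ (Fin d)}
    (hv : v ∈ coordTarget d G) {s : Set (EuclideanSpace ℝ (Fin d))} (hs : s ∈ 𝓝 v) :
    (fun v => uncoord d G v • z) '' s ∈ 𝓝 (uncoord d G v • z) := by
  induction z using QuotientGroup.induction_on with
  | H a =>
    have := topologicalGroup_of_lieGroup (𝓡 d) ∞ (G := G)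
    have h1 : uncoord d G '' s ∈ 𝓝 (uncoord d G v) := by
      have h2 : coord d ⁻¹' s ∈ 𝓝 (uncoord d G v) :=
        (continuousAt_coord (uncoord_mem hv)).preimage_mem_nhds (by rwa [coord_uncoord hv])
      filter_upwards [h2, isOpen_coordSource.mem_nhds (uncoord_mem hv)] with x hx hx'
      exact ⟨_, hx, uncoord_coord hx'⟩
    have h2 : IsOpenMap fun h : G => ((h * a : G) : G ⧸ Γ) :=
      (isLocalHomeomorph_mk d Γ).isOpenMap.comp (isOpenMap_mul_right a)
    have h3 := h2.image_mem_nhds h1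
    rwa [image_image] at h3

end QuotientGeometry

/-! ### First-order expansions at the source and at the target of an orbit -/

section QuotientExpansion

variable {d : ℕ} {G : Type*} [TopologicalSpace G] [ChartedSpace (EuclideanSpace ℝ (Fin d)) G]
  [Group G] [LieGroup (𝓡 d) ∞ G] (Γ : Subgroup G) [DiscreteTopology Γ]

/-- First-order expansion of a function of `v` along the orbit map `v ↦ uncoord v • z`, under small
translations. -/
theorem exists_target_expansion (z : G ⧸ Γ) {u : EuclideanSpace ℝ (Fin d) → ℝ}
    (hu : ContDiffAt ℝ 1 u 0) :
    ∃ (A : EuclideanSpace ℝ (Fin d) → StrongDual ℝ (EuclideanSpace ℝ (Fin d))) (r : ℝ), 0 < r ∧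
      ContinuousAt A 0 ∧ A 0 = fderiv ℝ u 0 ∧
      ∀ κ > 0, ∃ δ > 0, ∀ a ∈ closedBall 0 r, ∀ a' ∈ closedBall 0 r, ∀ h ∈ coordSource d G,
        ‖coord d h‖ ≤ δ → h • uncoord d G a • z = uncoord d G a' • z →
        |u a' - u a - A a (coord d h)| ≤ κ * ‖coord d h‖ := by
  have := topologicalGroup_of_lieGroup (𝓡 d) ∞ (G := G)
  let E := EuclideanSpace ℝ (Fin d)
  have h1 : ContDiffAt ℝ 1 (fun p : E × E => coord d (uncoord d G p.2 * uncoord d G p.1)) (0, 0) :=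
    ContDiffAt.comp (0, 0) (g := fun p : E × E => coord d (uncoord d G p.1 * uncoord d G p.2))
      (f := fun p : E × E => (p.2, p.1)) (contDiffAt_coord_mul.of_le (by simp))
      (contDiffAt_snd.prodMk contDiffAt_fst)
  have h2 : ContDiffAt ℝ 1
      (fun p : E × E => u (coord d (uncoord d G p.2 * uncoord d G p.1))) (0, 0) :=
    ContDiffAt.comp (0, 0) (g := u) (by simpa using hu) h1
  obtain ⟨A, r, hr, hA, hA0, hexp⟩ := exists_uniform_expansion h2
  obtain ⟨ρ, hρ, hρt, hinj⟩ := exists_injOn_uncoord_smul (d := d) Γ z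
  have hc0 := continuousAt_uncoord (zero_mem_coordTarget (d := d) (G := G))
  have h3 : ContinuousAt (fun p : E × E => uncoord d G p.2 * uncoord d G p.1) (0, 0) :=
    (ContinuousAt.comp (f := fun p : E × E => p.2) (g := uncoord d G) hc0 continuousAt_snd).mul
      (ContinuousAt.comp (f := fun p : E × E => p.1) (g := uncoord d G) hc0 continuousAt_fst)
  have h4 := h3.preimage_mem_nhds (isOpen_coordSource.mem_nhds (by
    simpa using one_mem_coordSource (d := d) (G := G)))
  have h5 := h1.continuousAt.preimage_mem_nhds (ball_mem_nhds _ hρ)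
  obtain ⟨ρ', hρ', hball⟩ := Metric.mem_nhds_iff.1 (inter_mem h4 h5)
  simp only [uncoord_zero, mul_one, coord_one] at hball
  refine ⟨A, min r (min (ρ / 2) (ρ' / 2)), by positivity, hA, ?_, fun κ hκ => ?_⟩
  · refine (hA0.congr_of_eventuallyEq ?_).fderiv.symm
    filter_upwards [isOpen_coordTarget.mem_nhds (zero_mem_coordTarget (d := d) (G := G))] with w hw
    simp [coord_uncoord hw]
  obtain ⟨δ, hδ, hδ'⟩ := hexp κ hκ
  refine ⟨min δ (ρ' / 2), by positivity, fun a ha a' ha' h hh hhδ heq => ?_⟩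
  rw [mem_closedBall_zero_iff, le_min_iff, le_min_iff] at ha ha'
  rw [le_min_iff] at hhδ
  have hab : a ∈ ball (0 : E) ρ := mem_ball_zero_iff.2 (by linarith)
  have h6 : (a, coord d h) ∈ ball ((0 : E), (0 : E)) ρ' := by
    rw [← ball_prod_same]
    exact ⟨mem_ball_zero_iff.2 (by linarith), mem_ball_zero_iff.2 (by linarith)⟩
  have h7 := hball h6
  simp only [mem_inter_iff, mem_preimage, uncoord_coord hh] at h7
  -- Both coordinates describe the same point of the orbit of z and lie in the ball where the orbit
  -- map is injective, so a' is determined by h and a.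
  have h8 : coord d (h * uncoord d G a) = a' := by
    refine hinj h7.2 (mem_ball_zero_iff.2 (by linarith)) ?_
    change uncoord d G _ • z = uncoord d G _ • z
    rw [uncoord_coord h7.1, mul_smul, heq]
  have h9 := hδ' a (mem_closedBall_zero_iff.2 ha.1) (coord d h) hhδ.1
  simp only [uncoord_coord hh, h8, uncoord_zero, one_mul, coord_uncoord (hρt hab)] at h9
  exact h9

/-- First-order expansion, in a chart of the quotient, of the translation that takes a point to a
nearby point. -/
theorem exists_source_expansion
    {e : OpenPartialHomeomorph (G ⧸ Γ) (EuclideanSpace ℝ (Fin d))}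
    (he : e ∈ IsManifold.maximalAtlas (𝓡 d) 1 (G ⧸ Γ)) {c₀ : EuclideanSpace ℝ (Fin d)}
    (hc₀ : c₀ ∈ e.target) :
    ∃ (M : EuclideanSpace ℝ (Fin d) → EuclideanSpace ℝ (Fin d) →L[ℝ] EuclideanSpace ℝ (Fin d))
      (P : EuclideanSpace ℝ (Fin d) →L[ℝ] EuclideanSpace ℝ (Fin d)) (r : ℝ), 0 < r ∧
      ContinuousAt M c₀ ∧ (∀ w, M c₀ (P w) = w) ∧ closedBall c₀ r ⊆ e.target ∧
      ∀ κ > 0, ∃ δ > 0, ∀ c ∈ closedBall c₀ r, ∀ c' ∈ closedBall c₀ r, ‖c' - c‖ ≤ δ →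
        ∃ V, e.symm c' = uncoord d G V • e.symm c ∧ ‖V - M c (c' - c)‖ ≤ κ * ‖c' - c‖ := by
  have := topologicalGroup_of_lieGroup (𝓡 d) ∞ (G := G)
  have : IsManifold (𝓡 d) 1 (G ⧸ Γ) := IsManifold.of_le (n := ∞) (by simp)
  let E := EuclideanSpace ℝ (Fin d)
  obtain ⟨a, ha⟩ := QuotientGroup.mk_surjective (e.symm c₀)
  have he1 : ContMDiffAt (𝓡 d) (𝓡 d) 1 e (a : G ⧸ Γ) :=
    contMDiffAt_of_mem_maximalAtlas he (ha ▸ e.map_target hc₀)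
  have he2 : ContMDiffAt (𝓡 d) (𝓡 d) 1 e.symm c₀ :=
    contMDiffAt_symm_of_mem_maximalAtlas he hc₀
  have hs : ContMDiffAt (𝓡 d) (𝓡 d) 1 (localSection d Γ a) (e.symm c₀) := by
    rw [← ha]; exact (contMDiffAt_localSection Γ a).of_le (by simp)
  have hse : ContMDiffAt (𝓡 d) (𝓡 d) 1 (fun c => localSection d Γ a (e.symm c)) c₀ :=
    hs.comp c₀ he2
  have h1 : ContMDiffAt 𝓘(ℝ, E × E) (𝓡 d) 1 (fun p : E × E =>
      localSection d Γ a (e.symm (p.1 + p.2)) * (localSection d Γ a (e.symm p.1))⁻¹) (c₀, 0) :=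
    (ContMDiffAt.comp (c₀, 0) (g := fun c => localSection d Γ a (e.symm c))
        (f := fun p : E × E => p.1 + p.2) (by rw [add_zero]; exact hse)
        (contDiffAt_fst.add contDiffAt_snd).contMDiffAt).mul
      (ContMDiffAt.comp (c₀, 0) (g := fun c => localSection d Γ a (e.symm c))
        (f := fun p : E × E => p.1) hse contDiffAt_fst.contMDiffAt).inv
  have h10 : localSection d Γ a (e.symm (c₀ + 0)) * (localSection d Γ a (e.symm c₀))⁻¹ = 1 := by
    rw [add_zero, mul_inv_cancel]
  -- F(c, w) is the coordinate of the group element that moves the point with chart coordinate c to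
  -- that with c + w. It vanishes for w = 0.
  set F : E × E → E := fun p => coord d
    (localSection d Γ a (e.symm (p.1 + p.2)) * (localSection d Γ a (e.symm p.1))⁻¹) with hF
  have h2 : ContDiffAt ℝ 1 F (c₀, 0) := by
    rw [← contMDiffAt_iff_contDiffAt]
    refine ContMDiffAt.comp (c₀, 0) (g := coord d) ?_ h1
    simp only [h10]
    exact (contMDiffAt_coord one_mem_coordSource).of_le (by simp)
  obtain ⟨M, r, hr, hM, hM0, hexp⟩ := exists_uniform_expansion h2
  have h3 := h1.continuousAt.preimage_mem_nhds (isOpen_coordSource.mem_nhds (by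
    simp only [h10]; exact (one_mem_coordSource (d := d) (G := G))))
  have h4 : ∀ᶠ c in 𝓝 c₀, ((localSection d Γ a (e.symm c) : G) : G ⧸ Γ) = e.symm c := by
    refine he2.continuousAt.eventually (p := fun x => ((localSection d Γ a x : G) : G ⧸ Γ) = x) ?_
    rw [← ha]
    exact eventually_mk_localSection Γ a
  obtain ⟨ρ, hρ, hρ'⟩ := Metric.mem_nhds_iff.1 h3
  obtain ⟨ρ₁, hρ₁, hρ₁'⟩ := Metric.mem_nhds_iff.1
    (inter_mem h4 (e.open_target.mem_nhds hc₀))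
  have hkey : ∀ c ∈ ball c₀ (min ρ ρ₁), ∀ c' ∈ ball c₀ (min ρ ρ₁), ‖c' - c‖ < ρ →
      e.symm c' = uncoord d G (F (c, c' - c)) • e.symm c := by
    intro c hc c' hc' hcc
    have h5 : (c, c' - c) ∈ ball (c₀, (0 : E)) ρ := by
      rw [← ball_prod_same]
      exact ⟨ball_subset_ball (min_le_left _ _) hc, mem_ball_zero_iff.2 hcc⟩
    have h6 := hρ' h5
    rw [mem_preimage, add_sub_cancel] at h6
    have h7 : ((localSection d Γ a (e.symm c) : G) : G ⧸ Γ) = e.symm c :=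
      (hρ₁' (ball_subset_ball (min_le_right _ _) hc)).1
    have h8 : ((localSection d Γ a (e.symm c') : G) : G ⧸ Γ) = e.symm c' :=
      (hρ₁' (ball_subset_ball (min_le_right _ _) hc')).1
    rw [hF]
    simp only [add_sub_cancel]
    rw [uncoord_coord h6]
    conv_rhs => rw [← h7]
    change _ = ((_ * _ : G) : G ⧸ Γ)
    rw [h7, inv_mul_cancel_right, h8]
  have hF0 : F (c₀, 0) = 0 := by simp only [hF, h10, coord_one]
  -- The derivative at 0 of v ↦ e(uncoord v • aΓ) undoes M c₀, because this map recovers c₀ + w from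
  -- F(c₀, w). In finite dimension it is then a right inverse too, which is what is used: group
  -- directions have to be realized by chart displacements.
  have hleft : ∃ P : E →L[ℝ] E, ∀ w, P (M c₀ w) = w := by
    have h5 : ContMDiffAt (𝓡 d) (𝓡 d) 1 (fun v : E => e (uncoord d G v • (a : G ⧸ Γ))) 0 := by
      have h6 : ContMDiffAt (𝓡 d) (𝓡 d) 1 (fun v : E => uncoord d G v • (a : G ⧸ Γ)) 0 :=
        ContMDiffAt.comp 0 (g := fun h : G => h • (a : G ⧸ Γ))
          ((contMDiff_smul_const Γ _).contMDiffAt.of_le (by simp))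
          ((contMDiffAt_uncoord zero_mem_coordTarget).of_le (by simp))
      exact ContMDiffAt.comp 0 (g := e) (by rw [uncoord_zero, one_smul]; exact he1) h6
    have h6 := (h5.contDiffAt.differentiableAt (by simp)).hasFDerivAt
    refine ⟨fderiv ℝ (fun v : E => e (uncoord d G v • (a : G ⧸ Γ))) 0, fun w => ?_⟩
    have h7 := HasFDerivAt.comp (g := fun v : E => e (uncoord d G v • (a : G ⧸ Γ)))
      (f := fun w => F (c₀, w)) 0 (by rw [hF0]; exact h6) hM0
    have h8 : HasFDerivAt (fun w : E => c₀ + w) (ContinuousLinearMap.id ℝ E) 0 :=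
      (hasFDerivAt_id (𝕜 := ℝ) (0 : E)).const_add c₀
    have h9 : (fun w : E => c₀ + w) =ᶠ[𝓝 0]
        (fun v : E => e (uncoord d G v • (a : G ⧸ Γ))) ∘ fun w => F (c₀, w) := by
      filter_upwards [ball_mem_nhds (0 : E) (lt_min hρ hρ₁)] with w hw
      rw [mem_ball_zero_iff, lt_min_iff] at hw
      have h11 := hkey c₀ (mem_ball_self (lt_min hρ hρ₁)) (c₀ + w) (by
        rw [mem_ball, dist_eq_norm, add_sub_cancel_left, lt_min_iff]; exact hw) (by
        rw [add_sub_cancel_left]; exact hw.1)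
      rw [add_sub_cancel_left, ← ha] at h11
      rw [Function.comp_apply, ← h11]
      refine (e.right_inv ?_).symm
      exact (hρ₁' (by rw [mem_ball, dist_eq_norm, add_sub_cancel_left]; exact hw.2)).2
    have h10 := (h7.congr_of_eventuallyEq h9).unique h8
    exact congrArg (fun f : E →L[ℝ] E => f w) h10
  obtain ⟨P, hP⟩ := hleft
  have hP' : ∀ w, M c₀ (P w) = w := by
    have h5 : (P : E →ₗ[ℝ] E) * (M c₀ : E →ₗ[ℝ] E) = 1 := LinearMap.ext hP
    have h6 := mul_eq_one_comm.1 h5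
    exact fun w => LinearMap.congr_fun h6 w
  refine ⟨M, P, min r (min (ρ / 2) (ρ₁ / 2)), by positivity, hM, hP', ?_, fun κ hκ => ?_⟩
  · intro c hc
    refine (hρ₁' ?_).2
    have h5 : dist c c₀ ≤ ρ₁ / 2 := (mem_closedBall.1 hc).trans
      ((min_le_right _ _).trans (min_le_right _ _))
    rw [mem_ball]; linarith
  obtain ⟨δ, hδ, hδ'⟩ := hexp κ hκ
  have hsub : closedBall c₀ (min r (min (ρ / 2) (ρ₁ / 2))) ⊆ ball c₀ (min ρ ρ₁) := by
    refine closedBall_subset_ball ((min_le_right _ _).trans_lt (lt_min ?_ ?_))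
    · exact (min_le_left _ _).trans_lt (by linarith)
    · exact (min_le_right _ _).trans_lt (by linarith)
  refine ⟨min δ (ρ / 2), by positivity, fun c hc c' hc' hcc => ⟨F (c, c' - c),
    hkey c (hsub hc) c' (hsub hc') (hcc.trans_lt ((min_le_right _ _).trans_lt (by linarith))), ?_⟩⟩
  have h5 := hδ' c (closedBall_subset_closedBall (min_le_left _ _) hc) (c' - c)
    (hcc.trans (min_le_left _ _))
  have h6 : F (c, 0) = 0 := by
    rw [hF]
    simp only [add_zero, mul_inv_cancel, coord_one]
  rwa [h6, sub_zero] at h5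

end QuotientExpansion

/-! ### Transversality in orbit coordinates -/

section Transversality

variable {d : ℕ} {G : Type*} [TopologicalSpace G] [ChartedSpace (EuclideanSpace ℝ (Fin d)) G]
  [Group G] [LieGroup (𝓡 d) ∞ G] (Γ : Subgroup G) [DiscreteTopology Γ]

variable (d) in
/-- The derivative at the identity of the orbit map of `z`, as a map of the model space. -/
def orbitDeriv (z : G ⧸ Γ) : EuclideanSpace ℝ (Fin d) →L[ℝ] EuclideanSpace ℝ (Fin d) :=
  mfderiv (𝓡 d) (𝓡 d) (fun h : G => h • z) 1

lemma hasFDerivAt_orbit (z : G ⧸ Γ) :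
    HasFDerivAt (fun v => chartAt (EuclideanSpace ℝ (Fin d)) z (uncoord d G v • z))
      (orbitDeriv d Γ z) 0 := by
  have hm : MDifferentiableAt (𝓡 d) (𝓡 d) (fun h : G => h • z) 1 :=
    (contMDiff_smul_const Γ z).contMDiffAt.mdifferentiableAt (by simp)
  have h1 := hm.hasMFDerivAt.2
  simp only [writtenInExtChartAt, extChartAt, mfld_simps] at h1
  rw [one_smul] at h1
  replace h1 : HasFDerivAt (E := EuclideanSpace ℝ (Fin d)) (F := EuclideanSpace ℝ (Fin d))
      ((chartAt (EuclideanSpace ℝ (Fin d)) z) ∘ (fun h : G => h • z) ∘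
        (chartAt (EuclideanSpace ℝ (Fin d)) (1 : G)).symm) (orbitDeriv d Γ z)
      (chartAt (EuclideanSpace ℝ (Fin d)) (1 : G) 1) := hasFDerivWithinAt_univ.1 h1
  have h2 : HasFDerivAt (fun v : EuclideanSpace ℝ (Fin d) =>
      v + chartAt (EuclideanSpace ℝ (Fin d)) (1 : G) 1)
      (ContinuousLinearMap.id ℝ (EuclideanSpace ℝ (Fin d))) 0 :=
    (hasFDerivAt_id (𝕜 := ℝ) (0 : EuclideanSpace ℝ (Fin d))).add_const _
  have h3 := HasFDerivAt.comp (f := fun v : EuclideanSpace ℝ (Fin d) =>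
      v + chartAt (EuclideanSpace ℝ (Fin d)) (1 : G) 1) 0 (by rw [zero_add]; exact h1) h2
  exact h3

/-- An immersed submanifold of the quotient lies locally in the zero set of a `C^1` function of the
orbit coordinates, with nonvanishing derivative in a given transversal direction. -/
theorem exists_orbit_defining_function {k : ℕ} {M : Type*} [TopologicalSpace M]
    [ChartedSpace (EuclideanSpace ℝ (Fin k)) M] [IsManifold (𝓡 k) 1 M] {ι : M → G ⧸ Γ}
    (hι : ContMDiff (𝓡 k) (𝓡 d) 1 ι) (m₀ : M)
    (hinj : Function.Injective (mfderiv (𝓡 k) (𝓡 d) ι m₀)) {v : EuclideanSpace ℝ (Fin d)}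
    (hv : orbitDeriv d Γ (ι m₀) v ∉ range (mfderiv (𝓡 k) (𝓡 d) ι m₀)) :
    ∃ u : EuclideanSpace ℝ (Fin d) → ℝ, ContDiffAt ℝ 1 u 0 ∧ fderiv ℝ u 0 v = 1 ∧
      ∀ r > 0, ∀ᶠ m in 𝓝 m₀, ∃ w, ‖w‖ < r ∧ uncoord d G w • ι m₀ = ι m ∧ u w = 0 := by
  obtain ⟨a, ha⟩ := QuotientGroup.mk_surjective (ι m₀)
  obtain ⟨Dι, hDι⟩ : ∃ L : EuclideanSpace ℝ (Fin k) →L[ℝ] EuclideanSpace ℝ (Fin d),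
    L = mfderiv (𝓡 k) (𝓡 d) ι m₀ := ⟨_, rfl⟩
  have hinj' : Function.Injective Dι := by rw [hDι]; exact hinj
  have hv' : orbitDeriv d Γ (ι m₀) v ∉ range Dι := by rw [hDι]; exact hv
  set p₀ := chartAt (EuclideanSpace ℝ (Fin k)) m₀ m₀ with hp₀
  have hp₀i : (chartAt (EuclideanSpace ℝ (Fin k)) m₀).symm p₀ = m₀ := by simp [hp₀]
  have hm := (hι.mdifferentiableAt (x := m₀) (by simp)).hasMFDerivAt.2
  simp only [writtenInExtChartAt, extChartAt, mfld_simps] at hm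
  replace hm : HasFDerivAt (E := EuclideanSpace ℝ (Fin k)) (F := EuclideanSpace ℝ (Fin d))
      (chartAt (EuclideanSpace ℝ (Fin d)) (ι m₀) ∘ ι ∘
        (chartAt (EuclideanSpace ℝ (Fin k)) m₀).symm) Dι p₀ := by
    rw [hDι]; exact hasFDerivWithinAt_univ.1 hm
  have hsymm : ContMDiffAt (𝓡 k) (𝓡 k) 1 (chartAt (EuclideanSpace ℝ (Fin k)) m₀).symm p₀ :=
    (contMDiffOn_chart_symm (I := 𝓡 k)).contMDiffAt
      ((chartAt _ m₀).open_target.mem_nhds (mem_chart_target _ _))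
  have hιs : ContMDiffAt (𝓡 k) (𝓡 d) 1
      (fun p => ι ((chartAt (EuclideanSpace ℝ (Fin k)) m₀).symm p)) p₀ :=
    hι.contMDiffAt.comp p₀ hsymm
  set J : EuclideanSpace ℝ (Fin k) → EuclideanSpace ℝ (Fin d) := fun p =>
    orbitCoord d Γ a (ι ((chartAt (EuclideanSpace ℝ (Fin k)) m₀).symm p)) with hJ
  have hJ1 : ContDiffAt ℝ 1 J p₀ := by
    rw [← contMDiffAt_iff_contDiffAt]
    refine ContMDiffAt.comp p₀ (g := orbitCoord d Γ a) ?_ hιs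
    rw [hp₀i, ← ha]
    exact (contMDiffAt_orbitCoord Γ a).of_le (by simp)
  have hJ0 : J p₀ = 0 := by
    simp only [hJ]
    rw [hp₀i, ← ha, orbitCoord_self]
  have hback : ∀ᶠ m in 𝓝 m₀, uncoord d G (orbitCoord d Γ a (ι m)) • ι m₀ = ι m := by
    rw [← ha]
    refine hι.continuous.continuousAt.eventually
      (p := fun x => uncoord d G (orbitCoord d Γ a x) • (a : G ⧸ Γ) = x) ?_
    rw [← ha]
    exact eventually_uncoord_orbitCoord Γ a
  -- J is ι read in orbit coordinates; the orbit derivative carries its tangent space to that of ι.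
  -- So injectivity and transversality pass to J.
  have hD : (orbitDeriv d Γ (ι m₀)).comp (fderiv ℝ J p₀) = Dι := by
    have h1 := HasFDerivAt.comp (f := J) p₀ (by rw [hJ0]; exact hasFDerivAt_orbit Γ (ι m₀))
      (hJ1.differentiableAt (by simp)).hasFDerivAt
    refine (h1.congr_of_eventuallyEq ?_).unique hm
    have h2 := hsymm.continuousAt.eventually
      (p := fun m => uncoord d G (orbitCoord d Γ a (ι m)) • ι m₀ = ι m) (by rw [hp₀i]; exact hback)
    filter_upwards [h2] with p hp
    simp only [Function.comp_apply, hJ]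
    rw [hp]
  obtain ⟨u, hu, huv, hu0⟩ := exists_defining_function hJ1 (v := v) (fun x y hxy => hinj' (by
      rw [← hD]; exact congrArg (orbitDeriv d Γ (ι m₀)) hxy)) (fun ⟨x, hx⟩ => hv' ⟨x, by
      rw [← hD, ← hx]; rfl⟩)
  rw [hJ0] at hu huv
  refine ⟨u, hu, huv, fun r hr => ?_⟩
  have h3 : ContinuousAt (chartAt (EuclideanSpace ℝ (Fin k)) m₀) m₀ :=
    (chartAt _ m₀).continuousAt (mem_chart_source _ _)
  have h4 := hJ1.continuousAt.eventually (p := fun w => ‖w‖ < r) (by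
    rw [hJ0]
    filter_upwards [ball_mem_nhds (0 : EuclideanSpace ℝ (Fin d)) hr] with w hw
    simpa using hw)
  filter_upwards [hback, h3.eventually hu0, h3.eventually h4,
    (chartAt (EuclideanSpace ℝ (Fin k)) m₀).open_source.mem_nhds (mem_chart_source _ _)]
    with m h5 h6 h7 h8
  have h9 : J (chartAt (EuclideanSpace ℝ (Fin k)) m₀ m) = orbitCoord d Γ a (ι m) := by
    simp only [hJ]
    rw [(chartAt _ m₀).left_inv h8]
  rw [h9] at h6 h7
  exact ⟨_, h7, h5, h6⟩

end Transversality

/-! ### Orbits of affine maps -/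

lemma one_le_growth (s : ℕ) {ρ : ℝ} (hρ : 1 ≤ ρ) (n : ℕ) : 1 ≤ growth s ρ n :=
  one_le_mul_of_one_le_of_one_le (one_le_pow₀ (by simp)) (one_le_pow₀ hρ)

section AffineOrbits

variable {d : ℕ} {G : Type*} [TopologicalSpace G] [T2Space G]
  [ChartedSpace (EuclideanSpace ℝ (Fin d)) G] [Group G] [LieGroup (𝓡 d) ∞ G]
  (Γ : Subgroup G) [DiscreteTopology Γ]

/-- The point with coordinates `c` in the chart `e` is mapped by `f^n` to a point close to the piece
of the hypersurface `u = 0` in the orbit coordinates at `z`. -/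
def HitsAt (f : G ⧸ Γ → G ⧸ Γ) (e : OpenPartialHomeomorph (G ⧸ Γ) (EuclideanSpace ℝ (Fin d)))
    (z : G ⧸ Γ) (u : EuclideanSpace ℝ (Fin d) → ℝ) (r ε : ℝ) (n : ℕ)
    (c : EuclideanSpace ℝ (Fin d)) : Prop :=
  ∃ a, ‖a‖ ≤ r ∧ f^[n] (e.symm c) = uncoord d G a • z ∧ |u a| < ε

omit [DiscreteTopology Γ] in
/-- The orbit displacement between two hits is nearly tangent to the hypersurface. -/
lemma abs_le_of_hits {f : G ⧸ Γ → G ⧸ Γ} {τ : Monoid.End G} (hτ : ContMDiff (𝓡 d) (𝓡 d) ∞ τ)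
    (hf : ∀ n (h : G) x, f^[n] (h • x) = (τ ^ n : Monoid.End G) h • f^[n] x)
    {R C : ℝ} (hE : CoordEstimates d G R C)
    {e : OpenPartialHomeomorph (G ⧸ Γ) (EuclideanSpace ℝ (Fin d))} {z : G ⧸ Γ}
    {u : EuclideanSpace ℝ (Fin d) → ℝ} {r₃ ε : ℝ} {n : ℕ} {c c' a a' : EuclideanSpace ℝ (Fin d)}
    (ha : f^[n] (e.symm c) = uncoord d G a • z) (hau : |u a| < ε)
    (ha' : f^[n] (e.symm c') = uncoord d G a' • z) (hau' : |u a'| < ε)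
    (har' : ‖a'‖ ≤ r₃) {l : StrongDual ℝ (EuclideanSpace ℝ (Fin d))} {κ₁ κ₂ δ₁ δ₂ K B : ℝ}
    (hexp : ∀ a' ∈ closedBall (0 : EuclideanSpace ℝ (Fin d)) r₃, ∀ h ∈ coordSource d G,
      ‖coord d h‖ ≤ δ₂ → h • uncoord d G a • z = uncoord d G a' • z →
        |u a' - u a - l (coord d h)| ≤ κ₂ * ‖coord d h‖) (hκ₂ : 0 ≤ κ₂)
    {V : EuclideanSpace ℝ (Fin d)} (hV : e.symm c' = uncoord d G V • e.symm c)
    {w₀ : EuclideanSpace ℝ (Fin d)} (hVw : ‖V - w₀‖ ≤ κ₁)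
    (hK0 : 0 ≤ K) (hK : ∀ v, ‖(derivOne d τ ^ n) v‖ ≤ K * ‖v‖) (hδ0 : 0 < δ₁) (hδR : 4 * δ₁ < R)
    (hδC : 8 * C * δ₁ ≤ 1) (hδ₂ : 3 * δ₁ ≤ δ₂) (hVδ : ‖V‖ ≤ δ₁) (hKV : K * ‖V‖ ≤ δ₁)
    (hl : ‖l‖ ≤ B) :
    |l ((derivOne d τ ^ n) w₀)| ≤ 2 * ε + κ₂ * (3 * δ₁) + B * (9 * C * δ₁ ^ 2) + B * (K * κ₁) := by
  have hB : 0 ≤ B := (norm_nonneg _).trans hl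
  obtain ⟨h1, h2⟩ := coord_hom_sub_le hE (τ ^ n : Monoid.End G) (contMDiff_end_pow τ hτ n) (K := K)
    (fun v => by rw [derivOne_pow τ hτ]; exact hK v) hδ0 hδR hδC hVδ hKV
  rw [derivOne_pow τ hτ] at h2
  set h := (τ ^ n : Monoid.End G) (uncoord d G V) with hh
  set w := coord d h with hw
  replace h2 : ‖w - (derivOne d τ ^ n) V‖ ≤ 9 * C * δ₁ ^ 2 := h2
  have h3 : ‖w‖ ≤ 3 * δ₁ := by
    have h4 := norm_add_le (w - (derivOne d τ ^ n) V) ((derivOne d τ ^ n) V)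
    rw [sub_add_cancel] at h4
    have h5 := hK V
    have h6 : 9 * C * δ₁ ^ 2 ≤ 2 * δ₁ := by nlinarith
    linarith
  have h4 : h • uncoord d G a • z = uncoord d G a' • z := by
    rw [← ha, ← ha', hV, hf]
  have h5 := hexp a' (mem_closedBall_zero_iff.2 har') h h1 (h3.trans hδ₂) h4
  -- The four terms are the values of u at the two hits, the error of the expansion of u, the
  -- deviation of τ^n from its differential, and the error of the expansion at the source.
  have h6 : l ((derivOne d τ ^ n) w₀) = (u a' - u a) - (u a' - u a - l w) -
      l (w - (derivOne d τ ^ n) V) - l ((derivOne d τ ^ n) (V - w₀)) := by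
    simp only [map_sub]; ring
  have h7 : |l (w - (derivOne d τ ^ n) V)| ≤ B * (9 * C * δ₁ ^ 2) := by
    refine (l.le_opNorm _).trans ?_
    gcongr
  have h8 : |l ((derivOne d τ ^ n) (V - w₀))| ≤ B * (K * κ₁) := by
    refine (l.le_opNorm _).trans ?_
    gcongr
    exact (hK _).trans (by gcongr)
  have h9 : κ₂ * ‖w‖ ≤ κ₂ * (3 * δ₁) := by gcongr
  rw [abs_lt] at hau hau'
  rw [abs_le] at h5 h7 h8 ⊢
  rw [h6]
  constructor <;> linarith

/-- A functional that is at least 1/4 on a vector of size D / t has norm of order at least t. The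
summand 1 avoids dividing by D = 0. -/
lemma le_norm_of_apply {E : Type*} [NormedAddCommGroup E] [NormedSpace ℝ E] (g : StrongDual ℝ E)
    (q : E) {t D : ℝ} (ht : 0 ≤ t) (hD : 0 ≤ D) (hg : 1 / 4 ≤ g q) (hq : ‖q‖ * t ≤ D) :
    1 / (4 * (D + 1)) * t ≤ ‖g‖ := by
  have h1 : g q ≤ ‖g‖ * ‖q‖ := (le_abs_self _).trans (g.le_opNorm q)
  have h2 : t / 4 ≤ ‖g‖ * (D + 1) := by
    calc t / 4 = 1 / 4 * t := by ring
      _ ≤ ‖g‖ * ‖q‖ * t := by gcongr; linarith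
      _ = ‖g‖ * (‖q‖ * t) := by ring
      _ ≤ ‖g‖ * (D + 1) := by gcongr; linarith
  rw [div_mul_eq_mul_div, one_mul, div_le_iff₀ (by positivity)]
  linarith

set_option maxHeartbeats 1000000 in
/-- Alice can force the orbit to avoid a neighbourhood of a hypersurface that is transversal to the
maximally expanding subspace. -/
theorem exists_canForce_not_hitsAt {f : G ⧸ Γ → G ⧸ Γ} {τ τ' : Monoid.End G}
    (hτ : ContMDiff (𝓡 d) (𝓡 d) ∞ τ) (hτ' : ContMDiff (𝓡 d) (𝓡 d) ∞ τ') (hττ' : τ' * τ = 1)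
    (hf : ∀ n (h : G) x, f^[n] (h • x) = (τ ^ n : Monoid.End G) h • f^[n] x)
    (hρ : 1 < rho (derivOne d τ)) {v : EuclideanSpace ℝ (Fin d)}
    (hv : v ∈ maxExpandingSubspace (derivOne d τ)) (z : G ⧸ Γ)
    {u : EuclideanSpace ℝ (Fin d) → ℝ} (hu : ContDiffAt ℝ 1 u 0) (huv : fderiv ℝ u 0 v = 1) :
    ∃ r₃ > 0, ∀ β : ℝ, 0 < β → β < 1 / 3 → ∀ e ∈ IsManifold.maximalAtlas (𝓡 d) 1 (G ⧸ Γ),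
      CanForce β (fun b => closedBall b.1 b.2 ⊆ e.target)
        {c | ∃ ε > 0, ∀ n, ¬ HitsAt Γ f e z u r₃ ε n c} := by
  let E := EuclideanSpace ℝ (Fin d)
  obtain ⟨R, C, hE⟩ := exists_coordEstimates d G
  have hC := hE.C_pos
  have hR := hE.R_pos
  obtain ⟨A, rA, hrA, hA, hA0, hexpA⟩ := exists_target_expansion Γ z hu
  set T := derivOne d τ with hT
  have hST : derivOne d τ' ∘ₗ T = LinearMap.id := by
    rw [hT, ← derivOne_comp τ' τ hτ' hτ, ← derivOne_id (d := d) (G := G)]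
    exact congrArg _ hττ'
  set t := growth (maxMultiplicity T) (rho T) with ht
  have ht1 : ∀ n, 1 ≤ t n := one_le_growth _ hρ.le
  obtain ⟨CT, hCT, hTn⟩ := exists_norm_pow_le T (one_pos.trans hρ)
  -- A 0 v = 1; replacing v by a vector within ε' and A 0 by a functional within η costs 1/8 each,
  -- so a value of at least 1/2 remains.
  set ε' : ℝ := 1 / (8 * (‖A 0‖ + 1)) with hε'
  set η : ℝ := 1 / (8 * (‖v‖ + 1)) with hη
  have hε'0 : 0 < ε' := by positivity
  have hη0 : 0 < η := by positivity
  have hε'1 : (‖A 0‖ + 1) * ε' = 1 / 8 := by rw [hε']; field_simp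
  have hη1 : η * (‖v‖ + 1) = 1 / 8 := by rw [hη]; field_simp
  have hε'2 : ε' ≤ 1 := by nlinarith [norm_nonneg (A 0)]
  have hη2 : η ≤ 1 := by nlinarith [norm_nonneg v]
  obtain ⟨Cw, hCw, hwn⟩ := exists_small_preimage T (derivOne d τ') hST hρ hv hε'0
  obtain ⟨ra, hra, hAa⟩ := Metric.continuousAt_iff.1 hA η hη0
  have hr₃ : 0 < min rA (ra / 2) := by positivity
  -- This radius is fixed before β and the chart: the neighbourhood of a point of the submanifold
  -- that it controls must not depend on them.
  refine ⟨min rA (ra / 2), hr₃, fun β hβ hβ' e he => ?_⟩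
  set r₃ := min rA (ra / 2) with hr₃'
  have hAη : ∀ a : E, ‖a‖ ≤ r₃ → ‖A a - A 0‖ ≤ η := fun a ha => by
    have h1 : dist a 0 < ra := by
      rw [dist_zero_right]; linarith [ha.trans (min_le_right _ _)]
    have h2 := hAa h1
    rw [dist_eq_norm] at h2
    exact h2.le
  set BA := ‖A 0‖ + 1 with hBA
  have hBA0 : 0 < BA := by positivity
  have hAB : ∀ a : E, ‖a‖ ≤ r₃ → ‖A a‖ ≤ BA := fun a ha => by
    have h1 := norm_add_le (A a - A 0) (A 0)
    rw [sub_add_cancel] at h1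
    linarith [hAη a ha]
  have hAhalf : ∀ a : E, ‖a‖ ≤ r₃ → ∀ w : E, ‖w - v‖ ≤ ε' → 1 / 2 ≤ A a w := fun a ha w hw => by
    have h1 : A a w = A 0 v + A 0 (w - v) + (A a - A 0) w := by
      simp only [map_sub, sub_apply]; ring
    have h2 : |A 0 (w - v)| ≤ 1 / 8 := by
      refine ((A 0).le_opNorm _).trans ?_
      rw [← hε'1]
      gcongr
      linarith
    have h3 : |(A a - A 0) w| ≤ 1 / 8 := by
      refine ((A a - A 0).le_opNorm _).trans ?_
      rw [← hη1]
      gcongr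
      · exact hAη a ha
      · have := norm_add_le (w - v) v
        rw [sub_add_cancel] at this
        linarith
    have h4 : A 0 v = 1 := by rw [hA0]; exact huv
    rw [h1, h4]
    rw [abs_le] at h2 h3
    linarith
  have hlocal : ∀ c₀ ∈ e.target, ∃ r₀ > 0, ∀ b : E × ℝ, closedBall b.1 b.2 ⊆ closedBall c₀ r₀ →
      CanForce β (fun b' => b' = b) {c | ∃ ε > 0, ∀ n, ¬ HitsAt Γ f e z u r₃ ε n c} := by
    intro c₀ hc₀
    obtain ⟨M, P, rM, hrM, hM, hMP, -, hexpM⟩ := exists_source_expansion Γ he hc₀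
    set η₂ : ℝ := 1 / (4 * (BA * CT * ‖P‖ * Cw + 1)) with hη₂
    have hη₂0 : 0 < η₂ := by positivity
    have hη₂1 : BA * CT * ‖P‖ * Cw * η₂ ≤ 1 / 4 := by
      have h1 : (BA * CT * ‖P‖ * Cw + 1) * η₂ = 1 / 4 := by rw [hη₂]; field_simp
      linarith
    obtain ⟨rm, hrm, hMm⟩ := Metric.continuousAt_iff.1 hM (min η₂ 1) (by positivity)
    refine ⟨min rM (rm / 2), by positivity, fun b hb => ?_⟩
    have hMη : ∀ c ∈ closedBall b.1 b.2, ‖M c - M c₀‖ ≤ min η₂ 1 := fun c hc => by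
      have h0 : dist c c₀ ≤ min rM (rm / 2) := hb hc
      have h1 : dist c c₀ < rm := by linarith [h0.trans (min_le_right _ _)]
      have h2 := hMm h1
      rw [dist_eq_norm] at h2
      exact h2.le
    have hbM : closedBall b.1 b.2 ⊆ closedBall c₀ rM :=
      hb.trans (closedBall_subset_closedBall (min_le_left _ _))
    set BM := ‖M c₀‖ + 1 with hBM
    have hBM0 : 0 < BM := by positivity
    have hMB : ∀ c ∈ closedBall b.1 b.2, ‖M c‖ ≤ BM := fun c hc => by
      have h1 := norm_add_le (M c - M c₀) (M c₀)
      rw [sub_add_cancel] at h1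
      linarith [(hMη c hc).trans (min_le_right _ _)]
    -- The functional is tested on P w, where T^n w is close to v and ‖w‖ t n ≤ Cw. At M c₀ the
    -- value is at least 1/2; replacing M c₀ by M c costs at most 1/4, since ‖T^n‖ ≤ CT t n
    -- compensates the smallness of w.
    have hbig : ∀ a : E, ‖a‖ ≤ r₃ → ∀ c ∈ closedBall b.1 b.2, ∀ n,
        1 / (4 * (‖P‖ * Cw + 1)) * t n ≤
          ‖(A a).comp ((LinearMap.toContinuousLinearMap (T ^ n)).comp (M c))‖ := by
      intro a ha c hc n
      obtain ⟨w, hw1, hw2⟩ := hwn n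
      have htn := ht1 n
      refine le_norm_of_apply _ (P w) (by linarith) (by positivity) ?_ ?_
      · have h1 : (A a).comp ((LinearMap.toContinuousLinearMap (T ^ n)).comp (M c)) (P w) =
            A a ((T ^ n) w) + A a ((T ^ n) ((M c - M c₀) (P w))) := by
          rw [← map_add, ← map_add, sub_apply, hMP, add_sub_cancel]
          rfl
        have h2 : |A a ((T ^ n) ((M c - M c₀) (P w)))| ≤ 1 / 4 := by
          calc |A a ((T ^ n) ((M c - M c₀) (P w)))|
              ≤ ‖A a‖ * ‖(T ^ n) ((M c - M c₀) (P w))‖ := (A a).le_opNorm _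
            _ ≤ BA * (CT * t n * ‖(M c - M c₀) (P w)‖) := by
              gcongr
              · exact hAB a ha
              · exact hTn _ _
            _ ≤ BA * (CT * t n * (η₂ * (‖P‖ * ‖w‖))) := by
              gcongr
              refine (ContinuousLinearMap.le_opNorm _ _).trans ?_
              gcongr
              · exact (hMη c hc).trans (min_le_left _ _)
              · exact P.le_opNorm _
            _ = BA * CT * ‖P‖ * η₂ * (‖w‖ * t n) := by ring
            _ ≤ BA * CT * ‖P‖ * η₂ * Cw := by gcongr
            _ = BA * CT * ‖P‖ * Cw * η₂ := by ring
            _ ≤ 1 / 4 := hη₂1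
        rw [h1]
        have h3 := hAhalf a ha _ hw2
        rw [abs_le] at h2
        linarith
      · calc ‖P w‖ * t n ≤ ‖P‖ * ‖w‖ * t n := by gcongr; exact P.le_opNorm w
          _ = ‖P‖ * (‖w‖ * t n) := by ring
          _ ≤ ‖P‖ * Cw := by gcongr
    refine canForce_of_expanding (c := 1 / (4 * (‖P‖ * Cw + 1))) hβ hβ' hρ
      (lt_of_lt_of_le one_pos (ht1 0)) (mul_growth_le _ (one_pos.trans hρ)) (by positivity) b
      (HitsAt Γ f e z u r₃) fun κ hκ => ?_
    -- κ₁, κ₂, δ₀ and the tolerance κδ/8 are chosen so that each of the four error terms of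
    -- `abs_le_of_hits` is at most κδ/4. The constant D below makes both ‖V‖ and CT t n ‖V‖ at most
    -- Dδ.
    set κ₁ : ℝ := min 1 (κ / (8 * (BA * CT + 1))) with hκ₁
    have hκ₁0 : 0 < κ₁ := by positivity
    set D : ℝ := 2 * (CT + 1) * (BM + 1) with hD
    have hD0 : 0 < D := by positivity
    set κ₂ : ℝ := κ / (12 * D) with hκ₂
    have hκ₂0 : 0 < κ₂ := by positivity
    obtain ⟨δs, hδs, hs⟩ := hexpM κ₁ hκ₁0
    obtain ⟨δt, hδt, ht'⟩ := hexpA κ₂ hκ₂0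
    have hδ₀ : ∃ δ₀ > 0, 2 * δ₀ ≤ δs ∧ 3 * (D * δ₀) ≤ δt ∧ 4 * (D * δ₀) < R ∧
        8 * C * (D * δ₀) ≤ 1 ∧ BA * (9 * C * D ^ 2 * δ₀) ≤ κ / 4 := by
      have key : ∀ᶠ δ₀ : ℝ in 𝓝[>] 0, 2 * δ₀ < δs ∧ 3 * (D * δ₀) < δt ∧ 4 * (D * δ₀) < R ∧
          8 * C * (D * δ₀) < 1 ∧ BA * (9 * C * D ^ 2 * δ₀) < κ / 4 := by
        refine eventually_nhdsWithin_of_eventually_nhds ?_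
        have hlt : ∀ (φ : ℝ → ℝ) (y : ℝ), Continuous φ → φ 0 < y → ∀ᶠ x in 𝓝 0, φ x < y :=
          fun φ y hφ h0 => hφ.continuousAt.eventually_lt continuousAt_const h0
        refine (hlt _ _ (by fun_prop) (by simpa using hδs)).and
          ((hlt _ _ (by fun_prop) (by simpa using hδt)).and
          ((hlt _ _ (by fun_prop) (by simpa using hR)).and
          ((hlt _ _ (by fun_prop) (by simp)).and (hlt _ _ (by fun_prop) (by simpa using hκ)))))
      obtain ⟨δ₀, ⟨h1, h2, h3, h4, h5⟩, h6⟩ := (key.and self_mem_nhdsWithin).exists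
      exact ⟨δ₀, h6, h1.le, h2.le, h3, h4.le, h5.le⟩
    obtain ⟨δ₀, hδ₀, hd1, hd2, hd3, hd4, hd5⟩ := hδ₀
    refine ⟨δ₀, hδ₀, fun δ hδ hδδ => ⟨κ * δ / 8, by positivity, fun p r hr hpr n hnr => ?_⟩⟩
    have hDδ : D * δ ≤ D * δ₀ := by gcongr
    have htn := ht1 n
    have hrδ : r ≤ δ := (le_mul_of_one_le_left hr.le htn).trans hnr
    by_cases hex : ∃ c₁ ∈ closedBall p r, HitsAt Γ f e z u r₃ (κ * δ / 8) n c₁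
    · obtain ⟨c₁, hc₁, a₁, ha₁, hfa₁, hua₁⟩ := hex
      -- One bad point c₁ of the ball is used as base point: the hyperplane passes through it, and
      -- every other bad point is compared with it.
      refine ⟨_, (A a₁).comp ((LinearMap.toContinuousLinearMap (T ^ n)).comp (M c₁)) c₁,
        hbig a₁ ha₁ c₁ (hpr hc₁) n, fun c hc => ?_⟩
      rintro ⟨a, ha, hfa, hua⟩
      have hcc : ‖c - c₁‖ ≤ 2 * r := by
        rw [← dist_eq_norm]
        have h1 := dist_triangle_right c c₁ p
        have h2 : dist c p ≤ r := hc
        have h3 : dist c₁ p ≤ r := hc₁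
        linarith
      obtain ⟨V, hV, hVM⟩ := hs c₁ (hbM (hpr hc₁)) c (hbM (hpr hc)) (by linarith)
      have hVn : ‖V‖ ≤ (BM + 1) * (2 * r) := by
        have h1 := norm_add_le (V - M c₁ (c - c₁)) (M c₁ (c - c₁))
        rw [sub_add_cancel] at h1
        have h2 : ‖M c₁ (c - c₁)‖ ≤ BM * (2 * r) := by
          refine (ContinuousLinearMap.le_opNorm _ _).trans ?_
          gcongr
          exact hMB _ (hpr hc₁)
        have h3 : κ₁ * ‖c - c₁‖ ≤ 1 * (2 * r) := by
          gcongr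
          exact min_le_left _ _
        linarith
      have h1 := abs_le_of_hits Γ hτ hf hE hfa₁ hua₁ hfa hua (r₃ := r₃) ha (l := A a₁)
        (κ₁ := κ₁ * (2 * r)) (κ₂ := κ₂) (δ₁ := D * δ) (δ₂ := δt) (K := CT * t n) (B := BA)
        (fun a' ha' h hh hhδ heq => ht' a₁
          (mem_closedBall_zero_iff.2 (ha₁.trans (min_le_left _ _))) a'
          (closedBall_subset_closedBall (min_le_left _ _) ha') h hh hhδ heq) hκ₂0.le hV
        (w₀ := M c₁ (c - c₁)) (hVM.trans (by gcongr)) (by positivity) (hTn n) (by positivity)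
        (by linarith) ((mul_le_mul_of_nonneg_left hDδ (by positivity)).trans hd4)
        (by linarith) ?_ ?_ (hAB a₁ ha₁)
      · rw [← map_sub]
        refine h1.trans ?_
        have e1 : κ₂ * (3 * (D * δ)) = κ * δ / 4 := by
          rw [hκ₂]; field_simp; norm_num
        have e2 : BA * (9 * C * (D * δ) ^ 2) ≤ κ * δ / 4 := by
          calc BA * (9 * C * (D * δ) ^ 2) = BA * (9 * C * D ^ 2 * δ) * δ := by ring
            _ ≤ BA * (9 * C * D ^ 2 * δ₀) * δ := by gcongr
            _ ≤ κ / 4 * δ := by gcongr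
            _ = _ := by ring
        have e3 : BA * (CT * t n * (κ₁ * (2 * r))) ≤ κ * δ / 4 := by
          have e4 : (BA * CT + 1) * (κ / (8 * (BA * CT + 1))) = κ / 8 := by field_simp
          calc BA * (CT * t n * (κ₁ * (2 * r))) = 2 * (BA * CT * κ₁) * (t n * r) := by ring
            _ ≤ 2 * ((BA * CT + 1) * (κ / (8 * (BA * CT + 1)))) * δ := by
              gcongr
              · linarith
              · exact min_le_right _ _
            _ = _ := by rw [e4]; ring
        linarith
      · calc ‖V‖ ≤ (BM + 1) * (2 * r) := hVn
          _ ≤ (BM + 1) * (2 * δ) := by gcongr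
          _ = 2 * (0 + 1) * (BM + 1) * δ := by ring
          _ ≤ D * δ := by rw [hD]; gcongr
      · calc CT * t n * ‖V‖ ≤ CT * t n * ((BM + 1) * (2 * r)) := by gcongr
          _ = 2 * CT * (BM + 1) * (t n * r) := by ring
          _ ≤ 2 * (CT + 1) * (BM + 1) * δ := by gcongr; linarith
    · push Not at hex
      -- Without bad points in the ball any functional of the required size will do.
      exact ⟨_, 0, hbig 0 (by simpa using hr₃.le) p
        (hpr (mem_closedBall_self hr.le)) n, fun c hc hhit => absurd hhit (hex c hc)⟩
  choose! r₀ hr₀ hforce using hlocal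
  -- The expansions at the source are uniform only near a centre c₀. Alice waits until Bob's ball is
  -- small enough; the outcome x of the play itself serves as c₀.
  refine CanForce.of_eventually hβ
    (good := fun b => ∃ c₀ ∈ e.target, closedBall b.1 b.2 ⊆ closedBall c₀ (r₀ c₀))
    (fun b ⟨c₀, hc₀, hb⟩ => hforce c₀ hc₀ b hb) fun B hpos hanti hB0 hlim x hx => ?_
  have hxt : x ∈ e.target := hB0 (hx 0)
  have h1 := hlim.eventually (gt_mem_nhds (half_pos (hr₀ x hxt)))
  obtain ⟨i, hi⟩ := h1.exists
  refine ⟨i, x, hxt, fun y hy => ?_⟩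
  have h2 := dist_triangle_right y x (B i).1
  have h3 : dist y (B i).1 ≤ (B i).2 := hy
  have h4 : dist x (B i).1 ≤ (B i).2 := hx i
  rw [mem_closedBall]
  linarith

end AffineOrbits

/-! ### Two formal rules for forcing -/

section Game

variable {V : Type*} [NormedAddCommGroup V] [InnerProductSpace ℝ V]

lemma canForce_univ {β : ℝ} (hβ : 0 < β) (P : V × ℝ → Prop) : CanForce β P (univ : Set V) :=
  ⟨fun i B => dummyAnswer β (B i), ⟨fun i B B' hB => by rw [hB i le_rfl],
    fun _ _ hB => dummyAnswer_legal hβ _ hB⟩, fun _ _ _ _ x _ => mem_univ x⟩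

lemma CanForce.inter_self {β : ℝ} {S U : Set V}
    (h : CanForce β (fun b => closedBall b.1 b.2 ⊆ U) S) :
    CanForce β (fun b => closedBall b.1 b.2 ⊆ U) (S ∩ U) := by
  obtain ⟨F, hF, h⟩ := h
  exact ⟨F, hF, fun B hB hP hr x hx => ⟨h B hB hP hr x hx, hP (hx 0)⟩⟩

end Game

/-! ### Affine maps and their automorphisms -/

section AffineMap

variable {d : ℕ} {G : Type*} [TopologicalSpace G] [ChartedSpace (EuclideanSpace ℝ (Fin d)) G]
  [Group G] [LieGroup (𝓡 d) ∞ G] {Γ : Subgroup G}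

/-- The automorphism `affineAut g σ`, as an element of the monoid of endomorphisms. -/
def affineEnd {G : Type*} [Group G] (g : G) (σ : G ≃* G) : Monoid.End G := affineAut g σ

/-- The inverse of `affineEnd g σ`. -/
def affineEndInv {G : Type*} [Group G] (g : G) (σ : G ≃* G) : Monoid.End G :=
  σ.symm.toMonoidHom.comp (MulAut.conj g⁻¹).toMonoidHom

lemma contMDiff_affineEnd (g : G) {σ : G ≃* G} (hσ : ContMDiff (𝓡 d) (𝓡 d) ∞ σ) :
    ContMDiff (𝓡 d) (𝓡 d) ∞ (affineEnd g σ) :=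
  ((contMDiff_const (c := g)).mul hσ).mul (contMDiff_const (c := g⁻¹))

lemma contMDiff_affineEndInv (g : G) {σ : G ≃* G} (hσ : ContMDiff (𝓡 d) (𝓡 d) ∞ σ.symm) :
    ContMDiff (𝓡 d) (𝓡 d) ∞ (affineEndInv g σ) :=
  hσ.comp (((contMDiff_const (c := g⁻¹)).mul contMDiff_id).mul (contMDiff_const (c := g⁻¹⁻¹)))

lemma affineEnd_mul_affineEndInv {G : Type*} [Group G] (g : G) (σ : G ≃* G) :
    affineEnd g σ * affineEndInv g σ = 1 := by
  ext x
  change g * σ (σ.symm (g⁻¹ * x * g⁻¹⁻¹)) * g⁻¹ = x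
  simp [mul_assoc]

lemma affineEndInv_mul_affineEnd {G : Type*} [Group G] (g : G) (σ : G ≃* G) :
    affineEndInv g σ * affineEnd g σ = 1 := by
  ext x
  change σ.symm (g⁻¹ * (g * σ x * g⁻¹) * g⁻¹⁻¹) = x
  simp [mul_assoc]

/-- An affine map intertwines the action with the corresponding automorphism. -/
lemma iterate_affine_smul {G : Type*} [Group G] {Γ : Subgroup G} {g : G} {σ : G ≃* G}
    {f : G ⧸ Γ → G ⧸ Γ} (hf : ∀ h : G, f (h : G ⧸ Γ) = ((g * σ h : G) : G ⧸ Γ)) (n : ℕ) (h : G)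
    (x : G ⧸ Γ) : f^[n] (h • x) = (affineEnd g σ ^ n) h • f^[n] x := by
  have h1 : ∀ (h : G) (x : G ⧸ Γ), f (h • x) = affineEnd g σ h • f x := by
    intro h x
    induction x using QuotientGroup.induction_on with
    | H a =>
      change f ((h * a : G) : G ⧸ Γ) = affineEnd g σ h • f (a : G ⧸ Γ)
      rw [hf, hf]
      change _ = ((g * σ h * g⁻¹ * (g * σ a) : G) : G ⧸ Γ)
      rw [map_mul]
      congr 1
      group
  induction n generalizing h x with
  | zero => simp
  | succ n ih =>
    rw [Function.iterate_succ_apply, Function.iterate_succ_apply, h1, ih, pow_succ]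
    rfl

variable [DiscreteTopology Γ]

/-- Orbits that never hit a neighbourhood of the hypersurface `u = 0` do not accumulate on it. -/
lemma notMem_closure_of_not_hitsAt {f : G ⧸ Γ → G ⧸ Γ}
    {e : OpenPartialHomeomorph (G ⧸ Γ) (EuclideanSpace ℝ (Fin d))} {z : G ⧸ Γ}
    {u : EuclideanSpace ℝ (Fin d) → ℝ} {r ε : ℝ} (hε : 0 < ε) {c : EuclideanSpace ℝ (Fin d)}
    (hc : ∀ n, ¬ HitsAt Γ f e z u r ε n c) {w : EuclideanSpace ℝ (Fin d)}
    (hw : w ∈ coordTarget d G) (hwr : ‖w‖ < r) (huw : ContinuousAt u w) (hu0 : u w = 0) :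
    uncoord d G w • z ∉ closure (range fun n : ℕ => f^[n] (e.symm c)) := by
  intro hcl
  have h1 : {a : EuclideanSpace ℝ (Fin d) | ‖a‖ < r ∧ |u a| < ε} ∈ 𝓝 w := by
    refine inter_mem (continuous_norm.continuousAt.eventually (gt_mem_nhds hwr)) ?_
    have h2 : ContinuousAt (fun a => |u a|) w := huw.abs
    exact h2.eventually (gt_mem_nhds (by simpa [hu0] using hε))
  obtain ⟨_, ⟨a, ha, rfl⟩, n, hn⟩ :=
    mem_closure_iff_nhds.1 hcl _ (image_uncoord_smul_mem_nhds Γ z hw h1)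
  exact hc n ⟨a, ha.1.le, hn, ha.2⟩

end AffineMap

/-! ### Avoiding a submanifold near one of its points -/

section Local

variable {d : ℕ} {G : Type*} [TopologicalSpace G] [T2Space G]
  [ChartedSpace (EuclideanSpace ℝ (Fin d)) G] [Group G] [LieGroup (𝓡 d) ∞ G]
  {Γ : Subgroup G} [DiscreteTopology Γ]

/-- Near each of its points, a transversal submanifold can be avoided. -/
theorem exists_nhds_canForce_avoid {g : G} {σ : G ≃* G} (hσ : IsLieAutInto d Γ σ)
    {f : G ⧸ Γ → G ⧸ Γ} (hf : ∀ h : G, f (h : G ⧸ Γ) = ((g * σ h : G) : G ⧸ Γ))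
    {k : ℕ} {M : Type*} [TopologicalSpace M] [ChartedSpace (EuclideanSpace ℝ (Fin k)) M]
    [IsManifold (𝓡 k) 1 M] {ι : M → G ⧸ Γ} (hι : ContMDiff (𝓡 k) (𝓡 d) 1 ι)
    (hι_imm : ∀ m : M, Function.Injective (mfderiv (𝓡 k) (𝓡 d) ι m))
    (hZ : IsTransversal d Γ (maxHorospherical d g σ) k ι) (m : M) :
    ∃ N ∈ 𝓝 m, ∀ β : ℝ, 0 < β → β < 1 / 3 → ∀ e ∈ IsManifold.maximalAtlas (𝓡 d) 1 (G ⧸ Γ),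
      CanForce β (fun b => closedBall b.1 b.2 ⊆ e.target)
        {c | ∀ m' ∈ N, ι m' ∉ closure (range fun n : ℕ => f^[n] (e.symm c))} := by
  have hτ := contMDiff_affineEnd g hσ.contMDiff
  have hτ' := contMDiff_affineEndInv g hσ.contMDiff_symm
  obtain ⟨_, ⟨_, ⟨φ, hφ, hφH, rfl⟩, rfl⟩, hw⟩ := not_subset.1 (hZ m)
  have hv := lieAlgebraOf_connectedLieSubgroup_subset d (affineEnd g σ) (affineEndInv g σ) hτ hτ'
    (affineEnd_mul_affineEndInv g σ) (affineEndInv_mul_affineEnd g σ) hφ hφH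
  have hw' : orbitDeriv d Γ (ι m) (initialVelocity d φ) ∉ range (mfderiv (𝓡 k) (𝓡 d) ι m) := hw
  -- For ρ ≤ 1 the chosen velocity would be 0, whose image is tangent to the submanifold.
  have hρ : 1 < rho (derivOne d (affineEnd g σ)) := by
    by_contra hρ
    rw [maxExpandingSubspace, if_neg hρ, Submodule.mem_bot] at hv
    refine hw' ⟨0, ?_⟩
    rw [hv]
    exact (map_zero (mfderiv (𝓡 k) (𝓡 d) ι m)).trans (map_zero (orbitDeriv d Γ (ι m))).symm
  obtain ⟨u, hu, huv, hN⟩ := exists_orbit_defining_function Γ hι m (hι_imm m) hw'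
  obtain ⟨r₃, hr₃, hforce⟩ := exists_canForce_not_hitsAt Γ (τ := affineEnd g σ)
    (τ' := affineEndInv g σ) hτ hτ' (affineEndInv_mul_affineEnd g σ) (iterate_affine_smul hf) hρ hv
    (ι m) hu huv
  have h1 : ∀ᶠ w in 𝓝 (0 : EuclideanSpace ℝ (Fin d)), ContDiffAt ℝ 1 u w :=
    hu.eventually (by simp)
  obtain ⟨ρ, hρ0, hball⟩ := Metric.mem_nhds_iff.1
    (inter_mem h1 (isOpen_coordTarget.mem_nhds (zero_mem_coordTarget (d := d) (G := G))))
  refine ⟨_, hN (min r₃ ρ) (lt_min hr₃ hρ0), fun β hβ hβ' e he => (hforce β hβ hβ' e he).mono ?_⟩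
  rintro c ⟨ε, hε, hc⟩ m' ⟨w, hwr, hwm, hw0⟩
  rw [lt_min_iff] at hwr
  have h2 := hball (mem_ball_zero_iff.2 hwr.2)
  rw [← hwm]
  exact notMem_closure_of_not_hitsAt hε hc h2.2 hwr.1 (ContDiffAt.continuousAt (n := 1) h2.1) hw0

end Local

end NondenseOrbits

end

theorem theoremA1 {d : ℕ} {G : Type*} [TopologicalSpace G] [T2Space G]
    [ChartedSpace (EuclideanSpace ℝ (Fin d)) G] [Group G] [LieGroup (𝓡 d) ∞ G]
    (Γ : Subgroup G) [DiscreteTopology Γ]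
    (g : G) (σ : G ≃* G) (hσ : IsLieAutInto d Γ σ)
    (f : G ⧸ Γ → G ⧸ Γ) (hf : ∀ h : G, f (h : G ⧸ Γ) = ((g * σ h : G) : G ⧸ Γ))
    {k : ℕ} {M : Type*} [TopologicalSpace M] [SecondCountableTopology M]
    [ChartedSpace (EuclideanSpace ℝ (Fin k)) M] [IsManifold (𝓡 k) 1 M]
    (ι : M → G ⧸ Γ) (hι : ContMDiff (𝓡 k) (𝓡 d) 1 ι) (hι_inj : Function.Injective ι)
    (hι_imm : ∀ m : M, Function.Injective (mfderiv (𝓡 k) (𝓡 d) ι m))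
    (hZ : IsTransversal d Γ (maxHorospherical d g σ) k ι) :
    IsHAW d (avoidanceSet f (Set.range ι)) := by
  intro e he β hβ hβ'
  have hall : CanForce β (fun b => Metric.closedBall b.1 b.2 ⊆ e.target)
      {c | ∀ m, ι m ∉ closure (Set.range fun n : ℕ => f^[n] (e.symm c))} := by
    rcases isEmpty_or_nonempty M with hM | hM
    · exact (canForce_univ hβ _).mono fun c _ m => (hM.false m).elim
    choose N hN hforce using exists_nhds_canForce_avoid hσ hf hι hι_imm hZ
    -- The neighbourhoods are taken in M, not in the quotient, so an immersed submanifold causes no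
    -- difficulty; second countability leaves countably many games.
    obtain ⟨s, hs, hsN⟩ := TopologicalSpace.countable_cover_nhds hN
    have hne : s.Nonempty := by
      obtain ⟨m, hm, -⟩ := Set.mem_iUnion₂.1 (hsN.symm ▸ Set.mem_univ hM.some)
      exact ⟨m, hm⟩
    obtain ⟨p, rfl⟩ := hs.exists_eq_range hne
    refine (CanForce.iInter hβ hβ' fun j => hforce (p j) _ (pow_pos hβ _)
      ((pow_le_of_le_one hβ.le (by linarith) (by positivity)).trans_lt hβ') e he).mono ?_
    intro c hc m
    obtain ⟨_, ⟨j, rfl⟩, hj⟩ := Set.mem_iUnion₂.1 (hsN.symm ▸ Set.mem_univ m)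
    exact Set.mem_iInter.1 hc j m hj
  refine (hall.inter_self.mono ?_).isBetaHAWOn hβ hβ'
  rintro c ⟨hc, hct⟩
  refine ⟨e.symm c, ⟨?_, e.map_target hct⟩, e.right_inv hct⟩
  refine Set.eq_empty_iff_forall_notMem.2 ?_
  rintro _ ⟨hx, m, rfl⟩
  exact hc m hx
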